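/- **Setting.** Knots are considered up to isotopy in $S^3$ and without orientation. For a knot $K$ with Jones polynomial $V_K(t)$ let $\mathrm{span}(K)$ be the difference of the highest and the lowest exponent of $V_K$, let $\det(K)=|V_K(-1)|$, and let $\beta(K)=\log_3\bigl(3\,|V_K(e^{i\pi/3})^2|\bigr)$. The *Gordian graph* $\mathcal K_{\times}$ has the isotopy classes of knots as vertices, two distinct classes being adjacent if they have diagrams related by one crossing change. The *H(2)-Gordian graph* $\mathcal K_{H(2)}$ has the same vertices, two distinct classes being adjacent if they have diagrams related by one component-preserving H(2)-move, i.e. by replacing two parallel arcs )( by $\asymp$ (or conversely), or by smoothing a crossing in one of the two ways (or the converse). For a knot invariant $p$ the *quotient* $\mathcal{QK}^p$ of such a graph has as vertices the classes of knots with the same value of $p$, two distinct classes being adjacent if they contain adjacent knots. A connected graph is regarded as a geodesic metric space $X_G$ with edges of length $1$; it is *$\delta$-hyperbolic* if in every geodesic triangle in $X_G$ (whose corners may be interior points of edges) each side lies in the closed $\delta$-neighbourhood of the union of the other two sides, and *Gromov hyperbolic* if it is $\delta$-hyperbolic for some $\delta\ge 0$. **Theorem.** The quotients of the Gordian graph and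 of the H(2)-Gordian graph by $\beta$, by $\det$ and by $\mathrm{span}$ are all Gromov hyperbolic (in particular connected). More precisely: 1. The two quotients by $\beta$ are trees: the invariant $\beta$ induces an isomorphism of each of them onto the infinite path graph with vertex set $\{1,2,3,\dots\}$ and edges $\{n,n+1\}$. They are $\delta$-hyperbolic for every $\delta\ge 0$. 2. The values of $\det$ on knots are exactly the odd positive integers. In both quotients by $\det$ every class other than that of the unknot is adjacent to the class of the unknot; any two vertices have distance at most $2$; and both graphs are $\delta$-hyperbolic for every $\delta\ge 1$. 3. The values of $\mathrm{span}$ on knots are exactly $0,3,4,5,\dots$. In the quotient of the Gordian graph by $\mathrm{span}$ every class other than that of the unknot is adjacent to the class of the unknot. In the quotient of the H(2)-Gordian graph by $\mathrm{span}$ every class with odd span $n\ge 3$ is adjacent to the class of the unknot, and the classes with spans $n$ and $n+1$ are adjacent for every $n\ge 3$. In both quotients any two vertices have distance at most $2$, and both are $\delta$-hyperbolic for every $\delta\ge 1$. -/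

import Mathlib

namespace KnotGraphs

/-! ## Knot diagrams

A diagram in general position with respect to a height function is read from bottom to top as a
finite word of elementary slices.  In a slice exactly one thing happens, and all other strands run
straight up.  The strands at a given height are numbered `0, 1, 2, …` from left to right. -/

/-- What happens in a slice.
* `cup b` : two neighbouring strands are born at a local minimum; `b` says whether the left one of
  them is oriented upwards, and the right one then has the opposite direction.
* `cap` : two neighbouring strands end at a local maximum.
* `cross s` : two neighbouring strands cross.  If `s = true` then the strand going from bottom left
  to top right is the over strand, if `s = false` it is the under strand. -/
inductive Tile where
  | cup (b : Bool)
  | cap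
  | cross (s : Bool)

namespace Tile

/-- Number of strands entering from below. -/
def inp : Tile → ℕ
  | cup _ => 0
  | cap => 2
  | cross _ => 2

/-- Number of strands leaving at the top. -/
def out : Tile → ℕ
  | cup _ => 2
  | cap => 0
  | cross _ => 2

/-- Forget the orientation. -/
def forget : Tile → Tile
  | cup _ => cup true
  | cap => cap
  | cross s => cross s

/-- Reverse the orientation. -/
def reverse : Tile → Tile
  | cup b => cup (!b)
  | cap => cap
  | cross s => cross s

end Tile

/-- `(x, i)` is the tile `x` with `i` strands to the left of it. -/
abbrev Slice : Type := Tile × ℕ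

/-- The directions (`true` is upwards) of the strands above a tile at position `i`, in terms of
those below it; `none` if the tile does not fit, for want of strands or, for a `cap`, because the
two strands do not have opposite directions. -/
def stepAt : Tile → ℕ → List Bool → Option (List Bool)
  | .cup b, 0, o => some (b :: (!b) :: o)
  | .cap, 0, a :: b :: o => if a = b then none else some o
  | .cross _, 0, a :: b :: o => some (b :: a :: o)
  | x, i + 1, a :: o => (stepAt x i o).map (a :: ·)
  | _, _, _ => none

/-- The sign of a crossing, given the directions of the strands below it (zero for a cup or cap).
If the two strands run in parallel, a crossing `cross true` is positive. -/
def crossingSign : Tile → ℕ → List Bool → ℤ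
  | .cross s, i, o => (if s then 1 else -1) * (if o[i]? = o[i + 1]? then 1 else -1)
  | _, _, _ => 0

/-- Reads a word, starting from strands with directions `o`.  The value is `none` unless all slices
fit and no strand is left at the top; else it is `some z`, where `z` is the sum of the signs of all
crossings. -/
def orient : List Slice → List Bool → Option ℤ
  | [], [] => some 0
  | [], _ :: _ => none
  | (x, i) :: w, o => (stepAt x i o).bind fun o' =>
      (orient w o').map fun z => crossingSign x i o + z

/-! ### Following the strands

The part of a diagram below a given height pairs up the strands at that height.  It is recorded as
a function `m : ℕ → ℕ`, where `m j` is the other end of the arc that ends at strand `j`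
(and `m j = j` if there is no strand `j`). -/

/-- Position, after the insertion of two strands at `i`, of the strand that was at `j`. -/
def shiftUp (i j : ℕ) : ℕ := if j < i then j else j + 2

/-- Position, after the removal of the strands `i` and `i + 1`, of the strand that was at `j`. -/
def shiftDown (i j : ℕ) : ℕ := if j < i then j else j - 2

/-- The pairing after a new minimum with ends `i`, `i + 1`. -/
def cupMatch (i : ℕ) (m : ℕ → ℕ) (j : ℕ) : ℕ :=
  if j = i then i + 1 else if j = i + 1 then i else shiftUp i (m (shiftDown i j))

/-- The pairing after `i` and `i + 1` have been joined by a maximum. -/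
def capMatch (i : ℕ) (m : ℕ → ℕ) (j : ℕ) : ℕ :=
  shiftDown i <|
    if shiftUp i j = m i then m (i + 1)
    else if shiftUp i j = m (i + 1) then m i
    else m (shiftUp i j)

/-- The pairing after the strands `i` and `i + 1` have crossed. -/
def swapMatch (i : ℕ) (m : ℕ → ℕ) (j : ℕ) : ℕ :=
  Equiv.swap i (i + 1) (m (Equiv.swap i (i + 1) j))

/-- The number of closed components completed by the word `w` on top of the pairing `m`: one for
each maximum whose two ends belong to the same arc. -/
def components : List Slice → (ℕ → ℕ) → ℕ
  | [], _ => 0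
  | (.cup _, i) :: w, m => components w (cupMatch i m)
  | (.cap, i) :: w, m => (if m i = i + 1 then 1 else 0) + components w (capMatch i m)
  | (.cross _, i) :: w, m => components w (swapMatch i m)

/-- A diagram of a knot, with an orientation. -/
structure KnotDiagram where
  /-- the word of slices, from bottom to top -/
  word : List Slice
  /-- the writhe -/
  writhe : ℤ
  orient_eq : orient word [] = some writhe
  components_eq : components word id = 1

/-! ### Isotopy -/

/-- The local moves: planar isotopies (`far`, `zigzag`, `slide`) and Reidemeister moves. -/
inductive Move : List Slice → List Slice → Prop
  | far (x y : Tile) (i k : ℕ) :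
      Move [(x, i), (y, i + x.out + k)] [(y, i + x.inp + k), (x, i)]
  | zigzag_left (b : Bool) (i : ℕ) : Move [(.cup b, i), (.cap, i + 1)] []
  | zigzag_right (b : Bool) (i : ℕ) : Move [(.cup b, i + 1), (.cap, i)] []
  | slide_cup (b s : Bool) (i : ℕ) :
      Move [(.cup b, i), (.cross s, i + 1)] [(.cup b, i + 1), (.cross (!s), i)]
  | slide_cap (s : Bool) (i : ℕ) :
      Move [(.cross s, i + 1), (.cap, i)] [(.cross (!s), i), (.cap, i + 1)]
  | reidemeister_one_cup (b s : Bool) (i : ℕ) :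
      Move [(.cup b, i), (.cross s, i)] [(.cup (!b), i)]
  | reidemeister_one_cap (s : Bool) (i : ℕ) :
      Move [(.cross s, i), (.cap, i)] [(.cap, i)]
  | reidemeister_two (s : Bool) (i : ℕ) : Move [(.cross s, i), (.cross (!s), i)] []
  | reidemeister_three (s : Bool) (i : ℕ) :
      Move [(.cross s, i), (.cross s, i + 1), (.cross s, i)]
        [(.cross s, i + 1), (.cross s, i), (.cross s, i + 1)]

/-- `D'` arises from `D` by a local move or by reversing the orientation of the knot. -/
def KnotDiagram.Step (D D' : KnotDiagram) : Prop :=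
  (∃ u l l' v, Move l l' ∧ D.word = u ++ l ++ v ∧ D'.word = u ++ l' ++ v) ∨
    D'.word = D.word.map fun x => (x.1.reverse, x.2)

/-- Isotopy classes of unoriented knots: diagrams up to the equivalence relation generated by
local moves and by the reversal of orientation. -/
def Knot : Type := Quot KnotDiagram.Step

/-- The class of a diagram. -/
def KnotDiagram.knot (D : KnotDiagram) : Knot := Quot.mk _ D

/-- The diagram of the unknot without crossings. -/
def unknotDiagram : KnotDiagram where
  word := [(.cup true, 0), (.cap, 0)]
  writhe := 0
  orient_eq := by decide
  components_eq := by decide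

/-- The unknot. -/
def unknot : Knot := unknotDiagram.knot

/-! ## The Kauffman bracket and the Jones polynomial -/

noncomputable section

open LaurentPolynomial in
/-- The value `δ = -a² - a⁻²` of a loop, in `ℤ[a, a⁻¹]`. -/
def loopValue : LaurentPolynomial ℤ := -T 2 - T (-2)

open LaurentPolynomial in
/-- The Kauffman state sum: each crossing `cross true` is resolved as `a` times two vertical
strands plus `a⁻¹` times a cap followed by a cup (for `cross false` with `a` and `a⁻¹` exchanged),
and a state with `k` loops contributes `δ ^ (k - 1)`.  The pairing `m` and the number `k` record
the arcs and the loops of the part of the state already read. -/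
def bracketAux : List Slice → (ℕ → ℕ) → ℕ → LaurentPolynomial ℤ
  | [], _, k => loopValue ^ (k - 1)
  | (.cup _, i) :: w, m, k => bracketAux w (cupMatch i m) k
  | (.cap, i) :: w, m, k => bracketAux w (capMatch i m) (if m i = i + 1 then k + 1 else k)
  | (.cross s, i) :: w, m, k =>
      T (if s then 1 else -1) * bracketAux w m k +
      T (if s then -1 else 1) * bracketAux w (cupMatch i (capMatch i m))
        (if m i = i + 1 then k + 1 else k)

/-- The Kauffman bracket of a diagram, normalized to be `1` on the circle. -/
def KnotDiagram.bracket (D : KnotDiagram) : LaurentPolynomial ℤ := bracketAux D.word id 0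

open LaurentPolynomial in
/-- `(-a) ^ (-3 z)`. -/
def writheFactor (z : ℤ) : LaurentPolynomial ℤ := ((-1 : ℤˣ) ^ (-3 * z) : ℤˣ) • T (-3 * z)

/-- The bracket with its writhe correction, `X(a) = (-a) ^ (-3 w) ⟨D⟩`. -/
def KnotDiagram.X (D : KnotDiagram) : LaurentPolynomial ℤ := writheFactor D.writhe * D.bracket

/-! ### Isotopy invariance

Everything up to `KnotDiagram.X_step` serves to show that `X` does not change under `Step`, so that
it is defined on isotopy classes. -/

section Invariance

open LaurentPolynomial

/-- `m` is a pairing of the strands `0, …, n - 1`. -/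
def Pairing (n : ℕ) (m : ℕ → ℕ) : Prop :=
  (∀ j, m (m j) = j) ∧ (∀ j, m j = j ↔ n ≤ j)

theorem Pairing.cup {n i : ℕ} {m : ℕ → ℕ} (h : Pairing n m) (hi : i ≤ n) :
    Pairing (n + 2) (cupMatch i m) := by
  obtain ⟨h1, h2⟩ := h
  refine ⟨fun j => ?_, fun j => ?_⟩
  · have := h1 (shiftDown i j)
    grind (splits := 30) [cupMatch, shiftUp, shiftDown]
  · have := h1 (shiftDown i j)
    have := h2 (shiftDown i j)
    grind (splits := 30) [cupMatch, shiftUp, shiftDown]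

theorem shiftUp_inj (i : ℕ) {a b : ℕ} : shiftUp i a = shiftUp i b ↔ a = b := by
  grind [shiftUp]

theorem shiftUp_capMatch {n i : ℕ} {m : ℕ → ℕ} (h : Pairing (n + 2) m) (hi : i ≤ n) (j : ℕ) :
    shiftUp i (capMatch i m j) =
      if shiftUp i j = m i then m (i + 1)
      else if shiftUp i j = m (i + 1) then m i
      else m (shiftUp i j) := by
  obtain ⟨h1, h2⟩ := h
  have e1 := h1 i
  have e2 := h1 (i+1)
  have e3 := h2 i
  have e4 := h2 (i+1)
  have := h1 (shiftUp i j)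
  grind (splits := 30) [capMatch, shiftUp, shiftDown]

theorem Pairing.cap {n i : ℕ} {m : ℕ → ℕ} (h : Pairing (n + 2) m) (hi : i ≤ n) :
    Pairing n (capMatch i m) := by
  have key := shiftUp_capMatch h hi
  obtain ⟨h1, h2⟩ := h
  have e1 := h1 i
  have e2 := h1 (i+1)
  have e3 := h2 i
  have e4 := h2 (i+1)
  refine ⟨fun j => ?_, fun j => ?_⟩
  · have f1 := h1 (shiftUp i j)
    have f2 : shiftUp i j ≠ i ∧ shiftUp i j ≠ i + 1 := by grind [shiftUp]
    rw [← shiftUp_inj i, key, key]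
    generalize shiftUp i j = J at *
    grind (splits := 30)
  · have := h1 (shiftUp i j)
    have := h2 (shiftUp i j)
    grind (splits := 30) [capMatch, shiftUp, shiftDown]

theorem zig1 {n i : ℕ} {m : ℕ → ℕ} (h : Pairing n m) (hi : i < n) :
    capMatch (i+1) (cupMatch i m) = m ∧ cupMatch i m (i+1) ≠ i+2:= by
  obtain ⟨h1, h2⟩ := h
  have e1 := h1 i
  have e3 := h2 i
  constructor
  · funext j
    have := h1 j
    grind (splits := 30) [capMatch, cupMatch, shiftUp, shiftDown]
  · grind (splits := 30) [capMatch, cupMatch, shiftUp, shiftDown]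

theorem zig2 {n i : ℕ} {m : ℕ → ℕ} (h : Pairing n m) (hi : i < n) :
    capMatch i (cupMatch (i+1) m) = m ∧ cupMatch (i+1) m i ≠ i+1:= by
  obtain ⟨h1, h2⟩ := h
  have e1 := h1 i
  have e3 := h2 i
  constructor
  · funext j
    have := h1 j
    grind (splits := 30) [capMatch, cupMatch, shiftUp, shiftDown]
  · grind (splits := 30) [capMatch, cupMatch, shiftUp, shiftDown]

theorem capcup {n i : ℕ} {m : ℕ → ℕ} (h : Pairing n m) :
    capMatch i (cupMatch i m) = m ∧ cupMatch i m i = i+1:= by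
  obtain ⟨h1, h2⟩ := h
  constructor
  · funext j
    have := h1 j
    grind (splits := 30) [capMatch, cupMatch, shiftUp, shiftDown]
  · grind (splits := 30) [capMatch, cupMatch, shiftUp, shiftDown]

theorem cup_cup (i k : ℕ) (m : ℕ → ℕ) :
    cupMatch (i+2+k) (cupMatch i m) = cupMatch i (cupMatch (i+k) m) := by
  funext j
  grind (splits := 30) [capMatch, cupMatch, shiftUp, shiftDown]

theorem cap_cup {n : ℕ} (i k : ℕ) {m : ℕ → ℕ} (h : Pairing (n+2) m) (hi : i + k ≤ n) :
    capMatch (i+2+k) (cupMatch i m) = cupMatch i (capMatch (i+k) m) ∧ 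
    (cupMatch i m (i+2+k) = i+2+k+1 ↔ m (i+k) = i+k+1) := by
  obtain ⟨h1, h2⟩ := h
  have e1 := h1 (i+k)
  have e2 := h1 (i+k+1)
  have e3 := h2 (i+k)
  have e4 := h2 (i+k+1)
  constructor
  · funext j
    have := h1 (shiftUp (i+k) (shiftDown i j))
    grind (splits := 30) [capMatch, cupMatch, shiftUp, shiftDown]
  · grind (splits := 30) [capMatch, cupMatch, shiftUp, shiftDown]

theorem cup_cap {n : ℕ} (i k : ℕ) {m : ℕ → ℕ} (h : Pairing (n+2) m) (hi : i + k ≤ n) :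
    cupMatch (i+k) (capMatch i m) = capMatch i (cupMatch (i+2+k) m) ∧ 
    (cupMatch (i+2+k) m i = i+1 ↔ m i = i+1) := by
  obtain ⟨h1, h2⟩ := h
  have e1 := h1 (i)
  have e2 := h1 (i+1)
  have e3 := h2 (i)
  have e4 := h2 (i+1)
  constructor
  · funext j
    have := h1 (shiftDown (i+2+k) (shiftUp i j))
    grind (splits := 30) [capMatch, cupMatch, shiftUp, shiftDown]
  · grind (splits := 30) [capMatch, cupMatch, shiftUp, shiftDown]

theorem cap_cap {n : ℕ} (i k : ℕ) {m : ℕ → ℕ} (h : Pairing (n+4) m) (hi : i + k ≤ n) :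
    capMatch (i+k) (capMatch i m) = capMatch i (capMatch (i+2+k) m) ∧
    ((m i = i + 1 ∧ capMatch i m (i+k) = i+k+1 ↔
       m (i+2+k) = i+2+k+1 ∧ capMatch (i+2+k) m i = i+1) ∧
     (m i = i + 1 ∨ capMatch i m (i+k) = i+k+1 ↔
       m (i+2+k) = i+2+k+1 ∨ capMatch (i+2+k) m i = i+1)) := by
  have k1 := shiftUp_capMatch (n := n+2) (i := i) h (by omega)
  have k2 := shiftUp_capMatch (n := n+2) (i := i+2+k) h (by omega)
  have k3 := shiftUp_capMatch (n := n) (i := i+k) (h.cap (i := i) (by omega)) (by omega)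
  have k4 := shiftUp_capMatch (n := n) (i := i) (h.cap (i := i+2+k) (by omega)) (by omega)
  have l1 := k1 (i+k)
  have l2 := k1 (i+k+1)
  have l3 := k2 i
  have l4 := k2 (i+1)
  have s1 : shiftUp i (i+k) = i+2+k := by grind [shiftUp]
  have s2 : shiftUp i (i+k+1) = i+2+k+1 := by grind [shiftUp]
  have s3 : shiftUp (i+2+k) i = i := by grind [shiftUp]
  have s4 : shiftUp (i+2+k) (i+1) = i+1 := by grind [shiftUp]
  obtain ⟨h1, h2⟩ := h
  have e1 := h1 (i)
  have e2 := h1 (i+1)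
  have e3 := h2 (i)
  have e4 := h2 (i+1)
  have f1 := h1 (i+2+k)
  have f2 := h1 (i+2+k+1)
  have f3 := h2 (i+2+k)
  have f4 := h2 (i+2+k+1)
  rw [s1] at l1
  rw [s2] at l2
  rw [s3] at l3
  rw [s4] at l4
  constructor
  · funext j
    have c : ∀ j, shiftUp i (shiftUp (i+k) j) = shiftUp (i+2+k) (shiftUp i j) := by
      intro j; grind [shiftUp]
    have m1 := k1 (shiftUp (i+k) j)
    have m2 := k2 (shiftUp i j)
    have m3 := k3 j
    have m4 := k4 j
    rw [← shiftUp_inj (i+k), ← shiftUp_inj i, c (capMatch i _ j), m3, m4]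
    have g : shiftUp i (shiftUp (i+k) j) ≠ i ∧ shiftUp i (shiftUp (i+k) j) ≠ i + 1 ∧
      shiftUp i (shiftUp (i+k) j) ≠ i+2+k ∧ shiftUp i (shiftUp (i+k) j) ≠ i+2+k + 1 := by
      clear * -
      grind [shiftUp]
    have p1 : (shiftUp (i+k) j = capMatch i m (i+k)) ↔ _ := (shiftUp_inj i).symm
    have p2 : (shiftUp (i+k) j = capMatch i m (i+k+1)) ↔ _ := (shiftUp_inj i).symm
    have p3 : (shiftUp i j = capMatch (i+2+k) m i) ↔ _ := (shiftUp_inj (i+2+k)).symm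
    have p4 : (shiftUp i j = capMatch (i+2+k) m (i+1)) ↔ _ := (shiftUp_inj (i+2+k)).symm
    have J1 := h1 (shiftUp i (shiftUp (i+k) j))
    simp only [p1, p2, p3, p4, apply_ite (shiftUp i), apply_ite (shiftUp (i+2+k)), ← c j] at *
    rw [m1, m2, l1, l2, l3, l4]
    generalize shiftUp i (shiftUp (i+k) j) = J at *
    clear * - e1 e2 f1 f2 e3 e4 f3 f4 hi g J1
    generalize hp : i + 2 + k = p at *
    have : i + 1 < p := by omega
    grind (splits := 40)
  · have p1 : (capMatch i m (i+k) = i+k+1) ↔ _ := (shiftUp_inj i).symm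
    have p2 : (capMatch (i+2+k) m i = i+1) ↔ _ := (shiftUp_inj (i+2+k)).symm
    rw [p1, p2, l1, l3, s2, s4]
    clear * - e1 e2 f1 f2 e3 e4 f3 f4 hi
    generalize hp : i + 2 + k = p at *
    have : i + 1 < p := by omega
    constructor <;> grind (splits := 40)

theorem stepAt_length {x : Tile} {i : ℕ} {o o' : List Bool} (h : stepAt x i o = some o') :
    i + x.inp ≤ o.length ∧ o'.length + x.inp = o.length + x.out := by
  induction i generalizing o o' with
  | zero =>
    rcases x with b | _ | s <;> rcases o with _ | ⟨a, _ | ⟨c, o⟩⟩ <;>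
      simp [stepAt, Tile.inp, Tile.out] at h ⊢ <;> (try replace h := h.2) <;> (try subst h) <;> simp
  | succ i ih =>
    rcases o with _ | ⟨a, o⟩
    · rcases x with b | _ | s <;> simp [stepAt] at h
    · have h' : (stepAt x i o).map (a :: ·) = some o' := by
        rcases x with b | _ | s <;> simpa [stepAt] using h
      obtain ⟨p, hp, rfl⟩ := Option.map_eq_some_iff.1 h'
      have := ih hp
      simp only [List.length_cons]
      omega

theorem stepAt_succ_cons (x : Tile) (i : ℕ) (a : Bool) (o : List Bool) :
    stepAt x (i + 1) (a :: o) = (stepAt x i o).map (a :: ·) := by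
  rcases x with b | _ | s <;> simp [stepAt]

theorem stepAt_succ_nil (x : Tile) (i : ℕ) : stepAt x (i + 1) [] = none := by
  rcases x with b | _ | s <;> simp [stepAt]

theorem crossingSign_succ_cons (x : Tile) (i : ℕ) (a : Bool) (o : List Bool) :
    crossingSign x (i + 1) (a :: o) = crossingSign x i o := by
  rcases x with b | _ | s <;> simp [crossingSign]

/-- The directions at the top, and the sum of the signs, of a word. -/
def run : List Slice → List Bool → Option (List Bool × ℤ)
  | [], o => some (o, 0)
  | (x, i) :: w, o => (stepAt x i o).bind fun o' =>
      (run w o').map fun p => (p.1, crossingSign x i o + p.2)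

theorem orient_append (l v : List Slice) (o : List Bool) :
    orient (l ++ v) o = (run l o).bind fun p => (orient v p.1).map fun z => p.2 + z := by
  induction l generalizing o with
  | nil => simp [run]
  | cons x l ih =>
    simp only [List.cons_append, orient, run, ih]
    rcases stepAt x.1 x.2 o with _ | o' <;> simp
    rcases run l o' with _ | p <;> simp [Function.comp_def, add_assoc]

theorem run_shift (l : List Slice) (a : Bool) (o : List Bool) :
    run (l.map fun x => (x.1, x.2 + 1)) (a :: o) = (run l o).map fun p => (a :: p.1, p.2) := by
  induction l generalizing o with
  | nil => simp [run]
  | cons x l ih =>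
    simp only [List.map_cons, run, stepAt_succ_cons, crossingSign_succ_cons]
    rcases stepAt x.1 x.2 o with _ | o' <;> simp [ih]
    rfl

/-- If the run of `l` is defined then the run of `l'` has the same result, up to `c` in the sign. -/
def RunLE (l l' : List Slice) (c : ℤ) : Prop :=
  ∀ o p, run l o = some p → run l' o = some (p.1, p.2 + c)

theorem RunLE.shift {x : Slice} {l l' : List Slice} {c : ℤ} (h : RunLE (x :: l) l' c) :
    RunLE ((x.1, x.2 + 1) :: l.map fun x => (x.1, x.2 + 1)) (l'.map fun x => (x.1, x.2 + 1)) c := by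
  rintro (_ | ⟨a, o⟩) p hp
  · simp [run, stepAt_succ_nil] at hp
  · have e := run_shift (x :: l) a o
    rw [List.map_cons] at e
    rw [e] at hp
    obtain ⟨q, hq, rfl⟩ := Option.map_eq_some_iff.1 hp
    rw [run_shift, h _ _ hq]
    rfl

theorem stepAt_far (x y : Tile) (k : ℕ) :
    RunLE [(x, 0), (y, x.out + k)] [(y, x.inp + k), (x, 0)] 0 := by
  intro o p
  have z : ∀ b (q : List Bool), crossingSign (.cup b) 0 q = 0 ∧ crossingSign .cap 0 q = 0 :=
    fun b q => ⟨rfl, rfl⟩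
  rcases x with b | _ | s
  · simp only [run, Tile.out, Tile.inp, stepAt, Option.bind_some, zero_add,
      show 2 + k = k + 1 + 1 by omega, stepAt_succ_cons, crossingSign_succ_cons, (z _ _).1]
    generalize crossingSign y k o = t
    rcases stepAt y k o with _ | q <;> simp [stepAt]
  · simp only [run, Tile.out, Tile.inp, zero_add, show 2 + k = k + 1 + 1 by omega]
    rcases o with _ | ⟨a, _ | ⟨c, o⟩⟩
    · simp [stepAt]
    · simp [stepAt]
    · simp only [stepAt_succ_cons, crossingSign_succ_cons, stepAt, (z true _).2]
      split_ifs with hac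
      · simp
      · simp only [Option.bind_some]
        generalize crossingSign y k o = t
        rcases stepAt y k o with _ | q <;> simp [stepAt, hac]
  · simp only [run, Tile.out, Tile.inp, zero_add, show 2 + k = k + 1 + 1 by omega]
    rcases o with _ | ⟨a, _ | ⟨c, o⟩⟩
    · simp [stepAt]
    · simp [stepAt]
    · simp only [stepAt_succ_cons, crossingSign_succ_cons, stepAt, Option.bind_some]
      generalize crossingSign y k o = t
      rcases stepAt y k o with _ | q <;> simp [crossingSign, stepAt]
      rintro rfl; simp [add_comm]


/-- The factor contributed by joining `i` and `i + 1`. -/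
def loopFactor (i : ℕ) (m : ℕ → ℕ) : LaurentPolynomial ℤ := if m i = i + 1 then loopValue else 1

def cupOp (i : ℕ) (F : (ℕ → ℕ) → LaurentPolynomial ℤ) (m : ℕ → ℕ) : LaurentPolynomial ℤ :=
  F (cupMatch i m)

def capOp (i : ℕ) (F : (ℕ → ℕ) → LaurentPolynomial ℤ) (m : ℕ → ℕ) : LaurentPolynomial ℤ :=
  loopFactor i m * F (capMatch i m)

def tileOp : Tile → ℕ → ((ℕ → ℕ) → LaurentPolynomial ℤ) → (ℕ → ℕ) → LaurentPolynomial ℤ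
  | .cup _, i, F, m => cupOp i F m
  | .cap, i, F, m => capOp i F m
  | .cross s, i, F, m =>
      T (if s then 1 else -1) * F m + T (if s then -1 else 1) * capOp i (cupOp i F) m

/-- State sum with a factor for each loop. -/
def loopBracket : List Slice → (ℕ → ℕ) → LaurentPolynomial ℤ
  | [], _ => 1
  | (x, i) :: w, m => tileOp x i (loopBracket w) m

theorem tileOp_lin (y : Tile) (j : ℕ) (F G : (ℕ → ℕ) → LaurentPolynomial ℤ)
    (a b : LaurentPolynomial ℤ) (m : ℕ → ℕ) :
    tileOp y j (fun m => a * F m + b * G m) m = a * tileOp y j F m + b * tileOp y j G m := by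
  rcases y with _ | _ | s <;> simp only [tileOp, cupOp, capOp] <;> ring

theorem far_cup (y : Tile) (i k n : ℕ) (F : (ℕ → ℕ) → LaurentPolynomial ℤ) (m : ℕ → ℕ)
    (h : Pairing n m) (hi : i + k + y.inp ≤ n) :
    cupOp i (tileOp y (i+2+k) F) m = tileOp y (i+k) (cupOp i F) m := by
  have hcap : ∀ F, 2 ≤ n → i + k + 2 ≤ n →
     cupOp i (capOp (i+2+k) F) m = capOp (i+k) (cupOp i F) m := by
    intro F h2 h3
    obtain ⟨n, rfl⟩ : ∃ n', n = n' + 2 := ⟨n - 2, by omega⟩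
    obtain ⟨e1, e2⟩ := cap_cup i k h (by omega)
    simp only [cupOp, capOp, loopFactor, e1, e2]
  rcases y with _ | _ | s
  · simp only [tileOp, cupOp, cup_cup]
  · simp only [Tile.inp] at hi
    simp only [tileOp]
    exact hcap F (by omega) hi
  · simp only [Tile.inp] at hi
    have := hcap (cupOp (i+2+k) F) (by omega) hi
    rw [cupOp] at this ⊢
    simp only [tileOp]
    rw [this]
    simp only [cupOp, capOp, cup_cup]

theorem far_cap (y : Tile) (i k n : ℕ) (F : (ℕ → ℕ) → LaurentPolynomial ℤ) (m : ℕ → ℕ)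
    (h : Pairing n m) (hi : i + 2 + k + y.inp ≤ n) :
    capOp i (tileOp y (i+k) F) m = tileOp y (i+2+k) (capOp i F) m := by
  have hcup : ∀ F n m, Pairing n m → i + 2 + k ≤ n → 
     capOp i (cupOp (i+k) F) m = cupOp (i+2+k) (capOp i F) m := by
    intro F n m h h3
    obtain ⟨n, rfl⟩ : ∃ n', n = n' + 2 := ⟨n - 2, by omega⟩
    obtain ⟨e1, e2⟩ := cup_cap i k h (by omega)
    simp only [cupOp, capOp, loopFactor, e1, e2]
  have hcap : ∀ F, i + 2 + k + 2 ≤ n →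
     capOp i (capOp (i+k) F) m = capOp (i+2+k) (capOp i F) m := by
    intro F h3
    obtain ⟨n, rfl⟩ : ∃ n', n = n' + 4 := ⟨n - 4, by omega⟩
    obtain ⟨e1, e2, e3⟩ := cap_cap i k h (by omega)
    simp only [capOp, loopFactor, e1]
    rw [← mul_assoc, ← mul_assoc]
    congr 1
    by_cases p1 : m i = i + 1 <;> by_cases p2 : capMatch i m (i+k) = i+k+1 <;>
    by_cases p3 : m (i+2+k) = i+2+k+1 <;> by_cases p4 : capMatch (i+2+k) m i = i+1 <;>
    simp only [p1, p2, p3, p4, if_true, if_false, mul_one, one_mul] at e2 e3 ⊢ <;> simp_all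
  rcases y with _ | _ | s
  · simp only [Tile.inp] at hi
    exact hcup F n m h hi
  · simp only [Tile.inp] at hi
    exact hcap F hi
  · simp only [Tile.inp] at hi
    have e1 := hcap (cupOp (i+k) F) hi
    obtain ⟨n, rfl⟩ : ∃ n', n = n' + 2 := ⟨n - 2, by omega⟩
    have e2 := hcup F _ _ (h.cap (i := i+2+k) (by omega)) (by omega)
    simp only [tileOp]
    have e3 : capOp (i+2+k) (capOp i (cupOp (i+k) F)) m = capOp (i+2+k) (cupOp (i+2+k) (capOp i F)) m := by
      simp only [capOp] at e2 ⊢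
      rw [e2]
    rw [← e3, ← e1]
    simp only [capOp, tileOp]
    ring

theorem far_all (x y : Tile) (i k n : ℕ) (F : (ℕ → ℕ) → LaurentPolynomial ℤ) (m : ℕ → ℕ)
    (h : Pairing n m) (hi : i + x.inp + k + y.inp ≤ n) :
    tileOp x i (tileOp y (i+x.out+k) F) m = tileOp y (i+x.inp+k) (tileOp x i F) m := by
  rcases x with b | _ | s
  · exact far_cup y i k n F m h hi
  · exact far_cap y i k n F m h hi
  · have hi : i + 2 + k + y.inp ≤ n := hi
    change tileOp (.cross s) i (tileOp y (i+2+k) F) m = tileOp y (i+2+k) (tileOp (.cross s) i F) m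
    have e : tileOp (.cross s) i F = fun m => T (if s then 1 else -1) * F m +
      T (if s then -1 else 1) * capOp i (cupOp i F) m := rfl
    rw [e, tileOp_lin]
    have e2 : capOp i (cupOp i (tileOp y (i+2+k) F)) m = tileOp y (i+2+k) (capOp i (cupOp i F)) m := by
      rw [← far_cap y i k n _ m h hi]
      obtain ⟨n, rfl⟩ : ∃ n', n = n' + 2 := ⟨n - 2, by omega⟩
      simp only [capOp]
      rw [far_cup y i k n F _ (h.cap (by omega)) (by omega)]
    rw [← e2]
    rfl

theorem cup_zig (i n : ℕ) (F : (ℕ → ℕ) → LaurentPolynomial ℤ) (m : ℕ → ℕ)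
    (h : Pairing n m) (hi : i < n) : cupOp i (capOp (i+1) F) m = F m := by
  obtain ⟨e1, e2⟩ := zig1 h hi
  simp [cupOp, capOp, loopFactor, e1, e2]

theorem cup_zag (i n : ℕ) (F : (ℕ → ℕ) → LaurentPolynomial ℤ) (m : ℕ → ℕ)
    (h : Pairing n m) (hi : i < n) : cupOp (i+1) (capOp i F) m = F m := by
  obtain ⟨e1, e2⟩ := zig2 h hi
  simp [cupOp, capOp, loopFactor, e1, e2]

theorem cup_loop (i n : ℕ) (F : (ℕ → ℕ) → LaurentPolynomial ℤ) (m : ℕ → ℕ)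
    (h : Pairing n m) : cupOp i (capOp i F) m = loopValue * F m := by
  obtain ⟨e1, e2⟩ := capcup (i := i) h
  simp [cupOp, capOp, loopFactor, e1, e2]

/-- The hook. -/
def hookOp (i : ℕ) (F : (ℕ → ℕ) → LaurentPolynomial ℤ) (m : ℕ → ℕ) : LaurentPolynomial ℤ :=
  capOp i (cupOp i F) m

theorem hookOp_lin (j : ℕ) (F G : (ℕ → ℕ) → LaurentPolynomial ℤ)
    (a b : LaurentPolynomial ℤ) (m : ℕ → ℕ) :
    hookOp j (fun m => a * F m + b * G m) m = a * hookOp j F m + b * hookOp j G m := by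
  simp only [hookOp, cupOp, capOp]; ring

theorem cap_congr (i n : ℕ) (F G : (ℕ → ℕ) → LaurentPolynomial ℤ) (m : ℕ → ℕ)
    (h : Pairing n m) (hi : i + 2 ≤ n) (e : ∀ n' m, n' + 2 = n → Pairing n' m → F m = G m) :
    capOp i F m = capOp i G m := by
  obtain ⟨n, rfl⟩ : ∃ n', n = n' + 2 := ⟨n - 2, by omega⟩
  simp only [capOp]
  rw [e _ _ rfl (h.cap (by omega))]

theorem hook_hook (i n : ℕ) (F : (ℕ → ℕ) → LaurentPolynomial ℤ) (m : ℕ → ℕ)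
    (h : Pairing n m) (hi : i + 2 ≤ n) : hookOp i (hookOp i F) m = loopValue * hookOp i F m := by
  have : hookOp i (hookOp i F) m = capOp i (fun m => loopValue * cupOp i F m) m :=
    cap_congr i n _ _ m h hi fun n' m' _ h' => cup_loop i n' _ m' h'
  rw [this, hookOp, capOp, capOp]; ring

theorem hook_up (i n : ℕ) (F : (ℕ → ℕ) → LaurentPolynomial ℤ) (m : ℕ → ℕ)
    (h : Pairing n m) (hi : i + 3 ≤ n) :
    hookOp i (hookOp (i+1) (hookOp i F)) m = hookOp i F m := by
  refine cap_congr i n _ _ m h (by omega) fun n' m' hn h' => ?_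
  have := cup_zig i n' (cupOp (i+1) (hookOp i F)) m' h' (by omega)
  refine this.trans ?_
  exact cup_zag i n' _ m' h' (by omega)

theorem hook_down (i n : ℕ) (F : (ℕ → ℕ) → LaurentPolynomial ℤ) (m : ℕ → ℕ)
    (h : Pairing n m) (hi : i + 3 ≤ n) :
    hookOp (i+1) (hookOp i (hookOp (i+1) F)) m = hookOp (i+1) F m := by
  refine cap_congr (i+1) n _ _ m h (by omega) fun n' m' hn h' => ?_
  have := cup_zag i n' (cupOp i (hookOp (i+1) F)) m' h' (by omega)
  refine this.trans ?_
  exact cup_zig i n' _ m' h' (by omega)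

theorem tileOp_cross (s : Bool) (i : ℕ) (F : (ℕ → ℕ) → LaurentPolynomial ℤ) :
    tileOp (.cross s) i F = fun m => T (if s then 1 else -1) * F m +
      T (if s then -1 else 1) * hookOp i F m := rfl

theorem coeffs (s : Bool) : ∃ a b : LaurentPolynomial ℤ, T (if s then 1 else -1) = a ∧
    T (if s then -1 else 1) = b ∧ a * b = 1 ∧ loopValue = - a ^ 2 - b ^ 2 := by
  refine ⟨_, _, rfl, rfl, ?_, ?_⟩
  · rw [← T_add]; cases s <;> simp
  · rw [loopValue, T_pow, T_pow]; cases s <;> simp <;> ring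

theorem r2_op (s : Bool) (i n : ℕ) (F : (ℕ → ℕ) → LaurentPolynomial ℤ) (m : ℕ → ℕ)
    (h : Pairing n m) (hi : i + 2 ≤ n) :
    tileOp (.cross s) i (tileOp (.cross (!s)) i F) m = F m := by
  obtain ⟨a, b, ha, hb, hab, hd⟩ := coeffs s
  have ha' : T (if (!s) then -1 else 1) = a := by rw [← ha]; cases s <;> simp
  have hb' : T (if (!s) then 1 else -1) = b := by rw [← hb]; cases s <;> simp
  simp only [tileOp_cross, ha, hb, ha', hb', hookOp_lin, hook_hook i n F m h hi]
  rw [hd]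
  linear_combination (F m + (-a^2 - b^2) * hookOp i F m) * hab

theorem r3_op (s : Bool) (i n : ℕ) (F : (ℕ → ℕ) → LaurentPolynomial ℤ) (m : ℕ → ℕ)
    (h : Pairing n m) (hi : i + 3 ≤ n) :
    tileOp (.cross s) i (tileOp (.cross s) (i+1) (tileOp (.cross s) i F)) m =
    tileOp (.cross s) (i+1) (tileOp (.cross s) i (tileOp (.cross s) (i+1) F)) m := by
  obtain ⟨a, b, ha, hb, hab, hd⟩ := coeffs s
  simp only [tileOp_cross, ha, hb, hookOp_lin, hook_hook i n F m h (by omega),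
    hook_hook (i+1) n F m h (by omega), hook_up i n F m h hi, hook_down i n F m h hi]
  rw [hd]
  linear_combination (hookOp i F m - hookOp (i+1) F m) * (- b^3 + a - a * (a * b + 1)) * hab


theorem writheFactor_add (y z : ℤ) :
    writheFactor (y + z) = writheFactor y * writheFactor z := by
  simp only [writheFactor, mul_add, zpow_add, T_add, smul_mul_smul_comm]

theorem writheFactor_zero : writheFactor 0 = 1 := by simp [writheFactor]

theorem writheFactor_one : writheFactor 1 = -T (-3) := by
  rw [writheFactor, show (-1 : ℤˣ) ^ (-3 * 1 : ℤ) = -1 by decide, Units.smul_def]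
  norm_num only [Units.val_neg, Units.val_one, neg_smul, one_smul]

theorem writheFactor_neg_one : writheFactor (-1) = -T 3 := by
  rw [writheFactor, show (-1 : ℤˣ) ^ (-3 * -1 : ℤ) = -1 by decide, Units.smul_def]
  norm_num only [Units.val_neg, Units.val_one, neg_smul, one_smul]

theorem r1_coeff (s : Bool) : (T (if s then 1 else -1) : LaurentPolynomial ℤ) +
    T (if s then -1 else 1) * loopValue = writheFactor (if s then 1 else -1) := by
  cases s
  · simp only [Bool.false_eq_true, if_false, writheFactor_neg_one, loopValue, mul_sub, mul_neg,
      ← T_add]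
    norm_num only
    abel
  · simp only [if_true, writheFactor_one, loopValue, mul_sub, mul_neg, ← T_add]
    norm_num only
    abel

theorem two_slices {x y : Slice} {r : List Slice} {o : List Bool} {q}
    (hq : run (x :: y :: r) o = some q) :
    x.2 + x.1.inp ≤ o.length ∧ y.2 + y.1.inp + x.1.inp ≤ o.length + x.1.out := by
  simp only [run] at hq
  obtain ⟨o1, h1, hq⟩ := Option.bind_eq_some_iff.1 hq
  obtain ⟨q', hq', -⟩ := Option.map_eq_some_iff.1 hq
  obtain ⟨o2, h2, -⟩ := Option.bind_eq_some_iff.1 hq'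
  have := stepAt_length h1
  have := stepAt_length h2
  omega

theorem Move.spec {l l' : List Slice} (h : Move l l') :
    ∃ c : ℤ, RunLE l l' c ∧ ∀ o p v m, run l o = some p → Pairing o.length m →
      loopBracket (l ++ v) m = writheFactor c * loopBracket (l' ++ v) m := by
  cases h with
  | far x y i k =>
    refine ⟨0, ?_, ?_⟩
    · induction i with
      | zero => simpa using stepAt_far x y k
      | succ i ih => 
        have := ih.shift
        simp only [List.map_cons, List.map_nil] at this
        rwa [show i + 1 + x.out + k = i + x.out + k + 1 by omega,
          show i + 1 + x.inp + k = i + x.inp + k + 1 by omega]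
    · intro o p v m hp hm
      have := two_slices hp
      rw [writheFactor_zero, one_mul]
      exact far_all x y i k _ _ m hm (by simp at this; omega)
  | zigzag_left b i =>
    refine ⟨0, ?_, ?_⟩
    · induction i with
      | zero => 
        rintro (_ | ⟨a, _ | ⟨c, o⟩⟩) p <;> cases b <;> (try cases a) <;> (try cases c) <;> (try cases d) <;>
          intro h <;> first | (injection h with h; subst h; rfl) | (simp [run, stepAt] at h)
      | succ i ih => exact ih.shift
    · intro o p v m hp hm
      have := two_slices hp
      rw [writheFactor_zero, one_mul]
      exact cup_zig i _ _ m hm (by simp [Tile.inp, Tile.out] at this; omega)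
  | zigzag_right b i =>
    refine ⟨0, ?_, ?_⟩
    · induction i with
      | zero => 
        rintro (_ | ⟨a, _ | ⟨c, o⟩⟩) p <;> cases b <;> (try cases a) <;> (try cases c) <;> (try cases d) <;>
          intro h <;> first | (injection h with h; subst h; rfl) | (simp [run, stepAt] at h)
      | succ i ih => exact ih.shift
    · intro o p v m hp hm
      have := two_slices hp
      rw [writheFactor_zero, one_mul]
      exact cup_zag i _ _ m hm (by simp [Tile.inp, Tile.out] at this; omega)
  | slide_cup b s i =>
    refine ⟨0, ?_, ?_⟩
    · induction i with
      | zero => 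
        rintro (_ | ⟨a, _ | ⟨c, o⟩⟩) p <;> cases b <;> cases s <;> (try cases a) <;> (try cases c) <;> (try cases d) <;>
          intro h <;> first | (injection h with h; subst h; rfl) | (simp [run, stepAt] at h)
      | succ i ih => exact ih.shift
    · intro o p v m hp hm
      have := two_slices hp
      simp [Tile.inp, Tile.out] at this
      rw [writheFactor_zero, one_mul]
      change cupOp i (tileOp (.cross s) (i + 1) (loopBracket v)) m =
        cupOp (i + 1) (tileOp (.cross (!s)) i (loopBracket v)) m
      have e1 := cup_zig i _ (cupOp (i+1) (loopBracket v)) m hm (by omega)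
      have e2 := cup_zag i _ (cupOp i (loopBracket v)) m hm (by omega)
      rw [cupOp] at e1 e2
      rw [cupOp, cupOp]
      simp only [tileOp, e1, e2]
      cases s <;> simp [cupOp] <;> ring
  | slide_cap s i =>
    refine ⟨0, ?_, ?_⟩
    · induction i with
      | zero => 
        rintro (_ | ⟨a, _ | ⟨c, _ | ⟨d, o⟩⟩⟩) p <;> cases s <;> (try cases a) <;> (try cases c) <;> (try cases d) <;>
          intro h <;> first | (injection h with h; subst h; rfl) | (simp [run, stepAt] at h)
      | succ i ih => exact ih.shift
    · intro o p v m hp hm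
      have := two_slices hp
      simp [Tile.inp, Tile.out] at this
      rw [writheFactor_zero, one_mul]
      change tileOp (.cross s) (i + 1) (capOp i (loopBracket v)) m =
        tileOp (.cross (!s)) i (capOp (i + 1) (loopBracket v)) m
      have e1 : capOp (i + 1) (cupOp (i + 1) (capOp i (loopBracket v))) m =
          capOp (i + 1) (loopBracket v) m :=
        cap_congr _ _ _ _ _ hm (by omega) fun n' m' hn h' => cup_zag i n' _ m' h' (by omega)
      have e2 : capOp i (cupOp i (capOp (i + 1) (loopBracket v))) m =
          capOp i (loopBracket v) m :=
        cap_congr _ _ _ _ _ hm (by omega) fun n' m' hn h' => cup_zig i n' _ m' h' (by omega)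
      simp only [tileOp, e1, e2]
      cases s <;> simp <;> ring
  | reidemeister_one_cup b s i =>
    refine ⟨if s then 1 else -1, ?_, ?_⟩
    · induction i with
      | zero => 
        rintro (_ | ⟨a, _ | ⟨c, o⟩⟩) p <;> cases b <;> cases s <;> (try cases a) <;> (try cases c) <;> (try cases d) <;>
          intro h <;> first | (injection h with h; subst h; rfl) | (simp [run, stepAt] at h)
      | succ i ih => exact ih.shift
    · intro o p v m hp hm
      have := two_slices hp
      simp [Tile.inp, Tile.out] at this
      change cupOp i (tileOp (.cross s) i (loopBracket v)) m = _ * cupOp i (loopBracket v) m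
      have e1 := cup_loop i _ (cupOp i (loopBracket v)) m hm
      rw [cupOp] at e1
      rw [cupOp, ← r1_coeff]
      simp only [tileOp, e1, cupOp]
      ring
  | reidemeister_one_cap s i =>
    refine ⟨if s then 1 else -1, ?_, ?_⟩
    · induction i with
      | zero => 
        rintro (_ | ⟨a, _ | ⟨c, o⟩⟩) p <;> cases s <;> (try cases a) <;> (try cases c) <;> (try cases d) <;>
          intro h <;> first | (injection h with h; subst h; rfl) | (simp [run, stepAt] at h)
      | succ i ih => exact ih.shift
    · intro o p v m hp hm
      have := two_slices hp
      simp [Tile.inp, Tile.out] at this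
      change tileOp (.cross s) i (capOp i (loopBracket v)) m = _ * capOp i (loopBracket v) m
      have e1 : capOp i (cupOp i (capOp i (loopBracket v))) m =
          capOp i (fun m => loopValue * loopBracket v m) m :=
        cap_congr _ _ _ _ _ hm (by omega) fun n' m' hn h' => cup_loop i n' _ m' h'
      rw [← r1_coeff]
      simp only [tileOp, e1]
      simp only [capOp]
      ring
  | reidemeister_two s i =>
    refine ⟨0, ?_, ?_⟩
    · induction i with
      | zero => 
        rintro (_ | ⟨a, _ | ⟨c, o⟩⟩) p <;> cases s <;> (try cases a) <;> (try cases c) <;> (try cases d) <;>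
          intro h <;> first | (injection h with h; subst h; rfl) | (simp [run, stepAt] at h)
      | succ i ih => exact ih.shift
    · intro o p v m hp hm
      have := two_slices hp
      simp [Tile.inp, Tile.out] at this
      rw [writheFactor_zero, one_mul]
      exact r2_op s i _ _ m hm (by omega)
  | reidemeister_three s i =>
    refine ⟨0, ?_, ?_⟩
    · induction i with
      | zero =>
        rintro (_ | ⟨a, _ | ⟨c, _ | ⟨d, o⟩⟩⟩) p h
        · simp [run, stepAt] at h
        · simp [run, stepAt] at h
        · simp [run, stepAt] at h
        · simp only [run, stepAt, Option.bind_some, Option.map_some, Option.some.injEq,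
            zero_add] at h ⊢
          subst h
          simp only [crossingSign, List.getElem?_cons_zero, List.getElem?_cons_succ, zero_add,
            Prod.mk.injEq, true_and, Option.some.injEq, eq_comm (a := c) (b := a)]
          ring_nf
      | succ i ih => exact ih.shift
    · intro o p v m hp hm
      have := two_slices hp
      simp [Tile.inp, Tile.out] at this
      rw [writheFactor_zero, one_mul]
      exact r3_op s i _ _ m hm (by omega)

theorem orient_context {l l' : List Slice} {c : ℤ} (h : RunLE l l' c) (u v : List Slice)
    {o : List Bool} {z : ℤ} (hz : orient (u ++ l ++ v) o = some z) :
    orient (u ++ l' ++ v) o = some (z + c) := by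
  rw [List.append_assoc, orient_append] at hz ⊢
  obtain ⟨p, hp, hz⟩ := Option.bind_eq_some_iff.1 hz
  obtain ⟨y, hy, rfl⟩ := Option.map_eq_some_iff.1 hz
  rw [orient_append] at hy
  obtain ⟨q, hq, hy⟩ := Option.bind_eq_some_iff.1 hy
  obtain ⟨x, hx, rfl⟩ := Option.map_eq_some_iff.1 hy
  simp [hp, orient_append, h _ _ hq, hx]
  ring

theorem Pairing.step {x : Tile} {i : ℕ} {o o' : List Bool} (h : stepAt x i o = some o')
    {m : ℕ → ℕ} (hm : Pairing o.length m) :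
    (∀ b, x = .cup b → Pairing o'.length (cupMatch i m)) ∧
    (x = .cap → Pairing o'.length (capMatch i m)) ∧
    (∀ s, x = .cross s → Pairing o'.length m ∧ Pairing o'.length (cupMatch i (capMatch i m))) := by
  have hl := stepAt_length h
  refine ⟨?_, ?_, ?_⟩
  · rintro b rfl
    simp only [Tile.inp, Tile.out] at hl
    rw [show o'.length = o.length + 2 by omega]
    exact hm.cup (by omega)
  · rintro rfl
    simp only [Tile.inp, Tile.out] at hl
    rw [show o.length = o'.length + 2 by omega] at hm
    exact hm.cap (by omega)
  · rintro s rfl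
    simp only [Tile.inp, Tile.out] at hl
    obtain ⟨n, hn⟩ : ∃ n, o.length = n + 2 := ⟨o.length - 2, by omega⟩
    rw [show o'.length = n + 2 by omega]
    rw [hn] at hm
    exact ⟨hm, (hm.cap (by omega)).cup (by omega)⟩

theorem loopBracket_context {l l' : List Slice} {c : ℤ}
    (h : ∀ o p v m, run l o = some p → Pairing o.length m →
      loopBracket (l ++ v) m = writheFactor c * loopBracket (l' ++ v) m) (u v : List Slice)
    {o : List Bool} {z : ℤ} (hz : orient (u ++ (l ++ v)) o = some z) (m : ℕ → ℕ)
    (hm : Pairing o.length m) :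
    loopBracket (u ++ (l ++ v)) m = writheFactor c * loopBracket (u ++ (l' ++ v)) m := by
  induction u generalizing o z m with
  | nil =>
    rw [List.nil_append, orient_append] at hz
    obtain ⟨p, hp, -⟩ := Option.bind_eq_some_iff.1 hz
    exact h o p v m hp hm
  | cons x u ih =>
    obtain ⟨x, i⟩ := x
    simp only [List.cons_append, orient] at hz
    obtain ⟨o', ho, hz⟩ := Option.bind_eq_some_iff.1 hz
    obtain ⟨y, hy, -⟩ := Option.map_eq_some_iff.1 hz
    obtain ⟨p1, p2, p3⟩ := Pairing.step ho hm
    simp only [List.cons_append, loopBracket]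
    rcases x with b | _ | s
    · simp only [tileOp, cupOp]
      exact ih hy _ (p1 _ rfl)
    · simp only [tileOp, capOp]
      rw [ih hy _ (p2 rfl)]
      ring
    · simp only [tileOp, capOp, cupOp]
      rw [ih hy _ (p3 _ rfl).1, ih hy _ (p3 _ rfl).2]
      ring

theorem bracketAux_eq (w : List Slice) (o : List Bool) (m : ℕ → ℕ) (k : ℕ) {z : ℤ}
    (hz : orient w o = some z) (hm : Pairing o.length m)
    (hk : 0 < o.length ∨ 0 < k ∨ w ≠ []) :
    loopValue * bracketAux w m k = loopValue ^ k * loopBracket w m := by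
  induction w generalizing o m k z with
  | nil =>
    rcases o with _ | ⟨a, o⟩
    · simp at hk
      obtain ⟨k, rfl⟩ : ∃ j, k = j + 1 := ⟨k - 1, by omega⟩
      simp [bracketAux, loopBracket, pow_succ, mul_comm]
    · simp [orient] at hz
  | cons x w ih =>
    obtain ⟨x, i⟩ := x
    simp only [orient] at hz
    obtain ⟨o', ho, hz⟩ := Option.bind_eq_some_iff.1 hz
    obtain ⟨y, hy, -⟩ := Option.map_eq_some_iff.1 hz
    obtain ⟨p1, p2, p3⟩ := Pairing.step ho hm
    have hl := stepAt_length ho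
    simp only [loopBracket]
    rcases x with b | _ | s
    · simp only [Tile.inp, Tile.out] at hl
      simp only [tileOp, cupOp, bracketAux]
      exact ih _ _ _ hy (p1 _ rfl) (.inl (by omega))
    · simp only [Tile.inp, Tile.out] at hl
      simp only [tileOp, capOp, bracketAux, loopFactor]
      rw [ih _ _ _ hy (p2 rfl)]
      · split_ifs <;> ring
      · by_cases h0 : 0 < o'.length
        · exact .inl h0
        · right; left
          have e : m i = i + 1 := by
            have h2 : o.length = 2 := by omega
            have h3 : i = 0 := by omega
            rw [h2] at hm
            obtain ⟨q1, q2⟩ := hm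
            have a1 := q2 0
            have a2 := q2 (m 0)
            have a3 := q1 0
            subst h3
            grind
          simp [e]
    · simp only [Tile.inp, Tile.out] at hl
      simp only [tileOp, capOp, cupOp, bracketAux, loopFactor]
      rw [mul_add, mul_left_comm, ih _ _ _ hy (p3 _ rfl).1 (.inl (by omega)), mul_left_comm loopValue,
        ih _ _ _ hy (p3 _ rfl).2 (.inl (by omega))]
      split_ifs <;> ring

theorem pairing_id : Pairing ([] : List Bool).length id :=
  ⟨fun _ => rfl, fun j => by simp⟩

theorem KnotDiagram.bracket_eq (D : KnotDiagram) :
    loopValue * D.bracket = loopBracket D.word id := by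
  have := bracketAux_eq D.word [] id 0 D.orient_eq pairing_id
    (.inr (.inr fun h => by have := D.components_eq; simp [h, components] at this))
  rw [pow_zero, one_mul] at this
  exact this

theorem loopValue_ne_zero : loopValue ≠ 0 := by
  intro h
  have := congrArg (fun p : LaurentPolynomial ℤ => p.coeff 2) h
  simp only [loopValue, AddMonoidAlgebra.coeff_sub, AddMonoidAlgebra.coeff_neg, Finsupp.sub_apply,
    Finsupp.neg_apply, AddMonoidAlgebra.coeff_zero, Finsupp.zero_apply, T,
    AddMonoidAlgebra.coeff_single, Finsupp.single_apply] at this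
  norm_num at this

theorem orient_reverse (w : List Slice) (o : List Bool) :
    orient (w.map fun x => (x.1.reverse, x.2)) (o.map not) = orient w o := by
  have hstep : ∀ x i o, stepAt (Tile.reverse x) i (o.map not) = (stepAt x i o).map (List.map not) := by
    intro x i o
    induction i generalizing o with
    | zero => rcases x with b | _ | s <;> rcases o with _ | ⟨a, _ | ⟨c, o⟩⟩ <;>
        simp [Tile.reverse, stepAt]; split_ifs <;> simp
    | succ i ih =>
      rcases o with _ | ⟨a, o⟩
      · simp [stepAt_succ_nil]
      · rw [List.map_cons, stepAt_succ_cons, stepAt_succ_cons, ih]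
        simp [Function.comp_def]
  have hsign : ∀ x i o, crossingSign (Tile.reverse x) i (o.map not) = crossingSign x i o := by
    intro x i o
    rcases x with b | _ | s
    · rfl
    · rfl
    · have : ((o.map not)[i]? = (o.map not)[i + 1]?) ↔ (o[i]? = o[i + 1]?) := by
        rw [List.getElem?_map, List.getElem?_map]
        exact (Option.map_injective Bool.not_injective).eq_iff
      simp only [Tile.reverse, crossingSign, this]
  induction w generalizing o with
  | nil => rcases o with _ | ⟨a, o⟩ <;> rfl
  | cons x w ih =>
    simp only [List.map_cons, orient, hstep, hsign, Option.bind_map]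
    congr 1
    funext o'
    simp [ih]

theorem loopBracket_reverse (w : List Slice) :
    loopBracket (w.map fun x => (x.1.reverse, x.2)) = loopBracket w := by
  induction w with
  | nil => rfl
  | cons x w ih =>
    funext m
    obtain ⟨x, i⟩ := x
    simp only [List.map_cons, loopBracket, ih]
    rcases x with b | _ | s <;> rfl

/-- The polynomial `X` is an isotopy invariant. -/
theorem KnotDiagram.X_step {D D' : KnotDiagram} (h : D.Step D') : D.X = D'.X := by
  apply mul_left_cancel₀ loopValue_ne_zero
  rw [X, X, mul_left_comm, mul_left_comm loopValue, bracket_eq, bracket_eq]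
  rcases h with ⟨u, l, l', v, hm, h1, h2⟩ | h
  · obtain ⟨c, hc, hb⟩ := hm.spec
    have e := D.orient_eq
    rw [h1] at e
    have e' := orient_context hc u v e
    rw [← h2, D'.orient_eq, Option.some.injEq] at e'
    rw [List.append_assoc] at e h1 h2
    rw [h1, h2, loopBracket_context hb u v e id pairing_id, e', writheFactor_add, mul_assoc]
  · have e := D'.orient_eq
    rw [h] at e
    have e' := orient_reverse D.word []
    rw [List.map_nil, e, D.orient_eq, Option.some.injEq] at e'
    rw [h, e', loopBracket_reverse]

end Invariance

/-- The substitution `t = a⁻⁴`: the coefficient of `t ^ k` is that of `a ^ (-4 k)`. -/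
def substQuarter (X : LaurentPolynomial ℤ) : LaurentPolynomial ℤ :=
  .ofCoeff (X.coeff.comapDomain (fun k : ℤ => -4 * k) (fun a _ b _ h => by
    have h' : -4 * a = -4 * b := h
    omega))

/-- The Jones polynomial `V(t)`, determined by `V(a⁻⁴) = X(a)`. -/
def Knot.jones : Knot → LaurentPolynomial ℤ :=
  Quot.lift (fun D => substQuarter D.X) fun _ _ h => by rw [KnotDiagram.X_step h]

/-- The span of the Jones polynomial: highest exponent minus lowest exponent. -/
def Knot.span (K : Knot) : ℤ :=
  sSup (K.jones.coeff.support : Set ℤ) - sInf (K.jones.coeff.support : Set ℤ)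

/-- The determinant `|V(-1)|`. -/
def Knot.det (K : Knot) : ℕ := (LaurentPolynomial.eval₂ (RingHom.id ℤ) (-1) K.jones).natAbs

/-- The tricoloring number `3 |V(exp(iπ/3))²|`. -/
def Knot.tri (K : Knot) : ℝ :=
  3 * ‖(LaurentPolynomial.eval₂ (Int.castRingHom ℂ)
    (Units.mk0 (Complex.exp (Real.pi * Complex.I / 3)) (Complex.exp_ne_zero _)) K.jones) ^ 2‖

/-- `β = log₃ tri`. -/
def Knot.beta (K : Knot) : ℝ := Real.logb 3 K.tri

end

/-! ## Knot graphs -/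

/-- `D'` arises from `D` by changing one crossing. -/
def KnotDiagram.CrossingChange (D D' : KnotDiagram) : Prop :=
  ∃ u v s i, D.word = u ++ [(.cross s, i)] ++ v ∧ D'.word = u ++ [(.cross (!s), i)] ++ v

/-- The underlying unoriented word of a diagram. -/
def KnotDiagram.shape (D : KnotDiagram) : List Slice := D.word.map fun x => (x.1.forget, x.2)

/-- The tangle replacements of an H(2)-move: two vertical strands are replaced by a cap followed by
a cup, or a crossing is resolved in one of the two ways. -/
inductive LocalBanding : List Slice → List Slice → Prop
  | saddle (i : ℕ) : LocalBanding [] [(.cap, i), (.cup true, i)]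
  | resolve_vertical (s : Bool) (i : ℕ) : LocalBanding [(.cross s, i)] []
  | resolve_horizontal (s : Bool) (i : ℕ) :
      LocalBanding [(.cross s, i)] [(.cap, i), (.cup true, i)]

/-- `D'` arises from `D` by a tangle replacement `LocalBanding`, disregarding orientations.  As both
are diagrams of knots, the move is component-preserving. -/
def KnotDiagram.Banding (D D' : KnotDiagram) : Prop :=
  ∃ u l l' v, LocalBanding l l' ∧ D.shape = u ++ l ++ v ∧ D'.shape = u ++ l' ++ v

/-- The Gordian graph. -/
def gordian : SimpleGraph Knot where
  Adj K K' := K ≠ K' ∧ ∃ D D' : KnotDiagram, D.knot = K ∧ D'.knot = K' ∧ D.CrossingChange D'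
  symm := by
    refine ⟨?_⟩
    rintro K K' ⟨h, D, D', h1, h2, u, v, s, i, e1, e2⟩
    exact ⟨h.symm, D', D, h2, h1, u, v, !s, i, e2, by simpa using e1⟩
  loopless := ⟨fun _ h => h.1 rfl⟩

/-- The H(2)-Gordian graph. -/
def hTwoGordian : SimpleGraph Knot where
  Adj K K' := K ≠ K' ∧ ∃ D D' : KnotDiagram, D.knot = K ∧ D'.knot = K' ∧
    (D.Banding D' ∨ D'.Banding D)
  symm := by
    refine ⟨?_⟩
    rintro K K' ⟨h, D, D', h1, h2, h3⟩
    exact ⟨h.symm, D', D, h2, h1, h3.symm⟩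
  loopless := ⟨fun _ h => h.1 rfl⟩

/-- The class of `v` under the relation `p v = p w`. -/
def cls {V α : Type*} (p : V → α) (v : V) : Quotient (Setoid.ker p) := Quotient.mk _ v

/-- The quotient of a graph by an invariant `p`: vertices are the classes of the relation
`p v = p w`, and two distinct classes are adjacent if they have adjacent representatives. -/
def quotientGraph {V α : Type*} (G : SimpleGraph V) (p : V → α) :
    SimpleGraph (Quotient (Setoid.ker p)) where
  Adj x y := x ≠ y ∧ ∃ v w, cls p v = x ∧ cls p w = y ∧ G.Adj v w
  symm := by
    refine ⟨?_⟩
    rintro x y ⟨h, v, w, h1, h2, h3⟩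
    exact ⟨h.symm, w, v, h2, h1, h3.symm⟩
  loopless := ⟨fun _ h => h.1 rfl⟩

/-- The infinite path graph on the positive integers. -/
def infinitePath : SimpleGraph ℕ+ where
  Adj m n := m + 1 = n ∨ n + 1 = m
  symm := ⟨fun _ _ h => h.symm⟩
  loopless := ⟨fun n h => by
    have h' : n + 1 = n := h.elim id id
    exact absurd (congrArg PNat.val h') (by simp)⟩

/-! ## Hyperbolic graphs -/

/-- A point of the metric graph `X_G`, in barycentric coordinates: nonnegative weights on the
vertices with sum `1`, supported on a vertex or on the two ends of an edge. -/
structure MetricGraph {V : Type*} (G : SimpleGraph V) where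
  weight : V →₀ ℝ
  nonneg : ∀ v, 0 ≤ weight v
  sum_eq_one : (weight.sum fun _ t => t) = 1
  support_subset : ∃ u v, (u = v ∨ G.Adj u v) ∧ (weight.support : Set V) ⊆ {u, v}

namespace MetricGraph

variable {V : Type*} {G : SimpleGraph V}

/-- Both points lie on one closed edge. -/
def OnCommonEdge (x y : MetricGraph G) : Prop :=
  ∃ u v, G.Adj u v ∧ (x.weight.support : Set V) ⊆ {u, v} ∧ (y.weight.support : Set V) ⊆ {u, v}

open Classical in
/-- The distance in the metric graph, all of whose edges have length `1`.  On an edge it is the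
usual distance; otherwise a shortest path leaves `x` through an end `u` of its edge, at distance
`1 - x.weight u` from `x`, and arrives at `y` through an end of the edge of `y`. -/
noncomputable def dist (x y : MetricGraph G) : ℝ :=
  if OnCommonEdge x y then ((x.weight - y.weight).sum fun _ t => |t|) / 2
  else ⨅ p : x.weight.support × y.weight.support,
    (1 - x.weight p.1) + (G.dist (p.1 : V) (p.2 : V) : ℝ) + (1 - y.weight p.2)

/-- `S` is the image of a geodesic from `x` to `y`. -/
def IsGeodesic (x y : MetricGraph G) (S : Set (MetricGraph G)) : Prop :=
  ∃ γ : ℝ → MetricGraph G, γ 0 = x ∧ γ (dist x y) = y ∧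
    (∀ s ∈ Set.Icc 0 (dist x y), ∀ t ∈ Set.Icc 0 (dist x y), dist (γ s) (γ t) = |s - t|) ∧
    S = γ '' Set.Icc 0 (dist x y)

/-- Every point of `S` has distance at most `δ` from a point of `S'`. -/
def InNeighborhood (δ : ℝ) (S S' : Set (MetricGraph G)) : Prop :=
  ∀ p ∈ S, ∃ q ∈ S', dist p q ≤ δ

end MetricGraph

open MetricGraph in
/-- A connected graph is `δ`-hyperbolic if all geodesic triangles in its metric graph are
`δ`-thin. -/
def IsHyperbolic {V : Type*} (G : SimpleGraph V) (δ : ℝ) : Prop :=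
  G.Connected ∧ ∀ (x y z : MetricGraph G) (a b c : Set (MetricGraph G)),
    IsGeodesic x y a → IsGeodesic y z b → IsGeodesic x z c →
      InNeighborhood δ a (b ∪ c) ∧ InNeighborhood δ b (a ∪ c) ∧ InNeighborhood δ c (a ∪ b)

/-- Gromov hyperbolic: `δ`-hyperbolic for some `δ ≥ 0`. -/
def IsGromovHyperbolic {V : Type*} (G : SimpleGraph V) : Prop := ∃ δ : ℝ, 0 ≤ δ ∧ IsHyperbolic G δ

end KnotGraphs

namespace KnotGraphs

open LaurentPolynomial

/-! ## Words without orientation -/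

/-! All three invariants are values or shapes of one state sum, `loopBracket`, and each claim has
two halves. One half restricts the values of an invariant, or how far a move can shift them. The
other exhibits pairs of diagrams related by one move with prescribed values (`Joined`). The metric
statements then follow from the shape of the quotient graphs.

For `β`, put a = exp(5πi/12), so that a⁻⁴ = exp(iπ/3) and a loop has value √3. At this value the
Temperley-Lieb operators act on functions of colourings by three colours (`potts`), and every tile,
crossings included, maps Gaussian functions to Gaussian functions (`IsGauss`). A closed diagram
therefore evaluates to a quadratic Gauss sum over the field with three elements, whose norm square
is a power of 3. Since V(exp(iπ/3)) is an Eisenstein integer, `β` is a positive integer. If x and y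
are the values of the two planar tangles in a fixed context, the two crossings have values a x + a⁻¹
y and a⁻¹ x + a y, and the four norm squares satisfy a quadratic equation (`normSq_relation`). Among
powers of 3 its only solutions have three equal terms and a fourth three times as large, so a
crossing change or a band move alters `β` by at most 1. Sums of trefoils realize all consecutive
pairs, and both quotients are the infinite path. On a line distances are differences of positions,
and triangles are 0-thin.

For `det`, put a = exp(iπ/4). Every coprime pair (p, q) comes from a braid on three strands whose
two closures have determinants |p| and |q| (`BraidValue`, `exists_braidValue`, by the Euclidean
algorithm). A band move exchanges the closures, and a change of one further crossing replaces p - q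
by p + q. After splitting off a summand that carries the greatest common divisor, any two odd
numbers are determinants of adjacent knots. Conversely V(-1) and V(1) = 1 have the same parity. Both
quotients by `det` are complete graphs.

For `span`, the values V(1) = 1 and V(ω) = 1 at a primitive cube root of unity exclude spans 1 and
2. For alternating braids the extreme terms of the recursion never cancel, so spans are explicit
(`Extents`, `Alternating`). These families, together with sums, a pretzel family and one pair of
braids on four strands, join all pairs of admissible spans by a crossing change except perhaps {4,
5}, and by a band move except perhaps {0, 4}. When at most one pair of vertices is not adjacent, and
that pair has a common neighbour, the metric graph has diameter at most 2. Each point of a geodesic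
is then within 1 of one of its ends, and that end lies on another side of the triangle.

Two technical points support this. First, the Jones polynomial is read from exponents divisible by
4, so all exponents of `X` must be shown to be of this kind (`KnotDiagram.X_exponents`); this is a
parity count of loops against the writhe. Second, diagrams are produced from unoriented words: every
closed word can be oriented (`exists_orient`), and it is a knot as soon as its bracket is odd at a =
1 (`Presents`). -/

/-- The word `w` can be placed on top of `n` strands and leaves `n'` strands. -/
def Fits : List Slice → ℕ → ℕ → Prop
  | [], n, n' => n = n'
  | (x, i) :: w, n, n' => i + x.inp ≤ n ∧ Fits w (n - x.inp + x.out) n'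

theorem Fits.append {u v : List Slice} {n n' n'' : ℕ} (h : Fits u n n') (h' : Fits v n' n'') :
    Fits (u ++ v) n n'' := by
  induction u generalizing n with
  | nil => cases h; exact h'
  | cons x u ih => exact ⟨h.1, ih h.2⟩

theorem Fits.split {u v : List Slice} {n n'' : ℕ} (h : Fits (u ++ v) n n'') :
    ∃ n', Fits u n n' ∧ Fits v n' n'' := by
  induction u generalizing n with
  | nil => exact ⟨n, rfl, h⟩
  | cons x u ih =>
    obtain ⟨n', h1, h2⟩ := ih h.2
    exact ⟨n', ⟨h.1, h1⟩, h2⟩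

theorem fits_of_orient {w : List Slice} {o : List Bool} {z : ℤ} (h : orient w o = some z) :
    Fits w o.length 0 := by
  induction w generalizing o z with
  | nil => rcases o with _ | ⟨a, o⟩ <;> simp [orient, Fits] at h ⊢
  | cons x w ih =>
    obtain ⟨x, i⟩ := x
    simp only [orient] at h
    obtain ⟨o', ho, hz⟩ := Option.bind_eq_some_iff.1 h
    obtain ⟨y, hy, -⟩ := Option.map_eq_some_iff.1 hz
    have hl := stepAt_length ho
    refine ⟨hl.1, ?_⟩
    rw [show o.length - x.inp + x.out = o'.length by omega]
    exact ih hy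

theorem KnotDiagram.fits (D : KnotDiagram) : Fits D.word 0 0 := fits_of_orient D.orient_eq

/-- The underlying unoriented word. -/
def shapeOf (w : List Slice) : List Slice := w.map fun x => (x.1.forget, x.2)

theorem shapeOf_append (u v : List Slice) : shapeOf (u ++ v) = shapeOf u ++ shapeOf v :=
  List.map_append

theorem fits_shapeOf {w : List Slice} {n n' : ℕ} : Fits (shapeOf w) n n' ↔ Fits w n n' := by
  induction w generalizing n with
  | nil => rfl
  | cons x w ih =>
    obtain ⟨x, i⟩ := x
    rw [shapeOf] at ih ⊢
    simp only [List.map_cons, Fits, ih]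
    rcases x with b | _ | s <;> rfl

theorem loopBracket_shapeOf (w : List Slice) : loopBracket (shapeOf w) = loopBracket w := by
  induction w with
  | nil => rfl
  | cons x w ih =>
    funext m
    obtain ⟨x, i⟩ := x
    rw [shapeOf] at ih ⊢
    simp only [List.map_cons, loopBracket, ih]
    rcases x with b | _ | s <;> rfl

theorem components_shapeOf (w : List Slice) : components (shapeOf w) = components w := by
  induction w with
  | nil => rfl
  | cons x w ih =>
    funext m
    obtain ⟨x, i⟩ := x
    change components ((x.forget, i) :: shapeOf w) m = _
    rcases x with b | _ | s <;> simp only [Tile.forget, components, ih]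

theorem Pairing.swap {n i : ℕ} {m : ℕ → ℕ} (h : Pairing n m) (hi : i + 2 ≤ n) :
    Pairing n (swapMatch i m) := by
  obtain ⟨h1, h2⟩ := h
  refine ⟨fun j => ?_, fun j => ?_⟩
  · simp [swapMatch, h1]
  · have := h2 (Equiv.swap i (i + 1) j)
    rw [swapMatch, Equiv.swap_apply_eq_iff, this, Equiv.swap_apply_def]
    split_ifs <;> omega

/-- A linear relation between state sums persists below a common word. -/
theorem loopBracket_linear {u v v₁ v₂ : List Slice} {c d : LaurentPolynomial ℤ} {n' : ℕ}
    (h : ∀ m, Pairing n' m → loopBracket v m = c * loopBracket v₁ m + d * loopBracket v₂ m)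
    {n : ℕ} (hu : Fits u n n') {m : ℕ → ℕ} (hm : Pairing n m) :
    loopBracket (u ++ v) m = c * loopBracket (u ++ v₁) m + d * loopBracket (u ++ v₂) m := by
  induction u generalizing n m with
  | nil => cases hu; exact h m hm
  | cons x u ih =>
    obtain ⟨x, i⟩ := x
    obtain ⟨hi, hu⟩ := hu
    simp only [List.cons_append, loopBracket]
    rcases x with b | _ | s
    · simp only [Tile.inp, Tile.out] at hi hu
      exact ih hu (hm.cup (by omega))
    · simp only [Tile.inp, Tile.out] at hi hu
      obtain ⟨n, rfl⟩ : ∃ k, n = k + 2 := ⟨n - 2, by omega⟩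
      simp only [tileOp, capOp]
      rw [ih hu (hm.cap (by omega))]
      ring
    · simp only [Tile.inp, Tile.out] at hi hu
      rw [show n - 2 + 2 = n by omega] at hu
      obtain ⟨k, rfl⟩ : ∃ k, n = k + 2 := ⟨n - 2, by omega⟩
      simp only [tileOp, capOp, cupOp]
      rw [ih hu hm, ih hu ((hm.cap (by omega)).cup (by omega))]
      ring

theorem loopBracket_scalar {u v v' : List Slice} {c : LaurentPolynomial ℤ} {n' : ℕ}
    (h : ∀ m, Pairing n' m → loopBracket v m = c * loopBracket v' m)
    {n : ℕ} (hu : Fits u n n') {m : ℕ → ℕ} (hm : Pairing n m) :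
    loopBracket (u ++ v) m = c * loopBracket (u ++ v') m := by
  have := loopBracket_linear (v₁ := v') (v₂ := v') (d := 0) (fun m hm => by rw [h m hm]; ring) hu hm
  rw [this]; ring

theorem loopBracket_cross {u v : List Slice} {s : Bool} {i n n₀ : ℕ} (hu : Fits u n₀ n) {m : ℕ → ℕ} (hm : Pairing n₀ m) :
    loopBracket (u ++ (.cross s, i) :: v) m =
      T (if s then 1 else -1) * loopBracket (u ++ v) m +
      T (if s then -1 else 1) * loopBracket (u ++ (.cap, i) :: (.cup true, i) :: v) m :=
  loopBracket_linear (fun _ _ => rfl) hu hm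

/-- The number of crossings. -/
def crossings : List Slice → ℕ
  | [] => 0
  | (.cross _, _) :: w => crossings w + 1
  | (.cup _, _) :: w => crossings w
  | (.cap, _) :: w => crossings w

/-- Evaluation of an integral Laurent polynomial at a unit. -/
noncomputable abbrev ev {R : Type*} [CommRing R] (x : Rˣ) : LaurentPolynomial ℤ →+* R :=
  LaurentPolynomial.eval₂ (Int.castRingHom R) x

/-! ## Representations of the Temperley-Lieb category -/

/-- Operators `cup i`, `cap i` on a module, with the relations of the Temperley-Lieb category for
the loop value `d`. -/
structure TLRep (R V : Type*) [CommRing R] [AddCommGroup V] [Module R V] (d : R) where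
  cup : ℕ → V →ₗ[R] V
  cap : ℕ → V →ₗ[R] V
  cap_cup : ∀ i v, cap i (cup i v) = d • v
  zig : ∀ i v, cap (i + 1) (cup i v) = v
  zag : ∀ i v, cap i (cup (i + 1) v) = v
  far_right : ∀ i k v, cap (i + 2 + k) (cup i v) = cup i (cap (i + k) v)
  far_left : ∀ i k v, cap i (cup (i + 2 + k) v) = cup (i + k) (cap i v)

namespace TLRep

variable {R V : Type*} [CommRing R] [AddCommGroup V] [Module R V] {d : R} (ρ : TLRep R V d)

/-- The vectors of planar pairings, generated from a vacuum vector `v₀`. -/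
inductive State (v₀ : V) : ℕ → (ℕ → ℕ) → V → Prop
  | vacuum : State v₀ 0 id v₀
  | cup {n : ℕ} {m : ℕ → ℕ} {v : V} (i : ℕ) (hi : i ≤ n) (h : State v₀ n m v) :
      State v₀ (n + 2) (cupMatch i m) (ρ.cup i v)

variable {ρ} {v₀ : V}

theorem State.pairing {n : ℕ} {m : ℕ → ℕ} {v : V} (h : ρ.State v₀ n m v) : Pairing n m := by
  induction h with
  | vacuum => exact pairing_id
  | cup i hi _ ih => exact ih.cup hi

/-- The cap is compared with the last cup: it closes it to a loop, straightens a zigzag with it, or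
is disjoint from it and passes to the state below. Only relations between a cap and a cup enter;
commutation of two cups or of two caps is never needed, because a state remembers the cups that
built it. -/
theorem State.cap {n : ℕ} {m : ℕ → ℕ} {v : V} (h : ρ.State v₀ (n + 2) m v) {i : ℕ} (hi : i ≤ n) :
    ∃ v', ρ.State v₀ n (capMatch i m) v' ∧ ρ.cap i v = (if m i = i + 1 then d else 1) • v' := by
  generalize hN : n + 2 = N at h
  induction h generalizing n i with
  | vacuum => omega
  | @cup n' m v k hk h ih =>
    obtain rfl : n = n' := by omega
    rcases lt_trichotomy i k with hik | rfl | hik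
    · obtain ⟨j, rfl | rfl⟩ : ∃ j, k = i + 1 ∨ k = i + 2 + j := ⟨k - i - 2, by omega⟩
      · obtain ⟨e1, e2⟩ := zig2 h.pairing (i := i) (by omega)
        exact ⟨v, by rwa [e1], by rw [if_neg e2, ρ.zag, one_smul]⟩
      · obtain ⟨n, rfl⟩ : ∃ n'', n = n'' + 2 := ⟨n - 2, by omega⟩
        obtain ⟨v', hv, e⟩ := ih (i := i) (by omega) rfl
        obtain ⟨e1, e2⟩ := cup_cap i j h.pairing (by omega)
        refine ⟨ρ.cup (i + j) v', ?_, ?_⟩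
        · rw [← e1]; exact hv.cup _ (by omega)
        · rw [ρ.far_left, e, map_smul]; simp only [e2]
    · obtain ⟨e1, e2⟩ := capcup (i := i) h.pairing
      exact ⟨v, by rwa [e1], by rw [if_pos e2, ρ.cap_cup]⟩
    · obtain ⟨j, rfl | rfl⟩ : ∃ j, i = k + 1 ∨ i = k + 2 + j := ⟨i - k - 2, by omega⟩
      · obtain ⟨e1, e2⟩ := zig1 h.pairing (i := k) (by omega)
        exact ⟨v, by rwa [e1], by rw [if_neg e2, ρ.zig, one_smul]⟩
      · obtain ⟨n, rfl⟩ : ∃ n'', n = n'' + 2 := ⟨n - 2, by omega⟩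
        obtain ⟨v', hv, e⟩ := ih (i := k + j) (by omega) rfl
        obtain ⟨e1, e2⟩ := KnotGraphs.cap_cup k j h.pairing (by omega)
        refine ⟨ρ.cup k v', ?_, ?_⟩
        · rw [e1]; exact hv.cup _ (by omega)
        · rw [ρ.far_right, e, map_smul]; simp only [e2]

/-- The action of a word, with crossings resolved as in the Kauffman bracket. -/
def act (ρ : TLRep R V d) (x : Rˣ) : List Slice → V →ₗ[R] V
  | [] => LinearMap.id
  | (.cup _, i) :: w => act ρ x w ∘ₗ ρ.cup i
  | (.cap, i) :: w => act ρ x w ∘ₗ ρ.cap i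
  | (.cross s, i) :: w => act ρ x w ∘ₗ
      (((x ^ (if s then 1 else -1 : ℤ) : Rˣ) : R) • LinearMap.id +
        ((x ^ (if s then -1 else 1 : ℤ) : Rˣ) : R) • ρ.cup i ∘ₗ ρ.cap i)

/-- A closed word acts on states by the value of its state sum. -/
theorem State.act_eq {x : Rˣ} (hx : ev x loopValue = d) {w : List Slice} {n : ℕ} {m : ℕ → ℕ}
    {v : V} (h : ρ.State v₀ n m v) (hw : Fits w n 0) :
    ρ.act x w v = ev x (loopBracket w m) • v₀ := by
  -- Every tile turns a state into a combination of states, so the induction stays among them; at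
  -- the end no strands are left, and the vacuum is the only state without strands.
  induction w generalizing n m v with
  | nil =>
    cases hw
    cases h
    simp [act, loopBracket]
  | cons y w ih =>
    obtain ⟨y, i⟩ := y
    obtain ⟨hi, hw⟩ := hw
    rcases y with b | _ | s
    · simp only [Tile.inp, Tile.out] at hi hw
      exact ih (h.cup i (by omega)) hw
    · simp only [Tile.inp, Tile.out] at hi hw
      obtain ⟨n, rfl⟩ : ∃ n', n = n' + 2 := ⟨n - 2, by omega⟩
      obtain ⟨v', hv, e⟩ := h.cap (i := i) (by omega)
      simp only [act, LinearMap.comp_apply, e, map_smul, loopBracket, tileOp, capOp, loopFactor,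
        map_mul]
      rw [ih hv hw, mul_smul]
      split_ifs <;> simp [hx]
    · simp only [Tile.inp, Tile.out] at hi hw
      obtain ⟨n, rfl⟩ : ∃ n', n = n' + 2 := ⟨n - 2, by omega⟩
      obtain ⟨v', hv, e⟩ := h.cap (i := i) (by omega)
      simp only [act, LinearMap.comp_apply, LinearMap.add_apply, LinearMap.smul_apply, e, map_smul,
        map_add, loopBracket, tileOp, capOp, cupOp, loopFactor, map_mul, LinearMap.id_apply,
        eval₂_T]
      rw [ih (hv.cup i (by omega)) hw, ih h hw, add_smul, mul_smul, mul_smul, mul_smul]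
      split_ifs <;> simp [hx]

end TLRep

/-! ## Counting components -/

/-- Three pairings that agree except on four strands, which they join in the three possible ways. -/
structure Triple (n : ℕ) (m₁ m₂ m₃ : ℕ → ℕ) (a b c d : ℕ) : Prop where
  pairing₁ : Pairing n m₁
  pairing₂ : Pairing n m₂
  pairing₃ : Pairing n m₃
  ne : a ≠ b ∧ a ≠ c ∧ a ≠ d ∧ b ≠ c ∧ b ≠ d ∧ c ≠ d
  first : m₁ a = b ∧ m₁ c = d
  second : m₂ a = c ∧ m₂ b = d
  third : m₃ a = d ∧ m₃ b = c
  other : ∀ j, j ≠ a → j ≠ b → j ≠ c → j ≠ d → m₂ j = m₁ j ∧ m₃ j = m₁ j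

namespace Triple

variable {n : ℕ} {m₁ m₂ m₃ : ℕ → ℕ} {a b c d : ℕ}

theorem swap_ab (h : Triple n m₁ m₂ m₃ a b c d) : Triple n m₁ m₃ m₂ b a c d := by
  obtain ⟨p1, p2, p3, hn, h1, h2, h3, ho⟩ := h
  refine ⟨p1, p3, p2, by tauto, ⟨by rw [← h1.1, p1.1], h1.2⟩, ⟨h3.2, h3.1⟩, ⟨h2.2, h2.1⟩, ?_⟩
  exact fun j ja jb jc jd => (ho j jb ja jc jd).symm

theorem swap_ac (h : Triple n m₁ m₂ m₃ a b c d) : Triple n m₃ m₂ m₁ c b a d := by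
  obtain ⟨p1, p2, p3, hn, h1, h2, h3, ho⟩ := h
  refine ⟨p3, p2, p1, by tauto, ⟨by rw [← h3.2, p3.1], h3.1⟩, ⟨by rw [← h2.1, p2.1], h2.2⟩,
    ⟨h1.2, by rw [← h1.1, p1.1]⟩, ?_⟩
  intro j ja jb jc jd
  obtain ⟨e1, e2⟩ := ho j jc jb ja jd
  exact ⟨e1.trans e2.symm, e2.symm⟩

theorem rotate (h : Triple n m₁ m₂ m₃ a b c d) : Triple n m₂ m₁ m₃ a c b d := by
  exact h.swap_ab.swap_ac.swap_ab

theorem swap_bd (h : Triple n m₁ m₂ m₃ a b c d) : Triple n m₃ m₂ m₁ a d c b := by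
  obtain ⟨p1, p2, p3, hn, h1, h2, h3, ho⟩ := h
  refine ⟨p3, p2, p1, by tauto, ⟨h3.1, by rw [← h3.2, p3.1]⟩, ⟨h2.1, by rw [← h2.2, p2.1]⟩,
    ⟨h1.1, by rw [← h1.2, p1.1]⟩, ?_⟩
  intro j ja jb jc jd
  obtain ⟨e1, e2⟩ := ho j ja jd jc jb
  exact ⟨e1.trans e2.symm, e2.symm⟩

theorem swap_ad (h : Triple n m₁ m₂ m₃ a b c d) : Triple n m₂ m₁ m₃ d b c a := by
  exact h.swap_bd.swap_ab.swap_bd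

theorem swap (h : Triple n m₁ m₂ m₃ a b c d) {i : ℕ} (hi : i + 2 ≤ n) :
    Triple n (swapMatch i m₁) (swapMatch i m₂) (swapMatch i m₃)
      (Equiv.swap i (i + 1) a) (Equiv.swap i (i + 1) b) (Equiv.swap i (i + 1) c)
      (Equiv.swap i (i + 1) d) := by
  obtain ⟨p1, p2, p3, hn, h1, h2, h3, ho⟩ := h
  have key : ∀ j x, j ≠ Equiv.swap i (i + 1) x → Equiv.swap i (i + 1) j ≠ x := by
    rintro j x hj rfl
    simp at hj
  refine ⟨p1.swap hi, p2.swap hi, p3.swap hi, by simpa using hn, by simp [swapMatch, h1],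
    by simp [swapMatch, h2], by simp [swapMatch, h3], ?_⟩
  intro j ja jb jc jd
  have := ho _ (key _ _ ja) (key _ _ jb) (key _ _ jc) (key _ _ jd)
  simp [swapMatch, this]

theorem shiftDown_shiftUp (i j : ℕ) : shiftDown i (shiftUp i j) = j := by
  grind [shiftUp, shiftDown]

theorem cup (h : Triple n m₁ m₂ m₃ a b c d) {i : ℕ} (hi : i ≤ n) :
    Triple (n + 2) (cupMatch i m₁) (cupMatch i m₂) (cupMatch i m₃)
      (shiftUp i a) (shiftUp i b) (shiftUp i c) (shiftUp i d) := by
  obtain ⟨p1, p2, p3, hn, h1, h2, h3, ho⟩ := h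
  have key : ∀ m x, cupMatch i m (shiftUp i x) = shiftUp i (m x) := by
    intro m x
    grind [cupMatch, shiftUp, shiftDown]
  refine ⟨p1.cup hi, p2.cup hi, p3.cup hi, by simpa [shiftUp_inj] using hn, by simp [key, h1],
    by simp [key, h2], by simp [key, h3], ?_⟩
  intro j ja jb jc jd
  have := ho (shiftDown i j)
  grind [cupMatch, shiftUp, shiftDown]

/-- The effect of a maximum on a triple: either the result is again a triple, or the three results
agree, and in exactly one of the three cases a circle is split off. -/
def CapCase (n i : ℕ) (m₁ m₂ m₃ : ℕ → ℕ) : Prop :=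
  (∃ a b c d, Triple n (capMatch i m₁) (capMatch i m₂) (capMatch i m₃) a b c d ∧
    (m₂ i = i + 1 ↔ m₁ i = i + 1) ∧ (m₃ i = i + 1 ↔ m₁ i = i + 1)) ∨
  (capMatch i m₂ = capMatch i m₁ ∧ capMatch i m₃ = capMatch i m₁ ∧
    ((m₁ i = i + 1 ∧ m₂ i ≠ i + 1 ∧ m₃ i ≠ i + 1 ∧ m₂ (i + 1) = m₃ i ∧ m₃ (i + 1) = m₂ i) ∨
     (m₂ i = i + 1 ∧ m₁ i ≠ i + 1 ∧ m₃ i ≠ i + 1 ∧ m₁ (i + 1) = m₃ i ∧ m₃ (i + 1) = m₁ i) ∨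
     (m₃ i = i + 1 ∧ m₁ i ≠ i + 1 ∧ m₂ i ≠ i + 1 ∧ m₁ (i + 1) = m₂ i ∧ m₂ (i + 1) = m₁ i)))

theorem CapCase.symm₂₃ {i : ℕ} (h : CapCase n i m₁ m₂ m₃) : CapCase n i m₁ m₃ m₂ := by
  rcases h with ⟨a, b, c, d, h, h1, h2⟩ | ⟨h1, h2, h3⟩
  · exact .inl ⟨_, _, _, _, h.swap_ab, h2, h1⟩
  · exact .inr ⟨h2, h1, by tauto⟩

theorem CapCase.symm₁₃ {i : ℕ} (h : CapCase n i m₁ m₂ m₃) : CapCase n i m₃ m₂ m₁ := by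
  rcases h with ⟨a, b, c, d, h, h1, h2⟩ | ⟨h1, h2, h3⟩
  · exact .inl ⟨_, _, _, _, h.swap_ac, h1.trans h2.symm, h2.symm⟩
  · exact .inr ⟨h1.trans h2.symm, h2.symm, by tauto⟩

theorem cap_of_other {m : ℕ → ℕ} (h : Pairing (n + 2) m) {i x y : ℕ} (hi : i ≤ n)
    (e : m (shiftUp i x) = shiftUp i y) : capMatch i m x = y := by
  rw [← shiftUp_inj i, shiftUp_capMatch h hi, e]
  have h1 := h.1 i
  have h2 := h.1 (i + 1)
  have : shiftUp i y ≠ i ∧ shiftUp i y ≠ i + 1 := by clear * -; grind [shiftUp]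
  rw [if_neg, if_neg]
  · rintro e'; rw [← e', e] at h2; exact this.2 h2
  · rintro e'; rw [← e', e] at h1; exact this.1 h1

theorem cap_of_merge {m : ℕ → ℕ} (h : Pairing (n + 2) m) {i x y : ℕ} (hi : i ≤ n)
    (e : m i = shiftUp i x) (e' : m (i + 1) = shiftUp i y) :
    capMatch i m x = y ∧ capMatch i m y = x := by
  refine ⟨(shiftUp_inj i).1 ?_, (shiftUp_inj i).1 ?_⟩
  · rw [shiftUp_capMatch h hi, e, e', if_pos rfl]
  · rw [shiftUp_capMatch h hi, e, e', if_pos rfl]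
    split_ifs with h1
    · exact h1
    · rfl

theorem exists_shiftUp {i j : ℕ} (h : j ≠ i) (h' : j ≠ i + 1) : ∃ x, j = shiftUp i x :=
  ⟨shiftDown i j, by grind [shiftUp, shiftDown]⟩

theorem shiftUp_ne (i j : ℕ) : shiftUp i j ≠ i ∧ shiftUp i j ≠ i + 1 := by grind [shiftUp]

/-- The first pairing joins `a` and `b`, so the maximum splits off a circle. In the other two it
merges two arcs into one joining `c` and `d`, as the first pairing does already. -/
theorem capCase_of_both (h : Triple (n + 2) m₁ m₂ m₃ a b c d) {i : ℕ} (hi : i ≤ n)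
    (ha : a = i) (hb : b = i + 1) : CapCase n i m₁ m₂ m₃ := by
  have k1 := shiftUp_capMatch h.pairing₁ hi
  have k2 := shiftUp_capMatch h.pairing₂ hi
  have k3 := shiftUp_capMatch h.pairing₃ hi
  obtain ⟨p1, p2, p3, hn, h1, h2, h3, ho⟩ := h
  subst ha hb
  have c1 := p1.1 c
  have e1 := p1.1 a
  rw [h1.1] at e1
  rw [h1.2] at c1
  right
  refine ⟨?_, ?_, ?_⟩
  · funext j
    rw [← shiftUp_inj a, k1, k2]
    obtain ⟨f1, f2⟩ := shiftUp_ne a j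
    have := ho (shiftUp a j) f1 f2
    generalize shiftUp a j = J at *
    clear k1 k2 k3 p1 p2 p3 ho
    grind
  · funext j
    rw [← shiftUp_inj a, k1, k3]
    obtain ⟨f1, f2⟩ := shiftUp_ne a j
    have := ho (shiftUp a j) f1 f2
    generalize shiftUp a j = J at *
    clear k1 k2 k3 p1 p2 p3 ho
    grind
  · left
    clear k1 k2 k3 p1 p2 p3 ho
    grind

/-- The maximum joins `a` to a strand `k` on which the three pairings agree; the partner `F` of `k`
takes over the role of `a` in the new triple. -/
theorem capCase_of_one (h : Triple (n + 2) m₁ m₂ m₃ a b c d) {i k : ℕ} (hi : i ≤ n)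
    (hik : (a = i ∧ k = i + 1) ∨ (a = i + 1 ∧ k = i)) (hb : b ≠ k) (hc : c ≠ k) (hd : d ≠ k) :
    CapCase n i m₁ m₂ m₃ := by
  have k1 := shiftUp_capMatch h.pairing₁ hi
  have k2 := shiftUp_capMatch h.pairing₂ hi
  have k3 := shiftUp_capMatch h.pairing₃ hi
  have q1 := h.pairing₁.cap hi
  have q2 := h.pairing₂.cap hi
  have q3 := h.pairing₃.cap hi
  obtain ⟨p1, p2, p3, hn, h1, h2, h3, ho⟩ := h
  have hak : a ≠ k := by clear * - hik; omega
  have ok := ho k hak.symm hb.symm hc.symm hd.symm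
  have a1 := p1.1 k
  have a2 := p1.2 k
  have a3 := p1.1 a
  have b1 := p1.1 c
  rw [h1.1] at a3
  rw [h1.2] at b1
  obtain ⟨F, hF⟩ : ∃ x, m₁ k = shiftUp i x := by
    have f1 : m₁ k ≠ k := by
      rw [Ne, a2]
      clear * - hik hi
      omega
    have f2 : m₁ k ≠ a := by rintro e; rw [e, h1.1] at a1; exact hb a1
    obtain ⟨rfl, rfl⟩ | ⟨rfl, rfl⟩ := hik
    · exact exists_shiftUp f2 f1
    · exact exists_shiftUp f1 f2
  have e : ∀ x, a ≠ x → x ≠ k → ∃ y, x = shiftUp i y := by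
    intro x h h'
    obtain ⟨rfl, rfl⟩ | ⟨rfl, rfl⟩ := hik
    · exact exists_shiftUp h.symm h'
    · exact exists_shiftUp h' h.symm
  obtain ⟨b', rfl⟩ := e b hn.1 hb
  obtain ⟨c', rfl⟩ := e c hn.2.1 hc
  obtain ⟨d', rfl⟩ := e d hn.2.2.1 hd
  have f : ∀ m, Pairing (n + 2) m → ∀ y, m a = shiftUp i y → m k = shiftUp i F →
      capMatch i m F = y := by
    rintro m hm y e1 e2
    obtain ⟨rfl, rfl⟩ | ⟨rfl, rfl⟩ := hik
    · exact (cap_of_merge hm hi e1 e2).2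
    · exact (cap_of_merge hm hi e2 e1).1
  have hFne : shiftUp i F ≠ shiftUp i b' ∧ shiftUp i F ≠ shiftUp i c' ∧
      shiftUp i F ≠ shiftUp i d' := by
    rw [hF] at a1
    refine ⟨?_, ?_, ?_⟩ <;> intro e <;> rw [e] at a1
    · exact hak (a3.symm.trans a1)
    · exact hd (h1.2.symm.trans a1)
    · exact hc (b1.symm.trans a1)
  simp only [ne_eq, shiftUp_inj] at hn hFne
  left
  refine ⟨F, b', c', d', ⟨q1, q2, q3, by tauto, ⟨f _ p1 _ h1.1 hF, cap_of_other p1 hi h1.2⟩,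
    ⟨f _ p2 _ h2.1 (ok.1.trans hF), cap_of_other p2 hi h2.2⟩,
    ⟨f _ p3 _ h3.1 (ok.2.trans hF), cap_of_other p3 hi h3.2⟩, ?_⟩, ?_⟩
  · intro j jF jb jc jd
    rw [← shiftUp_inj i, ← shiftUp_inj i (a := capMatch i m₃ j), k1, k2, k3]
    obtain ⟨f1, f2⟩ := shiftUp_ne i j
    have hja : shiftUp i j ≠ a := by
      rcases hik with h | h <;> rw [h.1]
      · exact f1
      · exact f2
    have := ho (shiftUp i j) hja (by rwa [Ne, shiftUp_inj]) (by rwa [Ne, shiftUp_inj])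
      (by rwa [Ne, shiftUp_inj])
    rw [Ne, ← shiftUp_inj i] at jF jb jc jd
    obtain ⟨rfl, rfl⟩ | ⟨rfl, rfl⟩ := hik
    · simp only [h1.1, h2.1, h3.1, ok, hF, jF, jb, jc, jd, if_false, this, and_self]
    · simp only [h1.1, h2.1, h3.1, ok, hF, jF, jb, jc, jd, if_false, this, and_self]
  · have := shiftUp_ne i F
    have := shiftUp_ne i b'
    have := shiftUp_ne i c'
    have := shiftUp_ne i d'
    obtain ⟨rfl, rfl⟩ | ⟨rfl, rfl⟩ := hik
    · rw [h1.1, h2.1, h3.1]; tauto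
    · rw [ok.1, ok.2]; tauto

theorem capCase_of_none (h : Triple (n + 2) m₁ m₂ m₃ a b c d) {i : ℕ} (hi : i ≤ n)
    (ha : a ≠ i ∧ a ≠ i + 1) (hb : b ≠ i ∧ b ≠ i + 1) (hc : c ≠ i ∧ c ≠ i + 1)
    (hd : d ≠ i ∧ d ≠ i + 1) : CapCase n i m₁ m₂ m₃ := by
  have k1 := shiftUp_capMatch h.pairing₁ hi
  have k2 := shiftUp_capMatch h.pairing₂ hi
  have k3 := shiftUp_capMatch h.pairing₃ hi
  have q1 := h.pairing₁.cap hi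
  have q2 := h.pairing₂.cap hi
  have q3 := h.pairing₃.cap hi
  obtain ⟨p1, p2, p3, hn, h1, h2, h3, ho⟩ := h
  have o1 := ho i ha.1.symm hb.1.symm hc.1.symm hd.1.symm
  have o2 := ho (i + 1) ha.2.symm hb.2.symm hc.2.symm hd.2.symm
  obtain ⟨a', rfl⟩ := exists_shiftUp ha.1 ha.2
  obtain ⟨b', rfl⟩ := exists_shiftUp hb.1 hb.2
  obtain ⟨c', rfl⟩ := exists_shiftUp hc.1 hc.2
  obtain ⟨d', rfl⟩ := exists_shiftUp hd.1 hd.2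
  simp only [ne_eq, shiftUp_inj] at hn
  left
  refine ⟨a', b', c', d', ⟨q1, q2, q3, hn, ⟨cap_of_other p1 hi h1.1, cap_of_other p1 hi h1.2⟩,
    ⟨cap_of_other p2 hi h2.1, cap_of_other p2 hi h2.2⟩,
    ⟨cap_of_other p3 hi h3.1, cap_of_other p3 hi h3.2⟩, ?_⟩, ?_⟩
  · intro j ja jb jc jd
    rw [← shiftUp_inj i, ← shiftUp_inj i (a := capMatch i m₃ j), k1, k2, k3, o1.1, o1.2, o2.1, o2.2]
    have := ho (shiftUp i j) (by rwa [Ne, shiftUp_inj]) (by rwa [Ne, shiftUp_inj])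
      (by rwa [Ne, shiftUp_inj]) (by rwa [Ne, shiftUp_inj])
    rw [this.1, this.2]
    exact ⟨rfl, rfl⟩
  · rw [o1.1, o1.2]; tauto

/-- Relabelling the four strands permutes the three pairings, so the cases in which `b`, `c` or `d`
is the other capped strand reduce to one. -/
theorem capCase_of_first (h : Triple (n + 2) m₁ m₂ m₃ a b c d) {i : ℕ} (hi : i ≤ n)
    (ha : a = i ∨ a = i + 1) : CapCase n i m₁ m₂ m₃ := by
  have key : ∀ {m₁ m₂ m₃ : ℕ → ℕ} {b c d : ℕ}, Triple (n + 2) m₁ m₂ m₃ a b c d →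
      (a = i ∧ b = i + 1 ∨ a = i + 1 ∧ b = i) → CapCase n i m₁ m₂ m₃ := by
    rintro m₁ m₂ m₃ b c d h (⟨ha, hb⟩ | ⟨ha, hb⟩)
    · exact h.capCase_of_both hi ha hb
    · exact (h.swap_ab.capCase_of_both hi hb ha).symm₂₃
  obtain ⟨k, hk⟩ : ∃ k, a = i ∧ k = i + 1 ∨ a = i + 1 ∧ k = i := by
    rcases ha with ha | ha
    · exact ⟨_, .inl ⟨ha, rfl⟩⟩
    · exact ⟨_, .inr ⟨ha, rfl⟩⟩
  by_cases hb : b = k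
  · subst hb; exact key h hk
  by_cases hc : c = k
  · subst hc; exact (key h.rotate hk).symm₁₃.symm₂₃.symm₁₃
  by_cases hd : d = k
  · subst hd; exact (key h.swap_bd hk).symm₁₃
  exact h.capCase_of_one hi hk hb hc hd

theorem capCase (h : Triple (n + 2) m₁ m₂ m₃ a b c d) {i : ℕ} (hi : i ≤ n) :
    CapCase n i m₁ m₂ m₃ := by
  by_cases ha : a = i ∨ a = i + 1
  · exact h.capCase_of_first hi ha
  by_cases hb : b = i ∨ b = i + 1
  · exact (h.swap_ab.capCase_of_first hi hb).symm₂₃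
  by_cases hc : c = i ∨ c = i + 1
  · exact (h.swap_ac.capCase_of_first hi hc).symm₁₃
  by_cases hd : d = i ∨ d = i + 1
  · exact (h.swap_ad.capCase_of_first hi hd).symm₁₃.symm₂₃.symm₁₃
  push Not at ha hb hc hd
  exact h.capCase_of_none hi ha hb hc hd

/-- The state sum at `a = 1` satisfies the Brauer relation. -/
theorem sum_eq_zero (h : Triple n m₁ m₂ m₃ a b c d) {w : List Slice} (hw : Fits w n 0) :
    (-2 : ℤ) ^ components w m₁ + (-2) ^ components w m₂ + (-2) ^ components w m₃ = 0 := by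
  induction w generalizing n m₁ m₂ m₃ a b c d with
  | nil =>
    cases hw
    have := (h.pairing₁.2 a).2 (by omega)
    exact absurd (h.first.1.symm.trans this).symm h.ne.1
  | cons y w ih =>
    obtain ⟨y, i⟩ := y
    obtain ⟨hi, hw⟩ := hw
    rcases y with _ | _ | s
    · exact ih (h.cup hi) hw
    · simp only [Tile.inp, Tile.out] at hi hw
      obtain ⟨n, rfl⟩ : ∃ n', n = n' + 2 := ⟨n - 2, by omega⟩
      simp only [components]
      rcases h.capCase (i := i) (by omega) with ⟨a, b, c, d, h, h1, h2⟩ | ⟨h1, h2, h3⟩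
      · simp only [h1, h2, pow_add, ← mul_add, ih h hw, mul_zero]
      · rw [h1, h2]
        -- One of the three terms carries a factor -2 and the two others a factor 1.
        rcases h3 with h3 | h3 | h3 <;> simp only [h3, if_true, if_false, pow_add] <;> ring
    · simp only [Tile.inp, Tile.out] at hi hw
      rw [show n - 2 + 2 = n by omega] at hw
      exact ih (h.swap hi) hw

/-- Two strands, their reconnection by a maximum and a minimum, and their crossing. -/
theorem of_cross {m : ℕ → ℕ} {i : ℕ} (hm : Pairing (n + 2) m) (hi : i ≤ n) (he : m i ≠ i + 1) :
    Triple (n + 2) m (cupMatch i (capMatch i m)) (swapMatch i m) i (m i) (i + 1) (m (i + 1)) := by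
  have k := shiftUp_capMatch hm hi
  have k' : ∀ j, j ≠ i → j ≠ i + 1 → cupMatch i (capMatch i m) j =
      if j = m i then m (i + 1) else if j = m (i + 1) then m i else m j := by
    intro j h1 h2
    obtain ⟨x, rfl⟩ := exists_shiftUp h1 h2
    rw [cupMatch, if_neg h1, if_neg h2, shiftDown_shiftUp, k]
  have e1 := hm.1 i
  have e2 := hm.1 (i + 1)
  have e3 : m i ≠ i := by rw [Ne, hm.2]; omega
  have e4 : m (i + 1) ≠ i + 1 := by rw [Ne, hm.2]; omega
  have e5 : m (i + 1) ≠ i := by rintro e; rw [e] at e2; exact he e2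
  have e6 : m (i + 1) ≠ m i := by rintro e; rw [e, e1] at e2; omega
  refine ⟨hm, (hm.cap hi).cup (by omega), hm.swap (by omega),
    ⟨e3.symm, by omega, e5.symm, he, e6.symm, e4.symm⟩, ⟨rfl, rfl⟩,
    ⟨by simp [cupMatch], by rw [k' _ e3 he, if_pos rfl]⟩, ⟨?_, ?_⟩, ?_⟩
  · simp only [swapMatch, Equiv.swap_apply_left]
    exact Equiv.swap_apply_of_ne_of_ne e5 e4
  · simp only [swapMatch, Equiv.swap_apply_of_ne_of_ne e3 he, e1, Equiv.swap_apply_left]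
  · intro j h1 h2 h3 h4
    have f1 : m j ≠ i := by rintro e; rw [← e, hm.1] at h2; exact h2 rfl
    have f2 : m j ≠ i + 1 := by rintro e; rw [← e, hm.1] at h4; exact h4 rfl
    refine ⟨by rw [k' _ h1 h3, if_neg h2, if_neg h4], ?_⟩
    simp only [swapMatch, Equiv.swap_apply_of_ne_of_ne h1 h3, Equiv.swap_apply_of_ne_of_ne f1 f2]

end Triple

/-- The degenerate case excluded from `Triple.of_cross`: strands that are already joined to each
other are reconnected to the same pairing in all three ways. -/
theorem hook_swap_of_loop {n i : ℕ} {m : ℕ → ℕ} (hm : Pairing (n + 2) m) (hi : i ≤ n)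
    (he : m i = i + 1) : cupMatch i (capMatch i m) = m ∧ swapMatch i m = m := by
  have k := shiftUp_capMatch hm hi
  have e : m (i + 1) = i := by rw [← he, hm.1]
  constructor
  · funext j
    by_cases h1 : j = i
    · subst h1; rw [cupMatch, if_pos rfl, he]
    by_cases h2 : j = i + 1
    · subst h2; rw [cupMatch, if_neg h1, if_pos rfl, e]
    obtain ⟨x, rfl⟩ := Triple.exists_shiftUp h1 h2
    rw [cupMatch, if_neg h1, if_neg h2, Triple.shiftDown_shiftUp, k, if_neg (by rwa [he]),
      if_neg (by rwa [e])]
  · funext j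
    by_cases h1 : j = i
    · subst h1; simp [swapMatch, e, he]
    by_cases h2 : j = i + 1
    · subst h2; simp [swapMatch, e, he]
    have f1 : m j ≠ i := by rintro f; rw [← hm.1 j, f] at h2; exact h2 he
    have f2 : m j ≠ i + 1 := by rintro f; rw [← hm.1 j, f] at h1; exact h1 e
    simp only [swapMatch, Equiv.swap_apply_of_ne_of_ne h1 h2, Equiv.swap_apply_of_ne_of_ne f1 f2]

/-- At `a = 1` the state sum counts components. -/
theorem ev_one_loopBracket {w : List Slice} {n : ℕ} {m : ℕ → ℕ} (hw : Fits w n 0)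
    (hm : Pairing n m) :
    ev (1 : ℤˣ) (loopBracket w m) = (-1) ^ crossings w * (-2) ^ components w m := by
  have hL : ev (1 : ℤˣ) loopValue = -2 := by simp [loopValue]
  induction w generalizing n m with
  | nil => simp [loopBracket, crossings, components]
  | cons y w ih =>
    obtain ⟨y, i⟩ := y
    obtain ⟨hi, hw⟩ := hw
    rcases y with _ | _ | s
    · exact ih hw (hm.cup hi)
    · simp only [Tile.inp, Tile.out] at hi hw
      obtain ⟨n, rfl⟩ : ∃ n', n = n' + 2 := ⟨n - 2, by omega⟩
      simp only [loopBracket, tileOp, capOp, map_mul, components, crossings, loopFactor]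
      rw [ih hw (hm.cap (by omega))]
      split_ifs
      · rw [hL]; ring
      · simp
    · simp only [Tile.inp, Tile.out] at hi hw
      rw [show n - 2 + 2 = n by omega] at hw
      obtain ⟨n, rfl⟩ : ∃ n', n = n' + 2 := ⟨n - 2, by omega⟩
      simp only [loopBracket, tileOp, capOp, cupOp, map_add, map_mul, components, crossings,
        loopFactor, eval₂_T, one_zpow, Units.val_one, one_mul]
      rw [ih hw hm, ih hw ((hm.cap (by omega)).cup (by omega))]
      -- For joined strands the two resolutions add up to 1 - 2 = -1. Otherwise the Brauer relation
      -- says that identity plus hook is minus the transposition, which is how `components` follows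
      -- a crossing.
      by_cases he : m i = i + 1
      · obtain ⟨e1, e2⟩ := hook_swap_of_loop hm (by omega) he
        rw [e1, e2, if_pos he, hL]; ring
      · have := (Triple.of_cross hm (by omega) he).sum_eq_zero hw
        rw [if_neg he, map_one]
        linear_combination (-1) ^ crossings w * this

/-! ## Directions -/

theorem shiftUp_succ (i j : ℕ) : shiftUp (i + 1) (j + 1) = shiftUp i j + 1 := by
  unfold shiftUp; split_ifs <;> omega

theorem stepAt_cup {b : Bool} {i : ℕ} {o o' : List Bool} (h : stepAt (.cup b) i o = some o') :
    o'[i]? = some b ∧ o'[i + 1]? = some (!b) ∧ ∀ j, o'[shiftUp i j]? = o[j]? := by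
  induction i generalizing o o' with
  | zero =>
    simp only [stepAt, Option.some.injEq] at h
    subst h
    exact ⟨rfl, rfl, fun j => by simp [shiftUp]⟩
  | succ i ih =>
    rcases o with _ | ⟨a, o⟩
    · simp [stepAt] at h
    · rw [stepAt_succ_cons] at h
      obtain ⟨p, hp, rfl⟩ := Option.map_eq_some_iff.1 h
      obtain ⟨h1, h2, h3⟩ := ih hp
      refine ⟨by simpa, by simpa, fun j => ?_⟩
      rcases j with _ | j
      · simp [shiftUp]
      · rw [shiftUp_succ, List.getElem?_cons_succ, List.getElem?_cons_succ, h3 j]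

theorem stepAt_cap {i : ℕ} {o o' : List Bool} (h : stepAt .cap i o = some o') :
    o[i]? ≠ o[i + 1]? ∧ ∀ j, o'[j]? = o[shiftUp i j]? := by
  induction i generalizing o o' with
  | zero =>
    rcases o with _ | ⟨a, _ | ⟨c, o⟩⟩ <;> simp [stepAt] at h
    obtain ⟨h, rfl⟩ := h
    exact ⟨by simpa using h, fun j => by simp [shiftUp]⟩
  | succ i ih =>
    rcases o with _ | ⟨a, o⟩
    · simp [stepAt] at h
    · rw [stepAt_succ_cons] at h
      obtain ⟨p, hp, rfl⟩ := Option.map_eq_some_iff.1 h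
      obtain ⟨h1, h2⟩ := ih hp
      refine ⟨by simpa using h1, fun j => ?_⟩
      rcases j with _ | j
      · simp [shiftUp]
      · rw [shiftUp_succ, List.getElem?_cons_succ, List.getElem?_cons_succ, h2 j]

theorem stepAt_cross {s : Bool} {i : ℕ} {o o' : List Bool}
    (h : stepAt (.cross s) i o = some o') : ∀ j, o'[j]? = o[Equiv.swap i (i + 1) j]? := by
  induction i generalizing o o' with
  | zero =>
    rcases o with _ | ⟨a, _ | ⟨c, o⟩⟩ <;> simp [stepAt] at h
    subst h
    rintro (_ | _ | j)
    · simp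
    · simp
    · rw [Equiv.swap_apply_of_ne_of_ne (by omega) (by omega)]; simp
  | succ i ih =>
    rcases o with _ | ⟨a, o⟩
    · simp [stepAt] at h
    · rw [stepAt_succ_cons] at h
      obtain ⟨p, hp, rfl⟩ := Option.map_eq_some_iff.1 h
      have h2 := ih hp
      intro j
      rcases j with _ | j
      · rw [Equiv.swap_apply_of_ne_of_ne (by omega) (by omega)]; simp
      · rw [List.getElem?_cons_succ, h2 j, ← List.getElem?_cons_succ (a := a)]
        congr 1
        grind

/-- Paired strands have opposite directions. -/
def Opposite (o : List Bool) (m : ℕ → ℕ) : Prop :=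
  ∀ j, j < o.length → o[m j]? ≠ o[j]?

theorem Opposite.cup {b : Bool} {i : ℕ} {o o' : List Bool} {m : ℕ → ℕ} (h : Opposite o m)
    (hs : stepAt (.cup b) i o = some o') : Opposite o' (cupMatch i m) := by
  obtain ⟨h1, h2, h3⟩ := stepAt_cup hs
  have hl := stepAt_length hs
  simp only [Tile.inp, Tile.out] at hl
  intro j hj
  by_cases e1 : j = i
  · subst e1; simp [cupMatch, h1, h2]
  by_cases e2 : j = i + 1
  · subst e2; simp [cupMatch, h1, h2]
  obtain ⟨x, rfl⟩ := Triple.exists_shiftUp e1 e2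
  rw [cupMatch, if_neg e1, if_neg e2, Triple.shiftDown_shiftUp, h3, h3]
  apply h
  unfold shiftUp at hj
  split_ifs at hj <;> omega

theorem Opposite.cap {i : ℕ} {o o' : List Bool} {m : ℕ → ℕ} (h : Opposite o m)
    (hm : Pairing o.length m) (hs : stepAt .cap i o = some o') : Opposite o' (capMatch i m) := by
  obtain ⟨h1, h2⟩ := stepAt_cap hs
  have hl := stepAt_length hs
  simp only [Tile.inp, Tile.out] at hl
  intro j hj
  have hj' : shiftUp i j < o.length := by unfold shiftUp; split_ifs <;> omega
  have hb : ∀ a, a < o.length → ∃ b, o[a]? = some b := fun a ha => ⟨_, List.getElem?_eq_getElem ha⟩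
  have hk := hm
  rw [show o.length = o'.length + 2 by omega] at hk
  have k := shiftUp_capMatch hk (i := i) (by omega) j
  rw [h2, h2, k]
  have a1 := h i (by omega)
  have a2 := h (i + 1) (by omega)
  have a3 := h _ hj'
  have lt : ∀ x, x < o.length → m x < o.length := by
    intro x hx
    by_contra hc
    have := (hm.2 (m x)).2 (by omega)
    rw [hm.1] at this
    rw [← this] at hc
    omega
  obtain ⟨b1, e1⟩ := hb i (by omega)
  obtain ⟨b2, e2⟩ := hb (i + 1) (by omega)
  obtain ⟨b3, e3⟩ := hb _ (lt i (by omega))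
  obtain ⟨b4, e4⟩ := hb _ (lt (i + 1) (by omega))
  split_ifs with c1 c2
  · rw [c1, e3, e4]; rw [e1, e3] at a1; rw [e2, e4] at a2; rw [e1, e2] at h1
    simp only [ne_eq, Option.some.injEq] at *
    revert a1 a2 h1; cases b1 <;> cases b2 <;> cases b3 <;> cases b4 <;> simp
  · rw [c2, e3, e4]; rw [e1, e3] at a1; rw [e2, e4] at a2; rw [e1, e2] at h1
    simp only [ne_eq, Option.some.injEq] at *
    revert a1 a2 h1; cases b1 <;> cases b2 <;> cases b3 <;> cases b4 <;> simp
  · exact a3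

theorem Opposite.swap {s : Bool} {i : ℕ} {o o' : List Bool} {m : ℕ → ℕ} (h : Opposite o m)
    (hs : stepAt (.cross s) i o = some o') : Opposite o' (swapMatch i m) := by
  have h1 := stepAt_cross hs
  have hl := stepAt_length hs
  simp only [Tile.inp, Tile.out] at hl
  intro j hj
  rw [h1, h1, swapMatch, Equiv.swap_apply_self]
  apply h
  rw [Equiv.swap_apply_def]
  split_ifs <;> omega

/-- Reconnecting two arcs compatibly with the directions changes the parity of the number of
components. -/
theorem Triple.components_odd {n : ℕ} {m₁ m₂ m₃ : ℕ → ℕ} {a b c d : ℕ}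
    (h : Triple n m₁ m₂ m₃ a b c d) {w : List Slice} {o : List Bool} {z : ℤ}
    (hn : o.length = n) (hw : orient w o = some z) (h₁ : Opposite o m₁) (h₃ : Opposite o m₃) :
    Odd (components w m₁ + components w m₃) := by
  induction w generalizing n m₁ m₂ m₃ a b c d o z with
  | nil =>
    rcases o with _ | ⟨x, o⟩
    · subst hn
      have := (h.pairing₁.2 a).2 (Nat.zero_le _)
      exact absurd (h.first.1.symm.trans this).symm h.ne.1
    · simp [orient] at hw
  | cons y w ih =>
    obtain ⟨y, i⟩ := y
    subst hn
    simp only [orient] at hw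
    obtain ⟨o', ho, hz⟩ := Option.bind_eq_some_iff.1 hw
    obtain ⟨z', hw', -⟩ := Option.map_eq_some_iff.1 hz
    clear hw hz
    have hl := stepAt_length ho
    rcases y with b | _ | s
    · simp only [Tile.inp, Tile.out] at hl
      exact ih (h.cup (by omega)) (by omega) hw' (h₁.cup ho) (h₃.cup ho)
    · simp only [Tile.inp, Tile.out] at hl
      have q1 := h.pairing₁
      have q3 := h.pairing₃
      have o1 := h₁.cap q1 ho
      have o3 := h₃.cap q3 ho
      rw [show o.length = o'.length + 2 by omega] at h q1 q3
      simp only [components]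
      rcases h.capCase (i := i) (by omega) with ⟨a, b, c, d, h, h1, h2⟩ | ⟨h1, h2, h3⟩
      · have := ih h rfl hw' o1 o3
        simp only [h2]
        grind
      · rw [h2]
        rcases h3 with h3 | h3 | h3
        · simp only [h3, if_true, if_false]; grind
        -- This reconnection contradicts the directions: the strand `m₁ (i + 1) = m₃ i` would be
        -- opposite both to `i + 1` and to `i`, while a maximum joins strands of opposite
        -- directions.
        · exfalso
          obtain ⟨f1, f2⟩ := stepAt_cap ho
          have a1 := h₁ i (by omega)
          have a2 := h₃ i (by omega)
          have a3 := h₁ (i + 1) (by omega)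
          have lt : m₁ (i + 1) < o.length := by
            by_contra hc
            have := (q1.2 (m₁ (i + 1))).2 (by omega)
            rw [q1.1] at this
            rw [← this] at hc
            omega
          rw [← h3.2.2.2.1] at a2
          rw [List.getElem?_eq_getElem lt] at a2 a3
          rw [List.getElem?_eq_getElem (show i < o.length by omega)] at a2 f1
          rw [List.getElem?_eq_getElem (show i + 1 < o.length by omega)] at a3 f1
          simp only [ne_eq, Option.some.injEq] at *
          revert a2 a3 f1
          cases o[i] <;> cases o[i + 1] <;> cases o[m₁ (i + 1)] <;> simp
        · simp only [h3, if_true, if_false]; grind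
    · simp only [Tile.inp, Tile.out] at hl
      exact ih (h.swap (by omega)) (by omega) hw' (h₁.swap ho) (h₃.swap ho)

/-! ## Exponents of the bracket modulo four -/

theorem coeff_T_mul (e k : ℤ) (f : LaurentPolynomial ℤ) :
    (T e * f).coeff k = f.coeff (k - e) := by
  have := AddMonoidAlgebra.coeff_single_mul_apply f (1 : ℤ) e k
  rw [one_mul] at this
  rw [sub_eq_neg_add]
  exact this

theorem ev_eq_sum {R : Type*} [CommRing R] (x : Rˣ) (f : LaurentPolynomial ℤ) :
    ev x f = f.coeff.sum fun k r => (r : R) * (x ^ k : Rˣ) := by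
  induction f using LaurentPolynomial.induction_on' with
  | add p q hp hq =>
    rw [map_add, hp, hq, AddMonoidAlgebra.coeff_add, Finsupp.sum_add_index'] <;> intros <;>
      push_cast <;> ring
  | C_mul_T n a =>
    rw [eval₂_C_mul_T, ← single_eq_C_mul_T, AddMonoidAlgebra.coeff_single, Finsupp.sum_single_index]
    · rfl
    · simp

/-- All exponents of `f` are congruent to `e` modulo `4`. -/
def ExponentsMod (e : ℤ) (f : LaurentPolynomial ℤ) : Prop := ∀ k, f.coeff k ≠ 0 → 4 ∣ k - e

namespace ExponentsMod

variable {e e' : ℤ} {f g : LaurentPolynomial ℤ}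

theorem congr (h : ExponentsMod e f) (he : 4 ∣ e' - e) : ExponentsMod e' f := fun k hk => by
  have := h k hk
  omega

theorem add (hf : ExponentsMod e f) (hg : ExponentsMod e g) : ExponentsMod e (f + g) := by
  intro k hk
  by_cases h : f.coeff k = 0
  · apply hg
    rw [AddMonoidAlgebra.coeff_add, Finsupp.add_apply, h, zero_add] at hk
    exact hk
  · exact hf k h

theorem neg (hf : ExponentsMod e f) : ExponentsMod e (-f) := by
  intro k hk
  apply hf
  rw [AddMonoidAlgebra.coeff_neg, Finsupp.neg_apply] at hk
  exact fun h => hk (by rw [h, neg_zero])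

theorem T_mul (hf : ExponentsMod e f) (k : ℤ) : ExponentsMod (k + e) (T k * f) := by
  intro j hj
  rw [coeff_T_mul] at hj
  have := hf _ hj
  omega

theorem loopValue_mul (hf : ExponentsMod e f) : ExponentsMod (e + 2) (loopValue * f) := by
  rw [loopValue, sub_mul, neg_mul, sub_eq_add_neg]
  exact ((hf.T_mul 2).neg.congr (by omega)).add ((hf.T_mul (-2)).neg.congr (by omega))

theorem one : ExponentsMod 0 1 := by
  intro k hk
  rw [← T_zero, T_apply] at hk
  split_ifs at hk with h
  · omega
  · exact absurd rfl hk

/-- If `k` is an exponent in a wrong class, the coefficient of the product at `k + 2` vanishes and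
forces `k + 4` to be an exponent as well; continuing, the support would be infinite. -/
theorem of_loopValue_mul (h : ExponentsMod (e + 2) (loopValue * f)) : ExponentsMod e f := by
  intro k hk
  by_contra hc
  have key : ∀ n : ℕ, f.coeff (k + 4 * n) ≠ 0 := by
    intro n
    induction n with
    | zero => simpa using hk
    | succ n ih =>
      have := mt (h (k + 4 * n + 2)) (by omega)
      rw [ne_eq, not_not, loopValue, sub_mul, neg_mul, AddMonoidAlgebra.coeff_sub,
        AddMonoidAlgebra.coeff_neg, Finsupp.sub_apply, Finsupp.neg_apply, coeff_T_mul,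
        coeff_T_mul] at this
      intro h0
      apply ih
      rw [show k + 4 * n + 2 - 2 = k + 4 * n by ring,
        show k + 4 * n + 2 - -2 = k + 4 * ((n + 1 : ℕ) : ℤ) by push_cast; ring, h0] at this
      linarith
  have inj : Function.Injective fun n : ℕ => k + 4 * (n : ℤ) := fun a b hab => by
    simp only at hab; omega
  have : Set.range (fun n : ℕ => k + 4 * (n : ℤ)) ⊆ (f.coeff.support : Set ℤ) := by
    rintro _ ⟨n, rfl⟩
    simpa using key n
  exact Set.infinite_range_of_injective inj (f.coeff.support.finite_toSet.subset this)

/-- The substitution drops all exponents not divisible by 4. Under the hypothesis there are none, so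
it only reindexes the sum. -/
theorem ev_substQuarter (hf : ExponentsMod 0 f) {R : Type*} [CommRing R] (x : Rˣ) :
    ev (x ^ (-4 : ℤ)) (substQuarter f) = ev x f := by
  rw [ev_eq_sum, ev_eq_sum, substQuarter]
  have hb : Set.BijOn (fun k : ℤ => -4 * k) ((fun k : ℤ => -4 * k) ⁻¹' (f.coeff.support : Set ℤ))
      (f.coeff.support : Set ℤ) := by
    refine ⟨fun k hk => hk, fun a _ b _ h => by simp only at h; omega, fun k hk => ?_⟩
    have := hf k (by simpa using hk)
    obtain ⟨j, hj⟩ := this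
    exact ⟨-j, by simp only [Set.mem_preimage]; rwa [show -4 * -j = k by omega],
      by simp only; omega⟩
  have := Finsupp.sum_comapDomain (fun k : ℤ => -4 * k) f.coeff
    (fun k r => (r : R) * (x ^ k : Rˣ)) hb
  rw [← this]
  simp only [Finsupp.sum, Function.comp_def, zpow_mul]

end ExponentsMod

/-! ### Parity of loops and the writhe modulo four -/

/-- The sign representation of the Temperley-Lieb category. -/
def signRep : TLRep ℤ ℤ (-1) where
  cup i := (-1 : ℤ) ^ i • LinearMap.id
  cap i := (-1 : ℤ) ^ (i + 1) • LinearMap.id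
  cap_cup i v := by
    simp only [LinearMap.smul_apply, LinearMap.id_apply, smul_smul, ← pow_add]
    rw [show i + 1 + i = 2 * i + 1 by ring, pow_succ, pow_mul]; simp
  zig i v := by
    simp only [LinearMap.smul_apply, LinearMap.id_apply, smul_smul, ← pow_add]
    rw [show i + 1 + 1 + i = 2 * (i + 1) by ring, pow_mul]; simp
  zag i v := by
    simp only [LinearMap.smul_apply, LinearMap.id_apply, smul_smul, ← pow_add]
    rw [show i + 1 + (i + 1) = 2 * (i + 1) by ring, pow_mul]; simp
  far_right i k v := by
    simp only [LinearMap.smul_apply, LinearMap.id_apply, smul_smul, ← pow_add]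
    rw [show i + 2 + k + 1 + i = 2 + (i + (i + k + 1)) by ring, pow_add]; simp
  far_left i k v := by
    simp only [LinearMap.smul_apply, LinearMap.id_apply, smul_smul, ← pow_add]
    rw [show i + 1 + (i + 2 + k) = 2 + (i + k + (i + 1)) by ring, pow_add]; simp

theorem signRep_cup (i : ℕ) (v : ℤ) : signRep.cup i v = (-1) ^ i * v := rfl

theorem signRep_cap (i : ℕ) (v : ℤ) : signRep.cap i v = (-1) ^ (i + 1) * v := rfl

/-- The product of the signs of the cups and caps of a word. -/
def cupCapSign : List Slice → ℤ
  | [] => 1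
  | (.cup _, i) :: w => (-1) ^ i * cupCapSign w
  | (.cap, i) :: w => (-1) ^ (i + 1) * cupCapSign w
  | (.cross _, _) :: w => cupCapSign w

/-- The sum of the unoriented signs of the crossings. -/
def crossSum : List Slice → ℤ
  | [] => 0
  | (.cup _, _) :: w => crossSum w
  | (.cap, _) :: w => crossSum w
  | (.cross s, _) :: w => (if s then 1 else -1) + crossSum w

theorem cupCapSign_eq (w : List Slice) : cupCapSign w = 1 ∨ cupCapSign w = -1 := by
  induction w with
  | nil => exact .inl rfl
  | cons x w ih =>
    obtain ⟨x, i⟩ := x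
    have h1 := neg_one_pow_eq_or ℤ i
    have h2 := neg_one_pow_eq_or ℤ (i + 1)
    rcases x with b | _ | s <;> simp only [cupCapSign]
    · rcases h1 with h1 | h1 <;> rcases ih with ih | ih <;> rw [h1, ih] <;> simp
    · rcases h2 with h2 | h2 <;> rcases ih with ih | ih <;> rw [h2, ih] <;> simp
    · exact ih

/-- A pairing without crossings, with its sign. -/
abbrev SignedPlanar (n : ℕ) (m : ℕ → ℕ) (ε : ℤ) : Prop := signRep.State 1 n m ε

namespace SignedPlanar

variable {n : ℕ} {m : ℕ → ℕ} {ε : ℤ}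

theorem sign (h : SignedPlanar n m ε) : ε = 1 ∨ ε = -1 := by
  induction h with
  | vacuum => exact .inl rfl
  | cup i _ _ ih =>
    rw [signRep_cup]
    have h1 := neg_one_pow_eq_or ℤ i
    rcases h1 with h1 | h1 <;> rcases ih with ih | ih <;> rw [h1, ih] <;> simp

theorem cap (h : SignedPlanar (n + 2) m ε) {i : ℕ} (hi : i ≤ n) :
    SignedPlanar n (capMatch i m) ((if m i = i + 1 then -1 else 1) * ((-1) ^ (i + 1) * ε)) := by
  obtain ⟨ε', h1, h2⟩ := TLRep.State.cap h hi
  rw [signRep_cap] at h2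
  rw [h2]
  convert h1 using 1
  split_ifs <;> simp

/-- The loop split off by a hook on joined strands compensates its sign; in the other case the sign
flips, which records the change in the parity of the number of loops. -/
theorem hook (h : SignedPlanar (n + 2) m ε) {i : ℕ} (hi : i ≤ n) :
    SignedPlanar (n + 2) (cupMatch i (capMatch i m)) (if m i = i + 1 then ε else -ε) := by
  have := TLRep.State.cup i hi (h.cap hi)
  rw [signRep_cup] at this
  convert this using 1
  have h1 := neg_one_pow_eq_or ℤ i
  rcases h1 with h1 | h1 <;> split_ifs <;> rw [pow_succ, h1] <;> ring

/-- A planar state with k loops has exponents congruent to 2k, that is to 1 - (-1)ᵏ, up to those of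
its crossing weights, and (-1)ᵏ is the product of the signs of its cups and caps. Resolving a
crossing the other way changes the weight by a factor a² or a⁻² and also the parity of k, so all
states agree modulo 4. -/
theorem exponentsMod (h : SignedPlanar n m ε) {w : List Slice} (hw : Fits w n 0) :
    ExponentsMod (crossSum w + 1 - cupCapSign w * ε) (loopBracket w m) := by
  induction w generalizing n m ε with
  | nil =>
    cases hw
    cases h
    simpa [loopBracket, crossSum, cupCapSign] using ExponentsMod.one
  | cons x w ih =>
    obtain ⟨x, i⟩ := x
    obtain ⟨hi, hw⟩ := hw
    rcases x with b | _ | s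
    · have := ih (TLRep.State.cup i hi h) hw
      rw [signRep_cup, ← mul_assoc, mul_comm (cupCapSign w)] at this
      exact this
    · simp only [Tile.inp, Tile.out] at hi hw
      obtain ⟨n, rfl⟩ : ∃ n', n = n' + 2 := ⟨n - 2, by omega⟩
      have := ih (h.cap (i := i) (by omega)) hw
      simp only [loopBracket, tileOp, capOp, loopFactor, crossSum, cupCapSign]
      have hk : cupCapSign w * ((-1) ^ (i + 1) * ε) = 1 ∨
          cupCapSign w * ((-1) ^ (i + 1) * ε) = -1 := by
        rcases cupCapSign_eq w with h1 | h1 <;> rcases neg_one_pow_eq_or ℤ (i + 1) with h2 | h2 <;>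
          rcases h.sign with h3 | h3 <;> rw [h1, h2, h3] <;> simp
      rw [show (-1) ^ (i + 1) * cupCapSign w * ε = cupCapSign w * ((-1) ^ (i + 1) * ε) by ring]
      split_ifs at this ⊢
      · refine this.loopValue_mul.congr ?_
        rw [show cupCapSign w * (-1 * ((-1) ^ (i + 1) * ε)) =
          -(cupCapSign w * ((-1) ^ (i + 1) * ε)) by ring]
        rcases hk with hk | hk <;> rw [hk] <;> omega
      · rw [one_mul] at this ⊢
        exact this
    · simp only [Tile.inp, Tile.out] at hi hw
      rw [show n - 2 + 2 = n by omega] at hw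
      obtain ⟨n, rfl⟩ : ∃ n', n = n' + 2 := ⟨n - 2, by omega⟩
      have h1 := ih h hw
      have h2 := ih (h.hook (i := i) (by omega)) hw
      have hk : cupCapSign w * ε = 1 ∨ cupCapSign w * ε = -1 := by
        rcases cupCapSign_eq w with h1 | h1 <;>
          rcases h.sign with h3 | h3 <;> rw [h1, h3] <;> simp
      simp only [loopBracket, tileOp, capOp, cupOp, loopFactor, crossSum, cupCapSign]
      refine ((h1.T_mul _).congr ?_).add ?_
      · omega
      · split_ifs at h2 ⊢ with he hs hs
        · exact (h2.loopValue_mul.T_mul (-1)).congr (by omega)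
        · rw [one_mul]
          exact (h2.T_mul (-1)).congr (by rw [mul_neg]; omega)
        · exact (h2.loopValue_mul.T_mul 1).congr (by omega)
        · rw [one_mul]
          exact (h2.T_mul 1).congr (by rw [mul_neg]; omega)

/-- Each crossing is smoothed compatibly with the directions, which keeps the pairing planar and
changes the parity of the number of components by `Triple.components_odd`. The writhe plus the
unoriented sum of signs keeps track of these parities. -/
theorem writhe_mod_four (h : SignedPlanar n m ε) {w : List Slice} {o : List Bool} {z : ℤ}
    (hn : o.length = n) (hw : orient w o = some z) (ho : Opposite o m) :
    4 ∣ z + crossSum w - 1 + cupCapSign w * ε * (-1) ^ components w m := by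
  induction w generalizing n m ε o z with
  | nil =>
    rcases o with _ | ⟨x, o⟩
    · subst hn
      cases h
      simp only [orient, Option.some.injEq] at hw
      simp [← hw, crossSum, cupCapSign, components]
    · simp [orient] at hw
  | cons x w ih =>
    obtain ⟨x, i⟩ := x
    subst hn
    simp only [orient] at hw
    obtain ⟨o', hs, hz⟩ := Option.bind_eq_some_iff.1 hw
    obtain ⟨z', hw', rfl⟩ := Option.map_eq_some_iff.1 hz
    clear hw hz
    have hl := stepAt_length hs
    rcases x with b | _ | s
    · simp only [Tile.inp, Tile.out] at hl
      have := ih (TLRep.State.cup i (by omega) h) (by omega) hw' (ho.cup hs)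
      rw [signRep_cup, ← mul_assoc (cupCapSign w), mul_comm (cupCapSign w)] at this
      simpa only [crossingSign, zero_add, crossSum, cupCapSign, components] using this
    · simp only [Tile.inp, Tile.out] at hl
      have hp := ho.cap h.pairing hs
      rw [show o.length = o'.length + 2 by omega] at h
      have := ih (h.cap (i := i) (by omega)) rfl hw' hp
      simp only [crossingSign, zero_add, crossSum, cupCapSign, components]
      convert this using 2
      split_ifs
      · rw [pow_add]; ring
      · rw [pow_add]; ring
    · simp only [Tile.inp, Tile.out] at hl
      have q1 := stepAt_cross hs
      have hsw := ho.swap hs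
      have hk : cupCapSign w * ε = 1 ∨ cupCapSign w * ε = -1 := by
        rcases cupCapSign_eq w with h1 | h1 <;>
          rcases h.sign with h3 | h3 <;> rw [h1, h3] <;> simp
      obtain ⟨n, hn⟩ : ∃ n', o.length = n' + 2 := ⟨o.length - 2, by omega⟩
      have hn' : o'.length = n + 2 := by omega
      rw [hn] at h
      have hi : i ≤ n := by omega
      have hl1 : i < o.length := by omega
      have hl2 : i + 1 < o.length := by omega
      simp only [crossingSign, crossSum, cupCapSign, components]
      by_cases he : m i = i + 1
      · obtain ⟨e1, e2⟩ := hook_swap_of_loop h.pairing hi he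
        have hne : o[i]? ≠ o[i + 1]? := by
          have := ho i hl1
          rw [he] at this
          exact this.symm
        rw [e2] at hsw ⊢
        have := ih h hn' hw' hsw
        rw [if_neg hne]
        split_ifs <;> omega
      · have ht := Triple.of_cross h.pairing hi he
        -- For parallel strands both signs agree and add up to ±2, which offsets the change of
        -- parity. For opposite ones they cancel, and the change of parity is offset by the sign of
        -- the hook.
        by_cases hpar : o[i]? = o[i + 1]?
        · have ho' : Opposite o' m := by
            have : o' = o := by
              apply List.ext_getElem?
              intro j
              rw [q1, Equiv.swap_apply_def]
              split_ifs with c1 c2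
              · rw [c1, hpar]
              · rw [c2, hpar]
              · rfl
            rwa [this]
          have hodd := ht.components_odd hn' hw' ho' hsw
          have := ih h hn' hw' ho'
          rw [if_pos hpar]
          have hc : (-1 : ℤ) ^ components w (swapMatch i m) = -(-1) ^ components w m := by
            have := hodd.neg_one_pow (α := ℤ)
            rw [pow_add] at this
            rcases neg_one_pow_eq_or ℤ (components w m) with e | e <;> rw [e] at this ⊢ <;> linarith
          rw [hc]
          rcases neg_one_pow_eq_or ℤ (components w m) with e | e <;> rw [e] at this ⊢ <;>
            split_ifs <;> omega
        · have hh : Opposite o' (cupMatch i (capMatch i m)) := by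
            intro j hj
            have := ht.rotate
            by_cases c1 : j = i
            · subst c1
              simp only [cupMatch, if_true, q1]
              simpa using hpar
            by_cases c2 : j = i + 1
            · subst c2
              simp only [cupMatch, if_true, q1]
              simpa using fun h => hpar h.symm
            have hj' := hsw j hj
            have k := shiftUp_capMatch h.pairing hi
            obtain ⟨x, rfl⟩ := Triple.exists_shiftUp c1 c2
            have oi := ho i hl1
            have oi1 := ho (i + 1) hl2
            have ox := ho (shiftUp i x) (by omega)
            have e1 : ∀ y, o'[shiftUp i y]? = o[shiftUp i y]? := fun y => by
              obtain ⟨f1, f2⟩ := Triple.shiftUp_ne i y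
              rw [q1, Equiv.swap_apply_of_ne_of_ne f1 f2]
            rw [cupMatch, if_neg c1, if_neg c2, Triple.shiftDown_shiftUp, e1, e1, k]
            have lt : ∀ x, x < o.length → m x < o.length := by
              intro x hx
              by_contra hc
              have := (h.pairing.2 (m x)).2 (by omega)
              rw [h.pairing.1] at this
              rw [← this] at hc
              omega
            have hb : ∀ a, a < o.length → ∃ b, o[a]? = some b :=
              fun a ha => ⟨_, List.getElem?_eq_getElem ha⟩
            obtain ⟨b1, g1⟩ := hb i hl1
            obtain ⟨b2, g2⟩ := hb (i + 1) hl2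
            obtain ⟨b3, g3⟩ := hb _ (lt i hl1)
            obtain ⟨b4, g4⟩ := hb _ (lt (i + 1) hl2)
            rw [g1, g2] at hpar
            rw [g1, g3] at oi
            rw [g2, g4] at oi1
            split_ifs with d1 d2
            · rw [d1, g3, g4]
              simp only [ne_eq, Option.some.injEq] at *
              revert oi oi1 hpar; cases b1 <;> cases b2 <;> cases b3 <;> cases b4 <;> simp
            · rw [d2, g3, g4]
              simp only [ne_eq, Option.some.injEq] at *
              revert oi oi1 hpar; cases b1 <;> cases b2 <;> cases b3 <;> cases b4 <;> simp
            · exact ox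
          have hodd := ht.rotate.components_odd hn' hw' hh hsw
          have := ih (h.hook hi) hn' hw' hh
          rw [if_neg he] at this
          rw [if_neg hpar]
          have hc : (-1 : ℤ) ^ components w (swapMatch i m) =
              -(-1) ^ components w (cupMatch i (capMatch i m)) := by
            have := hodd.neg_one_pow (α := ℤ)
            rw [pow_add] at this
            rcases neg_one_pow_eq_or ℤ (components w (cupMatch i (capMatch i m))) with e | e <;>
              rw [e] at this ⊢ <;> linarith
          rw [hc, mul_neg (cupCapSign w * ε)]
          rw [mul_neg, neg_mul] at this
          split_ifs <;> omega

end SignedPlanar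

theorem crossSum_mod_two (w : List Slice) : 2 ∣ crossSum w - crossings w := by
  induction w with
  | nil => simp [crossSum, crossings]
  | cons x w ih =>
    obtain ⟨x, i⟩ := x
    rcases x with b | _ | s <;> simp only [crossSum, crossings]
    · exact ih
    · exact ih
    · push_cast
      split_ifs <;> omega

theorem orient_mod_two {w : List Slice} {o : List Bool} {z : ℤ} (h : orient w o = some z) :
    2 ∣ z - crossings w := by
  induction w generalizing o z with
  | nil =>
    rcases o with _ | ⟨x, o⟩
    · simp only [orient, Option.some.injEq] at h
      simp [← h, crossings]
    · simp [orient] at h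
  | cons x w ih =>
    obtain ⟨x, i⟩ := x
    simp only [orient] at h
    obtain ⟨o', hs, hz⟩ := Option.bind_eq_some_iff.1 h
    obtain ⟨z', hw', rfl⟩ := Option.map_eq_some_iff.1 hz
    have := ih hw'
    rcases x with b | _ | s <;> simp only [crossingSign, crossings]
    · simpa using this
    · simpa using this
    · push_cast
      split_ifs <;> omega

theorem writheFactor_eq (z : ℤ) : writheFactor z = T (-3 * z) ∨ writheFactor z = -T (-3 * z) := by
  rw [writheFactor, Units.smul_def]
  rcases Int.units_eq_one_or ((-1 : ℤˣ) ^ (-3 * z)) with h | h <;> rw [h] <;> simp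

/-- For one component the two congruences combine to: the exponents of the bracket are congruent to
minus the writhe w. The writhe factor shifts them by -3w, hence to multiples of 4. -/
theorem KnotDiagram.X_exponents (D : KnotDiagram) : ExponentsMod 0 D.X := by
  have h0 : SignedPlanar 0 id 1 := .vacuum
  have h1 := h0.exponentsMod D.fits
  have h2 := h0.writhe_mod_four rfl D.orient_eq (fun j hj => by simp at hj)
  rw [D.components_eq, pow_one] at h2
  rw [← D.bracket_eq] at h1
  have h3 : ExponentsMod (crossSum D.word - 1 - cupCapSign D.word) D.bracket :=
    ExponentsMod.of_loopValue_mul (h1.congr (by omega))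
  have e1 := crossSum_mod_two D.word
  have e2 := orient_mod_two D.orient_eq
  have key : ExponentsMod 0 (T (-3 * D.writhe) * D.bracket) := (h3.T_mul _).congr (by omega)
  rw [X]
  rcases writheFactor_eq D.writhe with h | h <;> rw [h]
  · exact key
  · rw [neg_mul]
    exact key.neg

theorem KnotDiagram.ev_jones (D : KnotDiagram) {R : Type*} [CommRing R] (x : Rˣ) :
    ev (x ^ (-4 : ℤ)) D.knot.jones = ev x D.X :=
  D.X_exponents.ev_substQuarter x

/-! ## Special values of the Jones polynomial -/

theorem map_ev {R S : Type*} [CommRing R] [CommRing S] (φ : R →+* S) (x : Rˣ)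
    (f : LaurentPolynomial ℤ) : φ (ev x f) = ev (Units.map φ x) f := by
  rw [ev_eq_sum, ev_eq_sum, Finsupp.sum, map_sum, Finsupp.sum]
  refine Finset.sum_congr rfl fun k _ => ?_
  rw [map_mul, map_intCast, ← map_zpow]
  rfl

/-- If a loop has value `1` then all state sums are equal up to sign. -/
theorem ev_loopBracket_of_loopValue_eq_one {R : Type*} [CommRing R] {x : Rˣ}
    (hx : (x : R) + (x⁻¹ : Rˣ) = -1) (hL : ev x loopValue = 1) (w : List Slice) (m : ℕ → ℕ) :
    ev x (loopBracket w m) = (-1) ^ crossings w := by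
  induction w generalizing m with
  | nil => simp [loopBracket, crossings]
  | cons y w ih =>
    obtain ⟨y, i⟩ := y
    rcases y with b | _ | s
    · exact ih _
    · simp only [loopBracket, tileOp, capOp, loopFactor, map_mul, ih, crossings]
      split_ifs
      · rw [hL, one_mul]
      · rw [map_one, one_mul]
    · have hl : ev x (if m i = i + 1 then loopValue else 1) = 1 := by
        split_ifs
        · exact hL
        · exact map_one _
      simp only [loopBracket, tileOp, capOp, cupOp, loopFactor, map_add, map_mul, ih, crossings,
        eval₂_T, hl]
      rcases s <;> simp only [if_true, if_false, Bool.false_eq_true, zpow_one, zpow_neg, pow_succ] <;>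
        linear_combination (-1) ^ crossings w * hx

theorem KnotDiagram.ev_bracket (D : KnotDiagram) {R : Type*} [CommRing R] (x : Rˣ) :
    ev x loopValue * ev x D.bracket = ev x (loopBracket D.word id) := by
  rw [← map_mul, D.bracket_eq]

theorem ev_writheFactor {R : Type*} [CommRing R] (x : Rˣ) (z : ℤ) :
    ev x (writheFactor z) = (((-1) ^ z : ℤˣ) : ℤ) * ((x ^ (-3 * z) : Rˣ) : R) := by
  rw [writheFactor, Units.smul_def, map_zsmul, eval₂_T, zsmul_eq_mul]
  congr 3
  rw [show -3 * z = z + 2 * (-2 * z) by ring, zpow_add, zpow_mul (-1) 2]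
  simp

theorem neg_one_zpow_mul_pow {z : ℤ} {k : ℕ} (h : 2 ∣ z - k) :
    (((-1) ^ z : ℤˣ) : ℤ) * (-1) ^ k = 1 := by
  obtain ⟨j, hj⟩ := h
  rw [show z = 2 * j + k by omega, zpow_add, zpow_mul]
  simp [← mul_pow]

/-- At a = 1 the state sum only sees the number of components and the parity of the number of
crossings, and the latter is the parity of the writhe. -/
theorem KnotDiagram.ev_one_jones (D : KnotDiagram) : ev (1 : ℤˣ) D.knot.jones = 1 := by
  have h1 := D.ev_jones (1 : ℤˣ)
  rw [one_zpow] at h1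
  have h2 := D.ev_bracket (1 : ℤˣ)
  rw [ev_one_loopBracket D.fits pairing_id, D.components_eq,
    show ev (1 : ℤˣ) loopValue = -2 by simp [loopValue]] at h2
  have h3 : ev (1 : ℤˣ) D.bracket = (-1) ^ crossings D.word := by linarith
  rw [h1, X, map_mul, ev_writheFactor, h3]
  have := neg_one_zpow_mul_pow (orient_mod_two D.orient_eq)
  simpa using this

/-- The Eisenstein integers. -/
abbrev Eisenstein : Type := QuadraticAlgebra ℤ (-1) (-1)

/-- The primitive third root of unity. -/
def cubeRoot : Eisensteinˣ where
  val := ⟨0, 1⟩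
  inv := ⟨-1, -1⟩
  val_inv := by decide
  inv_val := by decide

theorem cubeRoot_pow_three : cubeRoot ^ 3 = 1 := by decide

/-- At a = ω² a loop has value 1 and a + a⁻¹ = -1, so every crossing contributes -1 whatever the
pairing; and a⁻⁴ = ω. -/
theorem KnotDiagram.ev_cubeRoot_jones (D : KnotDiagram) : ev cubeRoot D.knot.jones = 1 := by
  have e1 : (cubeRoot ^ 2) ^ (-4 : ℤ) = cubeRoot := by decide
  have h1 := D.ev_jones (cubeRoot ^ 2)
  rw [e1] at h1
  have hL : ev (cubeRoot ^ 2) loopValue = 1 := by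
    simp only [loopValue, map_sub, map_neg, eval₂_T]
    decide
  have h2 := D.ev_bracket (cubeRoot ^ 2)
  rw [hL, one_mul, ev_loopBracket_of_loopValue_eq_one (by decide) hL] at h2
  rw [h1, X, map_mul, ev_writheFactor, h2, zpow_mul,
    show (cubeRoot ^ 2) ^ (-3 : ℤ) = 1 by decide, one_zpow, Units.val_one, mul_one]
  have := neg_one_zpow_mul_pow (orient_mod_two D.orient_eq)
  exact_mod_cast congrArg (Int.cast (R := Eisenstein)) this

theorem Knot.exists_diagram (K : Knot) : ∃ D : KnotDiagram, D.knot = K := Quot.exists_rep K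

theorem Knot.jones_ne_zero (K : Knot) : K.jones ≠ 0 := by
  obtain ⟨D, rfl⟩ := K.exists_diagram
  intro h
  have := D.ev_one_jones
  rw [h, map_zero] at this
  exact zero_ne_one this

/-- Modulo 2 the points -1 and 1 coincide, so V(-1) is congruent to V(1) = 1. -/
theorem Knot.odd_det (K : Knot) : Odd K.det := by
  obtain ⟨D, rfl⟩ := K.exists_diagram
  rw [Knot.det, Int.natAbs_odd]
  have h1 := congrArg (Int.castRingHom (ZMod 2)) D.ev_one_jones
  rw [map_ev, map_one] at h1
  have h2 := map_ev (Int.castRingHom (ZMod 2)) (-1) D.knot.jones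
  rw [show Units.map (Int.castRingHom (ZMod 2) : ℤ →* ZMod 2) (-1 : ℤˣ) =
    1 by decide, h1, map_one] at h2
  rw [show RingHom.id ℤ = Int.castRingHom ℤ from RingHom.ext_int _ _]
  rw [← Int.not_even_iff_odd, even_iff_two_dvd]
  intro h
  have := (ZMod.intCast_zmod_eq_zero_iff_dvd _ 2).2 h
  rw [eq_intCast] at h2
  rw [h2] at this
  exact one_ne_zero this

/-! ### Possible spans -/

theorem span_eq_of_support {K : Knot} {p q : ℤ} (hp : K.jones.coeff p ≠ 0)
    (hq : K.jones.coeff q ≠ 0) (h : ∀ k, K.jones.coeff k ≠ 0 → p ≤ k ∧ k ≤ q) :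
    K.span = q - p := by
  have h1 : IsGreatest (K.jones.coeff.support : Set ℤ) q :=
    ⟨by simpa using hq, fun k hk => (h k (by simpa using hk)).2⟩
  have h2 : IsLeast (K.jones.coeff.support : Set ℤ) p :=
    ⟨by simpa using hp, fun k hk => (h k (by simpa using hk)).1⟩
  rw [Knot.span, h1.csSup_eq, h2.csInf_eq]

theorem Knot.exists_support (K : Knot) : ∃ p q : ℤ, p ≤ q ∧ K.jones.coeff p ≠ 0 ∧
    K.jones.coeff q ≠ 0 ∧ (∀ k, K.jones.coeff k ≠ 0 → p ≤ k ∧ k ≤ q) ∧ K.span = q - p := by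
  have hne : K.jones.coeff.support.Nonempty := by
    rw [Finsupp.support_nonempty_iff]
    intro h
    exact K.jones_ne_zero (AddMonoidAlgebra.coeff_injective (by rw [h]; rfl))
  have hp := Finset.min'_mem _ hne
  have hq := Finset.max'_mem _ hne
  have h : ∀ k, K.jones.coeff k ≠ 0 →
      K.jones.coeff.support.min' hne ≤ k ∧ k ≤ K.jones.coeff.support.max' hne := fun k hk =>
    ⟨Finset.min'_le _ _ (by simpa using hk), Finset.le_max' _ _ (by simpa using hk)⟩
  rw [Finsupp.mem_support_iff] at hp hq
  exact ⟨_, _, (h _ hp).2, hp, hq, h, span_eq_of_support hp hq h⟩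

/-- If V = tᵖ (a + b t + c t²), the values at 1 and ω give a + b + c = 1 and a + b ω + c ω² = ω⁻ᵖ.
For each residue of p modulo 3 the unique integral solution has exactly one nonzero coefficient, so
V would be a monomial. -/
theorem Knot.span_eq_zero_or (K : Knot) : K.span = 0 ∨ 3 ≤ K.span := by
  obtain ⟨p, q, hpq, hp, hq, h, hs⟩ := K.exists_support
  by_contra hc
  have hle : q ≤ p + 2 := by omega
  obtain ⟨D, rfl⟩ := K.exists_diagram
  set f := D.knot.jones
  have hsub : f.coeff.support ⊆ {p, p + 1, p + 2} := by
    intro k hk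
    have := h k (by simpa using hk)
    simp only [Finset.mem_insert, Finset.mem_singleton]
    omega
  have key : ∀ {R : Type} [CommRing R] (x : Rˣ), ev x f =
      ((x ^ p : Rˣ) : R) * (f.coeff p + f.coeff (p + 1) * x + f.coeff (p + 2) * x ^ 2) := by
    intro R _ x
    rw [ev_eq_sum, Finsupp.sum_of_support_subset _ hsub _ (by simp), Finset.sum_insert (by simp),
      Finset.sum_insert (by simp), Finset.sum_singleton, zpow_add, zpow_add, zpow_one]
    norm_cast
    push_cast
    ring
  have h1 := D.ev_one_jones
  rw [key] at h1
  have h2 := D.ev_cubeRoot_jones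
  rw [key] at h2
  simp only [one_zpow, Units.val_one, one_mul, mul_one, one_pow, Int.cast_id] at h1
  have h3 : cubeRoot ^ p = 1 ∨ cubeRoot ^ p = cubeRoot ∨ cubeRoot ^ p = cubeRoot ^ 2 := by
    rw [← Int.mul_ediv_add_emod p 3, zpow_add, zpow_mul]
    have : cubeRoot ^ (3 : ℤ) = 1 := cubeRoot_pow_three
    rw [this, one_zpow, one_mul]
    have : p % 3 = 0 ∨ p % 3 = 1 ∨ p % 3 = 2 := by omega
    rcases this with h | h | h <;> rw [h]
    · exact .inl rfl
    · exact .inr (.inl (zpow_one _))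
    · exact .inr (.inr rfl)
  have hc : q ≠ p := by omega
  have hq' : q = p + 1 ∨ q = p + 2 := by omega
  have hq'' : f.coeff (p + 1) ≠ 0 ∨ f.coeff (p + 2) ≠ 0 := by
    rcases hq' with rfl | rfl
    · exact .inl hq
    · exact .inr hq
  generalize f.coeff p = a at *
  generalize f.coeff (p + 1) = b at *
  generalize f.coeff (p + 2) = c at *
  have c2 : (cubeRoot : Eisenstein) ^ 2 = ⟨-1, -1⟩ := by decide
  have c1 : (cubeRoot : Eisenstein) = ⟨0, 1⟩ := rfl
  rcases h3 with h3 | h3 | h3 <;>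
    · simp only [h3, Units.val_pow_eq_pow_val, Units.val_one, one_mul] at h2
      rw [c2, c1, QuadraticAlgebra.ext_iff] at h2
      simp [QuadraticAlgebra.re_one, QuadraticAlgebra.im_one] at h2
      omega

/-! ## Quadratic Gauss sums over the field with three elements -/

/-- The standard character of `ZMod 3`. -/
noncomputable abbrev chi : AddChar (ZMod 3) ℂ := ZMod.stdAddChar

/-- `z` has norm square an integral power of three. -/
def IsPowThree (z : ℂ) : Prop := ∃ j : ℤ, Complex.normSq z = 3 ^ j

theorem IsPowThree.mul {z z' : ℂ} (h : IsPowThree z) (h' : IsPowThree z') :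
    IsPowThree (z * z') := by
  obtain ⟨j, hj⟩ := h
  obtain ⟨j', hj'⟩ := h'
  exact ⟨j + j', by rw [map_mul, hj, hj', zpow_add₀ (by norm_num)]⟩

theorem IsPowThree.inv {z : ℂ} (h : IsPowThree z) : IsPowThree z⁻¹ := by
  obtain ⟨j, hj⟩ := h
  exact ⟨-j, by rw [map_inv₀, hj, zpow_neg]⟩

theorem isPowThree_one : IsPowThree 1 := ⟨0, by simp⟩

theorem isPowThree_three : IsPowThree 3 := ⟨2, by norm_num [Complex.normSq_apply]⟩

theorem isPowThree_of_norm {z : ℂ} (h : ‖z‖ = 1) : IsPowThree z :=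
  ⟨0, by rw [Complex.normSq_eq_norm_sq, h]; simp⟩

theorem isPowThree_chi (t : ZMod 3) : IsPowThree (chi t) := isPowThree_of_norm (by simp)

theorem isPowThree_sqrt : IsPowThree (Real.sqrt 3 : ℂ) :=
  ⟨1, by rw [Complex.normSq_ofReal]; simp⟩

/-- Expanding the square and shifting one variable turns it into a sum of χ(Q h) Σ_y χ(B(h, y)). By
orthogonality of characters only the radical of the polar form survives, and the result is |W| times
the order of the radical. -/
theorem isPowThree_gaussSum {W : Type} [AddCommGroup W] [Module (ZMod 3) W] [Fintype W]
    (Q : QuadraticForm (ZMod 3) W) : IsPowThree (∑ x, chi (Q x)) := by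
  classical
  let B := QuadraticMap.polarBilin Q
  have hB : ∀ h y, Q (y + h) - Q y = Q h + B h y := fun h y => by
    simp only [B, QuadraticMap.polarBilin_apply_apply, QuadraticMap.polar]
    rw [add_comm y h]
    ring
  have hsum : ∀ h, ∑ y, chi (B h y) = if B h = 0 then (Fintype.card W : ℂ) else 0 := by
    intro h
    split_ifs with h0
    · simp [h0]
    · let φ : AddChar W ℂ := chi.compAddMonoidHom (B h).toAddMonoidHom
      have : φ ≠ 1 := by
        intro hφ
        apply h0
        ext y
        have := DFunLike.congr_fun hφ y
        simp only [φ, AddChar.compAddMonoidHom_apply, AddChar.one_apply] at this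
        exact ZMod.injective_stdAddChar (this.trans (AddChar.map_zero_eq_one _).symm)
      exact AddChar.sum_eq_zero_of_ne_one this
  -- On the radical 2 Q(h) = B(h, h) = 0, and 2 is invertible modulo 3.
  have hQ : ∀ h, B h = 0 → Q h = 0 := by
    intro h h0
    have h2 : B h h = 2 • Q h := by
      simp only [B, QuadraticMap.polarBilin_apply_apply, QuadraticMap.polar_self]
    rw [h0, LinearMap.zero_apply] at h2
    revert h2
    generalize Q h = q
    revert q
    decide
  have key : Complex.normSq (∑ x, chi (Q x)) =
      Fintype.card W * Fintype.card (LinearMap.ker B) := by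
    have : ((Complex.normSq (∑ x, chi (Q x)) : ℝ) : ℂ) =
        ((Fintype.card W * Fintype.card (LinearMap.ker B) : ℝ) : ℂ) := by
      rw [Complex.normSq_eq_conj_mul_self, map_sum, Finset.sum_mul]
      simp_rw [Finset.mul_sum, ← AddChar.map_neg_eq_conj, ← AddChar.map_add_eq_mul]
      have e : ∀ y : W, ∑ x, chi (-Q y + Q x) = ∑ h, chi (Q h) * chi (B h y) := by
        intro y
        rw [← Equiv.sum_comp (Equiv.addLeft y)]
        refine Finset.sum_congr rfl fun h _ => ?_
        rw [← AddChar.map_add_eq_mul, ← hB, Equiv.coe_addLeft]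
        congr 1
        ring
      simp_rw [e]
      rw [Finset.sum_comm]
      simp_rw [← Finset.mul_sum, hsum]
      have e2 : ∀ h, chi (Q h) * (if B h = 0 then (Fintype.card W : ℂ) else 0) =
          if B h = 0 then (Fintype.card W : ℂ) else 0 := by
        intro h
        split_ifs with h0
        · rw [hQ h h0, AddChar.map_zero_eq_one, one_mul]
        · rw [mul_zero]
      simp_rw [e2]
      rw [← Finset.sum_filter, Finset.sum_const, nsmul_eq_mul, mul_comm]
      push_cast
      congr 2
      rw [Fintype.card_subtype]
      simp only [LinearMap.mem_ker]
    exact_mod_cast this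
  have : Fact (Nat.Prime 3) := ⟨Nat.prime_three⟩
  refine ⟨Module.finrank (ZMod 3) W + Module.finrank (ZMod 3) (LinearMap.ker B), ?_⟩
  rw [key, Module.card_eq_pow_finrank (K := ZMod 3) (V := W),
    Module.card_eq_pow_finrank (K := ZMod 3) (V := LinearMap.ker B), ZMod.card, zpow_add₀ (by norm_num)]
  push_cast
  simp

/-- Partial Gauss sums. -/
def IsGauss {M : Type} [AddCommGroup M] [Module (ZMod 3) M] (ψ : M → ℂ) : Prop :=
  ∃ (W : Type) (_ : AddCommGroup W) (_ : Module (ZMod 3) W) (_ : Fintype W)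
    (Q : QuadraticForm (ZMod 3) (W × M)) (c : ℂ), IsPowThree c ∧ ∀ s, ψ s = c * ∑ x, chi (Q (x, s))

namespace IsGauss

variable {M N : Type} [AddCommGroup M] [Module (ZMod 3) M] [AddCommGroup N] [Module (ZMod 3) N]
  {ψ : M → ℂ}

theorem one : IsGauss (fun _ : M => 1) :=
  ⟨PUnit, inferInstance, inferInstance, inferInstance, 0, 1, isPowThree_one, fun s => by simp⟩

theorem isPowThree_zero (h : IsGauss ψ) : IsPowThree (ψ 0) := by
  obtain ⟨W, _, _, _, Q, c, hc, h⟩ := h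
  rw [h]
  exact hc.mul (isPowThree_gaussSum (Q.comp (LinearMap.inl (ZMod 3) W M)))

theorem comp (h : IsGauss ψ) (f : N →ₗ[ZMod 3] M) : IsGauss fun s => ψ (f s) := by
  obtain ⟨W, _, _, _, Q, c, hc, h⟩ := h
  exact ⟨W, _, _, _, Q.comp (LinearMap.prodMap LinearMap.id f), c, hc, fun s => h _⟩

theorem const_mul (h : IsGauss ψ) {c : ℂ} (hc : IsPowThree c) : IsGauss fun s => c * ψ s := by
  obtain ⟨W, i1, i2, i3, Q, c', hc', h⟩ := h
  exact ⟨W, i1, i2, i3, Q, c * c', hc.mul hc', fun s => by simp only [h, mul_assoc]⟩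

theorem mul_chi (h : IsGauss ψ) (q : QuadraticForm (ZMod 3) M) :
    IsGauss fun s => chi (q s) * ψ s := by
  obtain ⟨W, i1, i2, i3, Q, c, hc, h⟩ := h
  refine ⟨W, i1, i2, i3, q.comp (LinearMap.snd (ZMod 3) W M) + Q, c, hc, fun s => ?_⟩
  simp only [h, mul_left_comm _ c, Finset.mul_sum]
  simp [AddChar.map_add_eq_mul]

/-- The summed coordinate becomes one more hidden variable of the quadratic form. -/
theorem sum {ψ : ZMod 3 × M → ℂ} (h : IsGauss ψ) : IsGauss fun s => ∑ x, ψ (x, s) := by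
  obtain ⟨W, _, _, _, Q, c, hc, h⟩ := h
  refine ⟨W × ZMod 3, inferInstance, inferInstance, inferInstance,
    Q.comp (LinearEquiv.prodAssoc (ZMod 3) W (ZMod 3) M).toLinearMap, c, hc, fun s => ?_⟩
  simp_rw [h]
  rw [← Finset.mul_sum, Fintype.sum_prod_type_right]
  rfl

end IsGauss

/-! ## The three-state Potts representation -/

/-- Colourings of the regions. -/
abbrev Colouring : Type := ℕ → ZMod 3

/-- The colour at position `k`. -/
def coord (k : ℕ) : Colouring →ₗ[ZMod 3] ZMod 3 where
  toFun t := t k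
  map_add' _ _ := rfl
  map_smul' _ _ := rfl

/-- Insertion of a colour at position `k`. -/
def insertAt (k : ℕ) : ZMod 3 × Colouring →ₗ[ZMod 3] Colouring where
  toFun p j := if j < k then p.2 j else if j = k then p.1 else p.2 (j - 1)
  map_add' p q := by
    funext j
    simp only [Pi.add_apply, Prod.fst_add, Prod.snd_add]
    split_ifs <;> rfl
  map_smul' c p := by
    funext j
    simp only [Pi.smul_apply, Prod.smul_fst, Prod.smul_snd, RingHom.id_apply]
    split_ifs <;> rfl

/-- Removal of the colour at position `k`. -/
def removeAt (k : ℕ) : Colouring →ₗ[ZMod 3] Colouring where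
  toFun t j := if j < k then t j else t (j + 1)
  map_add' p q := by
    funext j
    simp only [Pi.add_apply]
    split_ifs <;> rfl
  map_smul' c p := by
    funext j
    simp only [Pi.smul_apply, RingHom.id_apply]
    split_ifs <;> rfl

theorem insertAt_apply (k : ℕ) (x : ZMod 3) (t : Colouring) (j : ℕ) :
    insertAt k (x, t) j = if j < k then t j else if j = k then x else t (j - 1) := rfl

theorem removeAt_apply (k : ℕ) (t : Colouring) (j : ℕ) :
    removeAt k t j = if j < k then t j else t (j + 1) := rfl

theorem removeAt_insertAt (k : ℕ) (x : ZMod 3) (t : Colouring) :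
    removeAt k (insertAt k (x, t)) = t := by
  funext j; simp only [insertAt_apply, removeAt_apply]; grind

theorem removeAt_insertAt_of_le {p q : ℕ} (h : p ≤ q) (x : ZMod 3) (t : Colouring) :
    removeAt p (insertAt (q + 1) (x, t)) = insertAt q (x, removeAt p t) := by
  funext j; simp only [insertAt_apply, removeAt_apply]; grind

theorem removeAt_insertAt_of_ge {p q : ℕ} (h : p ≤ q) (x : ZMod 3) (t : Colouring) :
    removeAt (q + 1) (insertAt p (x, t)) = insertAt p (x, removeAt q t) := by
  funext j; simp only [insertAt_apply, removeAt_apply]; grind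

theorem insertAt_removeAt (k : ℕ) (t : Colouring) : insertAt k (t k, removeAt k t) = t := by
  funext j; simp only [insertAt_apply, removeAt_apply]; grind

theorem insertAt_of_eq (k : ℕ) (t : Colouring) :
    removeAt k (insertAt (k + 1) (t k, t)) = t := by
  funext j; simp only [insertAt_apply, removeAt_apply]; grind

theorem insertAt_succ_of_eq (k : ℕ) (t : Colouring) :
    insertAt (k + 1) (t k, t) = insertAt k (t k, t) := by
  funext j; simp only [insertAt_apply]; grind

/-- `√3`. -/
noncomputable abbrev rootThree : ℂ := (Real.sqrt 3 : ℂ)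

theorem rootThree_sq : rootThree * rootThree = 3 := by
  rw [← Complex.ofReal_mul, Real.mul_self_sqrt (by norm_num)]; norm_num

theorem rootThree_ne : rootThree ≠ 0 := fun h => by
  have := rootThree_sq
  rw [h] at this
  norm_num at this

/-- Birth of a region. -/
noncomputable def pottsCupEven (k : ℕ) : (Colouring → ℂ) →ₗ[ℂ] (Colouring → ℂ) where
  toFun ψ t := ψ (removeAt k t)
  map_add' _ _ := rfl
  map_smul' _ _ := rfl

/-- Death of a region. -/
noncomputable def pottsCapEven (k : ℕ) : (Colouring → ℂ) →ₗ[ℂ] (Colouring → ℂ) where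
  toFun ψ t := rootThree⁻¹ * ∑ x, ψ (insertAt k (x, t))
  map_add' ψ φ := by
    funext t
    simp only [Pi.add_apply, Finset.sum_add_distrib, mul_add]
  map_smul' c ψ := by
    funext t
    simp only [Pi.smul_apply, smul_eq_mul, ← Finset.mul_sum, RingHom.id_apply]
    ring

/-- Splitting of a region. -/
noncomputable def pottsCupOdd (k : ℕ) : (Colouring → ℂ) →ₗ[ℂ] (Colouring → ℂ) where
  toFun ψ t := rootThree * if t k = t (k + 1) then ψ (removeAt k t) else 0
  map_add' ψ φ := by
    funext t
    simp only [Pi.add_apply]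
    split_ifs <;> ring
  map_smul' c ψ := by
    funext t
    simp only [Pi.smul_apply, smul_eq_mul, RingHom.id_apply]
    split_ifs <;> ring

/-- Fusion of two regions. -/
noncomputable def pottsCapOdd (k : ℕ) : (Colouring → ℂ) →ₗ[ℂ] (Colouring → ℂ) where
  toFun ψ t := ψ (insertAt k (t k, t))
  map_add' _ _ := rfl
  map_smul' _ _ := rfl

/-- A family of operators given separately at even and odd positions. -/
noncomputable def byParity (f g : ℕ → (Colouring → ℂ) →ₗ[ℂ] (Colouring → ℂ)) (i : ℕ) :
    (Colouring → ℂ) →ₗ[ℂ] (Colouring → ℂ) :=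
  if i % 2 = 0 then f (i / 2) else g (i / 2)

theorem byParity_even (f g : ℕ → (Colouring → ℂ) →ₗ[ℂ] (Colouring → ℂ)) {i k : ℕ} (h : i = 2 * k) :
    byParity f g i = f k := by
  rw [byParity, if_pos (by omega), show i / 2 = k by omega]

theorem byParity_odd (f g : ℕ → (Colouring → ℂ) →ₗ[ℂ] (Colouring → ℂ)) {i k : ℕ}
    (h : i = 2 * k + 1) : byParity f g i = g k := by
  rw [byParity, if_neg (by omega), show i / 2 = k by omega]

theorem exists_parity (i : ℕ) : (∃ k, i = 2 * k) ∨ ∃ k, i = 2 * k + 1 := by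
  rcases Nat.even_or_odd i with ⟨k, h⟩ | ⟨k, h⟩
  · exact .inl ⟨k, by omega⟩
  · exact .inr ⟨k, h⟩

/-- The three-state Potts representation. -/
noncomputable def potts : TLRep ℂ (Colouring → ℂ) rootThree where
  -- Regions are shaded as on a chessboard and only the shaded ones carry colours, the `k`-th lying
  -- between the strands `2 k` and `2 k + 1`. Even cups and caps create and close shaded regions;
  -- odd ones split a shaded region in two or fuse two neighbours. The factors √3 make all loops
  -- have the same value. Colourings are infinite sequences, so the number of strands need not be
  -- tracked.
  cup := byParity pottsCupEven pottsCupOdd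
  cap := byParity pottsCapEven pottsCapOdd
  cap_cup i ψ := by
    rcases exists_parity i with ⟨k, h⟩ | ⟨k, h⟩
    · rw [byParity_even _ _ h, byParity_even _ _ h]
      funext t
      simp only [pottsCupEven, pottsCapEven, LinearMap.coe_mk, AddHom.coe_mk, removeAt_insertAt,
        Finset.sum_const, Finset.card_univ, ZMod.card, nsmul_eq_mul, Pi.smul_apply, smul_eq_mul]
      rw [← mul_assoc, Nat.cast_ofNat, ← rootThree_sq, ← mul_assoc, inv_mul_cancel₀ rootThree_ne,
        one_mul]
    · rw [byParity_odd _ _ h, byParity_odd _ _ h]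
      funext t
      simp only [pottsCupOdd, pottsCapOdd, LinearMap.coe_mk, AddHom.coe_mk, removeAt_insertAt,
        Pi.smul_apply, smul_eq_mul]
      rw [if_pos (by simp [insertAt_apply])]
  zig i ψ := by
    rcases exists_parity i with ⟨k, h⟩ | ⟨k, h⟩
    · rw [byParity_odd (i := i + 1) (k := k) _ _ (by omega), byParity_even _ _ h]
      funext t
      simp only [pottsCupEven, pottsCapOdd, LinearMap.coe_mk, AddHom.coe_mk, removeAt_insertAt]
    · rw [byParity_even (i := i + 1) (k := k + 1) _ _ (by omega), byParity_odd _ _ h]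
      funext t
      simp only [pottsCupOdd, pottsCapEven, LinearMap.coe_mk, AddHom.coe_mk]
      have e : ∀ x, insertAt (k + 1) (x, t) k = t k ∧ insertAt (k + 1) (x, t) (k + 1) = x :=
        fun x => by simp [insertAt_apply]
      simp only [e, ← Finset.mul_sum, Finset.sum_ite_eq, Finset.mem_univ, if_true, insertAt_of_eq]
      rw [← mul_assoc, inv_mul_cancel₀ rootThree_ne, one_mul]
  zag i ψ := by
    rcases exists_parity i with ⟨k, h⟩ | ⟨k, h⟩
    · rw [byParity_odd (i := i + 1) (k := k) _ _ (by omega), byParity_even _ _ h]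
      funext t
      simp only [pottsCupOdd, pottsCapEven, LinearMap.coe_mk, AddHom.coe_mk]
      have e : ∀ x, insertAt k (x, t) k = x ∧ insertAt k (x, t) (k + 1) = t k :=
        fun x => by simp [insertAt_apply]
      simp only [e, ← Finset.mul_sum, Finset.sum_ite_eq', Finset.mem_univ, if_true,
        removeAt_insertAt]
      rw [← mul_assoc, inv_mul_cancel₀ rootThree_ne, one_mul]
    · rw [byParity_even (i := i + 1) (k := k + 1) _ _ (by omega), byParity_odd _ _ h]
      funext t
      simp only [pottsCupEven, pottsCapOdd, LinearMap.coe_mk, AddHom.coe_mk]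
      rw [← insertAt_succ_of_eq, removeAt_insertAt]
  far_right i k ψ := by
    rcases exists_parity i with ⟨p, h⟩ | ⟨p, h⟩ <;>
      rcases exists_parity (i + k) with ⟨q, h'⟩ | ⟨q, h'⟩
    · rw [byParity_even (i := i + 2 + k) (k := q + 1) _ _ (by omega), byParity_even _ _ h,
        byParity_even _ _ h']
      funext t
      simp only [pottsCupEven, pottsCapEven, LinearMap.coe_mk, AddHom.coe_mk,
        removeAt_insertAt_of_le (show p ≤ q by omega)]
    · rw [byParity_odd (i := i + 2 + k) (k := q + 1) _ _ (by omega), byParity_even _ _ h,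
        byParity_odd _ _ h']
      funext t
      simp only [pottsCupEven, pottsCapOdd, LinearMap.coe_mk, AddHom.coe_mk,
        removeAt_insertAt_of_le (show p ≤ q by omega)]
      rw [removeAt_apply, if_neg (by omega)]
    · rw [byParity_even (i := i + 2 + k) (k := q + 1) _ _ (by omega), byParity_odd _ _ h,
        byParity_even _ _ h']
      funext t
      have e : ∀ x, insertAt (q + 1) (x, t) p = t p ∧ insertAt (q + 1) (x, t) (p + 1) = t (p + 1) :=
        fun x => by
          rw [insertAt_apply, insertAt_apply, if_pos (by omega), if_pos (by omega)]; exact ⟨rfl, rfl⟩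
      simp only [pottsCupOdd, pottsCapEven, LinearMap.coe_mk, AddHom.coe_mk,
        removeAt_insertAt_of_le (show p ≤ q by omega), e, ← Finset.mul_sum]
      split_ifs
      · ring
      · simp
    · rw [byParity_odd (i := i + 2 + k) (k := q + 1) _ _ (by omega), byParity_odd _ _ h,
        byParity_odd _ _ h']
      funext t
      have e : ∀ x, insertAt (q + 1) (x, t) p = t p := fun x => by
        rw [insertAt_apply, if_pos (by omega)]
      have e' : insertAt (q + 1) (t (q + 1), t) (p + 1) = t (p + 1) := by
        rw [insertAt_apply]
        split_ifs with c1 c2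
        · rfl
        · rw [c2]
        · omega
      have e'' : removeAt p t q = t (q + 1) := by rw [removeAt_apply, if_neg (by omega)]
      simp only [pottsCupOdd, pottsCapOdd, LinearMap.coe_mk, AddHom.coe_mk,
        removeAt_insertAt_of_le (show p ≤ q by omega), e, e', e'']
  far_left i k ψ := by
    rcases exists_parity i with ⟨p, h⟩ | ⟨p, h⟩ <;>
      rcases exists_parity (i + k) with ⟨q, h'⟩ | ⟨q, h'⟩
    · rw [byParity_even (i := i + 2 + k) (k := q + 1) _ _ (by omega), byParity_even _ _ h,
        byParity_even _ _ h']
      funext t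
      simp only [pottsCupEven, pottsCapEven, LinearMap.coe_mk, AddHom.coe_mk,
        removeAt_insertAt_of_ge (show p ≤ q by omega)]
    · rw [byParity_odd (i := i + 2 + k) (k := q + 1) _ _ (by omega), byParity_even _ _ h,
        byParity_odd _ _ h']
      funext t
      have e : ∀ x, insertAt p (x, t) (q + 1) = t q ∧ insertAt p (x, t) (q + 1 + 1) = t (q + 1) :=
        fun x => by
          rw [insertAt_apply, insertAt_apply, if_neg (by omega), if_neg (by omega),
            if_neg (by omega), if_neg (by omega)]; exact ⟨rfl, rfl⟩
      simp only [pottsCupOdd, pottsCapEven, LinearMap.coe_mk, AddHom.coe_mk,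
        removeAt_insertAt_of_ge (show p ≤ q by omega), e, ← Finset.mul_sum]
      split_ifs
      · ring
      · simp
    · rw [byParity_even (i := i + 2 + k) (k := q + 1) _ _ (by omega), byParity_odd _ _ h,
        byParity_even _ _ h']
      funext t
      simp only [pottsCupEven, pottsCapOdd, LinearMap.coe_mk, AddHom.coe_mk,
        removeAt_insertAt_of_ge (show p ≤ q by omega)]
      rw [removeAt_apply, if_pos (by omega)]
    · rw [byParity_odd (i := i + 2 + k) (k := q + 1) _ _ (by omega), byParity_odd _ _ h,
        byParity_odd _ _ h']
      funext t
      have e : insertAt p (t p, t) (q + 1) = t q := by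
        rw [insertAt_apply, if_neg (by omega), if_neg (by omega)]; rfl
      have e' : insertAt p (t p, t) (q + 1 + 1) = t (q + 1) := by
        rw [insertAt_apply, if_neg (by omega), if_neg (by omega)]; rfl
      simp only [pottsCupOdd, pottsCapOdd, LinearMap.coe_mk, AddHom.coe_mk,
        removeAt_insertAt_of_ge (show p ≤ q by omega), e, e']
      by_cases hq : t q = t (q + 1)
      · rw [if_pos hq, if_pos hq]
        congr 4
        rw [removeAt_apply]
        split_ifs with c
        · rfl
        · rw [show p = q by omega, hq]
      · rw [if_neg hq, if_neg hq]

/-! ## The bracket at a root of unity of order twenty-four -/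

/-- `exp(5πi/12)`, a value of `a` for which `a⁻⁴ = exp(iπ/3)`. -/
noncomputable def rootA : ℂˣ := Units.mk0 (Complex.exp (5 * Real.pi * Complex.I / 12))
  (Complex.exp_ne_zero _)

theorem rootA_zpow (k : ℤ) : ((rootA ^ k : ℂˣ) : ℂ) = Complex.exp (k * (5 * Real.pi * Complex.I / 12)) := by
  rw [Units.val_zpow_eq_zpow_val, rootA, Units.val_mk0, Complex.exp_int_mul]

theorem norm_rootA_zpow (k : ℤ) : ‖((rootA ^ k : ℂˣ) : ℂ)‖ = 1 := by
  rw [rootA_zpow, show (k : ℂ) * (5 * Real.pi * Complex.I / 12) =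
    ((k * (5 * Real.pi / 12) : ℝ) : ℂ) * Complex.I by push_cast; ring]
  exact Complex.norm_exp_ofReal_mul_I _

theorem rootA_zpow_neg_four : rootA ^ (-4 : ℤ) =
    Units.mk0 (Complex.exp (Real.pi * Complex.I / 3)) (Complex.exp_ne_zero _) := by
  apply Units.ext
  rw [rootA_zpow, Units.val_mk0, Complex.exp_eq_exp_iff_exists_int]
  exact ⟨-1, by push_cast; ring⟩

theorem exp_ofReal_mul_I_eq (θ : ℝ) {c s : ℝ} (hc : Real.cos θ = c) (hs : Real.sin θ = s) :
    Complex.exp (θ * Complex.I) = c + s * Complex.I := by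
  rw [Complex.exp_mul_I, ← Complex.ofReal_cos, ← Complex.ofReal_sin, hc, hs]

theorem cos_five_sixths : Real.cos (5 * Real.pi / 6) = -(Real.sqrt 3 / 2) := by
  rw [show 5 * Real.pi / 6 = Real.pi - Real.pi / 6 by ring, Real.cos_pi_sub, Real.cos_pi_div_six]

theorem sin_five_sixths : Real.sin (5 * Real.pi / 6) = 1 / 2 := by
  rw [show 5 * Real.pi / 6 = Real.pi - Real.pi / 6 by ring, Real.sin_pi_sub, Real.sin_pi_div_six]

theorem cos_two_thirds : Real.cos (2 * Real.pi / 3) = -(1 / 2) := by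
  rw [show 2 * Real.pi / 3 = Real.pi - Real.pi / 3 by ring, Real.cos_pi_sub, Real.cos_pi_div_three]

theorem sin_two_thirds : Real.sin (2 * Real.pi / 3) = Real.sqrt 3 / 2 := by
  rw [show 2 * Real.pi / 3 = Real.pi - Real.pi / 3 by ring, Real.sin_pi_sub, Real.sin_pi_div_three]

theorem rootA_sq : ((rootA ^ (2 : ℤ) : ℂˣ) : ℂ) = -(rootThree / 2) + 1 / 2 * Complex.I := by
  rw [rootA_zpow, show ((2 : ℤ) : ℂ) * (5 * Real.pi * Complex.I / 12) =
    ((5 * Real.pi / 6 : ℝ) : ℂ) * Complex.I by push_cast; ring,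
    exp_ofReal_mul_I_eq _ cos_five_sixths sin_five_sixths]
  push_cast; ring

theorem rootA_inv_sq : ((rootA ^ (-2 : ℤ) : ℂˣ) : ℂ) = -(rootThree / 2) - 1 / 2 * Complex.I := by
  rw [rootA_zpow, show ((-2 : ℤ) : ℂ) * (5 * Real.pi * Complex.I / 12) =
    ((-(5 * Real.pi / 6) : ℝ) : ℂ) * Complex.I by push_cast; ring,
    exp_ofReal_mul_I_eq _ ((Real.cos_neg _).trans cos_five_sixths)
      ((Real.sin_neg _).trans (congrArg _ sin_five_sixths))]
  push_cast; ring

theorem chi_one : chi 1 = -(1 / 2) + rootThree / 2 * Complex.I := by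
  have := ZMod.stdAddChar_coe (N := 3) 1
  rw [show ((1 : ℤ) : ZMod 3) = 1 by norm_num] at this
  rw [this, show 2 * (Real.pi : ℂ) * Complex.I * (1 : ℤ) / (3 : ℕ) =
    ((2 * Real.pi / 3 : ℝ) : ℂ) * Complex.I by push_cast; ring,
    exp_ofReal_mul_I_eq _ cos_two_thirds sin_two_thirds]
  push_cast; ring

theorem chi_neg_one : chi (-1) = -(1 / 2) - rootThree / 2 * Complex.I := by
  rw [AddChar.map_neg_eq_conj, chi_one]
  simp [Complex.conj_ofReal]
  rw [Complex.conj_ofNat]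
  ring

/-- This is why exp(5πi/12) is chosen as fourth root of exp(-iπ/3): the root exp(-πi/12) would give
the loop value -√3. -/
theorem ev_rootA_loopValue : ev rootA loopValue = rootThree := by
  rw [loopValue, map_sub, map_neg, eval₂_T, eval₂_T, rootA_sq, rootA_inv_sq]
  ring

/-- The identity that makes crossings Gaussian: up to a scalar, a crossing has weight 1 on unequal
colours and 1 + √3 a^{±2} on equal ones, and the latter is a cube root of unity. -/
theorem chi_eq_rootA (s : Bool) : chi (if s then 1 else -1) =
    1 + rootThree * ((rootA ^ (if s then 2 else -2 : ℤ) : ℂˣ) : ℂ) := by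
  have h := rootThree_sq
  rcases s with _ | _
  · simp only [if_false, Bool.false_eq_true]
    rw [chi_neg_one, rootA_inv_sq]
    linear_combination h / 2
  · simp only [if_true]
    rw [chi_one, rootA_sq]
    linear_combination h / 2

theorem zmod_three_sq {x y : ZMod 3} (h : x ≠ y) : (x - y) * (x - y) = 1 := by
  revert x y; decide

namespace IsGauss

variable {ψ : Colouring → ℂ}

theorem pottsCupEven (h : IsGauss ψ) (k : ℕ) : IsGauss (pottsCupEven k ψ) := h.comp _

theorem pottsCapOdd (h : IsGauss ψ) (k : ℕ) : IsGauss (pottsCapOdd k ψ) :=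
  h.comp ((insertAt k).comp ((coord k).prod LinearMap.id))

theorem pottsCapEven (h : IsGauss ψ) (k : ℕ) : IsGauss (pottsCapEven k ψ) :=
  (h.comp (insertAt k)).sum.const_mul isPowThree_sqrt.inv

/-- The difference of two coordinates. -/
def coordSub (k : ℕ) : Colouring →ₗ[ZMod 3] ZMod 3 := coord k - coord (k + 1)

theorem _root_.KnotGraphs.sum_chi_mul (y : ZMod 3) : ∑ x, chi (x * y) = if y = 0 then 3 else 0 := by
  split_ifs with h
  · simp [h]
  · exact AddChar.sum_eq_zero_of_ne_one (ψ := chi.compAddMonoidHom (AddMonoidHom.mulRight y))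
      fun hc => h <| by
        have := DFunLike.congr_fun hc 1
        simp only [AddChar.compAddMonoidHom_apply, AddMonoidHom.coe_mulRight, one_mul,
          AddChar.one_apply] at this
        exact ZMod.injective_stdAddChar (this.trans (AddChar.map_zero_eq_one _).symm)

/-- The condition that two colours agree is a character sum over one new variable x, with exponent x
times the difference of the colours, which is a quadratic form. -/
theorem pottsCupOdd (h : IsGauss ψ) (k : ℕ) : IsGauss (pottsCupOdd k ψ) := by
  have h1 := ((h.comp ((removeAt k).comp (LinearMap.snd (ZMod 3) (ZMod 3) Colouring))).mul_chi
    (QuadraticMap.linMulLin (LinearMap.fst (ZMod 3) (ZMod 3) Colouring)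
      ((coordSub k).comp (LinearMap.snd (ZMod 3) (ZMod 3) Colouring)))).sum.const_mul
        (isPowThree_sqrt.mul isPowThree_three.inv)
  convert h1 using 1
  funext t
  simp only [KnotGraphs.pottsCupOdd, LinearMap.coe_mk, AddHom.coe_mk, QuadraticMap.linMulLin_apply,
    LinearMap.fst_apply, LinearMap.comp_apply, LinearMap.snd_apply, ← Finset.sum_mul, sum_chi_mul]
  have : coordSub k t = 0 ↔ t k = t (k + 1) := by
    rw [coordSub, LinearMap.sub_apply]; exact sub_eq_zero
  simp only [this]
  split_ifs
  · ring
  · ring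

theorem potts_cup (h : IsGauss ψ) (i : ℕ) : IsGauss (potts.cup i ψ) := by
  change IsGauss (byParity _ _ i ψ)
  rw [byParity]
  split_ifs
  · exact h.pottsCupEven _
  · exact h.pottsCupOdd _

theorem potts_cap (h : IsGauss ψ) (i : ℕ) : IsGauss (potts.cap i ψ) := by
  change IsGauss (byParity _ _ i ψ)
  rw [byParity]
  split_ifs
  · exact h.pottsCapEven _
  · exact h.pottsCapOdd _

/-- A nonzero square modulo 3 equals 1, so a weight that depends only on whether two colours agree,
with ratio a cube root of unity, is a scalar times χ of plus or minus the squared difference. At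
even positions the old colour `x` of the region is compared with the new one and summed over; at odd
positions two neighbouring regions are compared. -/
theorem potts_cross (h : IsGauss ψ) (s : Bool) (i : ℕ) :
    IsGauss (((rootA ^ (if s then 1 else -1 : ℤ) : ℂˣ) : ℂ) • ψ +
      ((rootA ^ (if s then -1 else 1 : ℤ) : ℂˣ) : ℂ) • potts.cup i (potts.cap i ψ)) := by
  have hx : ∀ k : ℤ, IsPowThree ((rootA ^ k : ℂˣ) : ℂ) := fun k => isPowThree_of_norm (norm_rootA_zpow k)
  rcases exists_parity i with ⟨k, hk⟩ | ⟨k, hk⟩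
  · let q : QuadraticForm (ZMod 3) (ZMod 3 × Colouring) :=
      QuadraticMap.linMulLin
        (LinearMap.fst (ZMod 3) _ _ - (coord k).comp (LinearMap.snd (ZMod 3) _ _))
        (LinearMap.fst (ZMod 3) _ _ - (coord k).comp (LinearMap.snd (ZMod 3) _ _))
    have hq : ∀ x t, q (x, t) = (x - t k) * (x - t k) := fun x t => rfl
    have h1 := ((h.comp ((insertAt k).comp (LinearMap.prodMap LinearMap.id (removeAt k)))).mul_chi
      (if s then -q else q)).sum.const_mul (((hx (if s then -1 else 1)).mul isPowThree_sqrt.inv).mul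
        (isPowThree_chi (if s then 1 else -1)))
    convert h1 using 1
    funext t
    have hc : ∀ x, chi (if s then 1 else -1) * (chi ((if s then -q else q) (x, t)) *
        ψ (insertAt k (x, removeAt k t))) = ψ (insertAt k (x, removeAt k t)) +
          if x = t k then rootThree * ((rootA ^ (if s then 2 else -2 : ℤ) : ℂˣ) : ℂ) * ψ t
            else 0 := by
      intro x
      by_cases hxt : x = t k
      · have : (if s then -q else q) (x, t) = 0 := by
          have := hq x t
          rw [hxt, sub_self, mul_zero] at this
          rw [hxt]
          split_ifs
          · rw [neg_apply, this, neg_zero]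
          · exact this
        rw [this, AddChar.map_zero_eq_one, if_pos hxt, chi_eq_rootA, hxt, insertAt_removeAt]
        ring
      · have : (if s then -q else q) (x, t) = -(if s then 1 else -1) := by
          have := hq x t
          rw [zmod_three_sq hxt] at this
          split_ifs
          · rw [neg_apply, this]
          · rw [this, neg_neg]
        rw [this, if_neg hxt, ← mul_assoc, ← AddChar.map_add_eq_mul, add_neg_cancel,
          AddChar.map_zero_eq_one]
        ring
    have e1 : potts.cup i (potts.cap i ψ) t =
        rootThree⁻¹ * ∑ x, ψ (insertAt k (x, removeAt k t)) := by
      change byParity _ _ i (byParity _ _ i ψ) t = _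
      rw [byParity_even _ _ hk, byParity_even _ _ hk]
      rfl
    have e2 : ((rootA ^ (if s then -1 else 1 : ℤ) : ℂˣ) : ℂ) *
        ((rootA ^ (if s then 2 else -2 : ℤ) : ℂˣ) : ℂ) =
        ((rootA ^ (if s then 1 else -1 : ℤ) : ℂˣ) : ℂ) := by
      rw [← Units.val_mul, ← zpow_add]
      split_ifs <;> norm_num
    have hsum := (Finset.mul_sum Finset.univ (fun x => chi ((if s then -q else q) (x, t)) *
      ψ (insertAt k (x, removeAt k t))) (chi (if s then 1 else -1))).trans
        (Finset.sum_congr rfl fun x _ => hc x)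
    rw [Pi.add_apply, Pi.smul_apply, Pi.smul_apply, e1, mul_assoc, smul_eq_mul, smul_eq_mul]
    refine Eq.trans ?_ (congrArg _ hsum.symm)
    rw [Finset.sum_add_distrib, Finset.sum_ite_eq' Finset.univ (t k), if_pos (Finset.mem_univ _)]
    have := inv_mul_cancel₀ rootThree_ne
    linear_combination (-(ψ t) * ((rootA ^ (if s then 1 else -1 : ℤ) : ℂˣ) : ℂ)) * this -
      rootThree⁻¹ * rootThree * ψ t * e2
  · let q : QuadraticForm (ZMod 3) Colouring := QuadraticMap.linMulLin (coordSub k) (coordSub k)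
    have hq : ∀ t, q t = (t k - t (k + 1)) * (t k - t (k + 1)) := fun t => rfl
    have h1 := (h.mul_chi (if s then q else -q)).const_mul ((hx (if s then 1 else -1)).mul
        (isPowThree_chi (if !s then 1 else -1)))
    convert h1 using 1
    funext t
    have hneg : (if !s then 1 else -1 : ZMod 3) = -(if s then 1 else -1) := by
      cases s <;> simp
    have hhook : potts.cup i (potts.cap i ψ) t =
        rootThree * if t k = t (k + 1) then ψ t else 0 := by
      change byParity _ _ i (byParity _ _ i ψ) t = _
      rw [byParity_odd _ _ hk, byParity_odd _ _ hk]
      simp only [KnotGraphs.pottsCupOdd, KnotGraphs.pottsCapOdd, LinearMap.coe_mk, AddHom.coe_mk]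
      congr 1
      split_ifs with c
      · rw [removeAt_apply, if_neg (lt_irrefl _), ← c, insertAt_removeAt]
      · rfl
    rw [Pi.add_apply, Pi.smul_apply, Pi.smul_apply, hhook, smul_eq_mul, smul_eq_mul]
    by_cases hxt : t k = t (k + 1)
    · have : (if s then q else -q) t = 0 := by
        have := hq t
        rw [hxt, sub_self, mul_zero] at this
        split_ifs
        · exact this
        · rw [neg_apply, this, neg_zero]
      have e2 : ((rootA ^ (if s then 1 else -1 : ℤ) : ℂˣ) : ℂ) *
          ((rootA ^ (if !s then 2 else -2 : ℤ) : ℂˣ) : ℂ) =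
          ((rootA ^ (if s then -1 else 1 : ℤ) : ℂˣ) : ℂ) := by
        rw [← Units.val_mul, ← zpow_add]
        cases s <;> norm_num
      rw [if_pos hxt, this, AddChar.map_zero_eq_one, chi_eq_rootA]
      linear_combination (-rootThree * ψ t) * e2
    · have : (if s then q else -q) t = (if s then 1 else -1) := by
        have := hq t
        rw [zmod_three_sq hxt] at this
        split_ifs
        · exact this
        · rw [neg_apply, this]
      rw [if_neg hxt, this, hneg, mul_assoc, ← mul_assoc (chi _), ← AddChar.map_add_eq_mul,
        neg_add_cancel, AddChar.map_zero_eq_one]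
      ring

theorem potts_act (h : IsGauss ψ) (w : List Slice) : IsGauss (potts.act rootA w ψ) := by
  induction w generalizing ψ with
  | nil => exact h
  | cons x w ih =>
    obtain ⟨x, i⟩ := x
    rcases x with b | _ | s
    · exact ih (h.potts_cup i)
    · exact ih (h.potts_cap i)
    · exact ih (h.potts_cross s i)

end IsGauss

/-- The state sum of a closed word has norm square a power of three. -/
theorem isPowThree_loopBracket {w : List Slice} (hw : Fits w 0 0) :
    IsPowThree (ev rootA (loopBracket w id)) := by
  have h : potts.State (fun _ => 1) 0 id (fun _ => 1) := .vacuum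
  have h1 := (IsGauss.one (M := Colouring)).potts_act w
  rw [h.act_eq ev_rootA_loopValue hw] at h1
  simpa using h1.isPowThree_zero

/-! ## The invariant `β` -/

/-- The exponent of three in the norm of the state sum at `rootA`. -/
def HasExponent (w : List Slice) (j : ℤ) : Prop :=
  Complex.normSq (ev rootA (loopBracket w id)) = 3 ^ j

theorem HasExponent.unique {w : List Slice} {j j' : ℤ} (h : HasExponent w j)
    (h' : HasExponent w j') : j = j' :=
  zpow_right_injective₀ (by norm_num) (by norm_num) (h.symm.trans h')

theorem exists_hasExponent {w : List Slice} (hw : Fits w 0 0) : ∃ j, HasExponent w j :=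
  isPowThree_loopBracket hw

/-! ### Integrality of the exponent -/

/-- The embedding of the Eisenstein integers. -/
noncomputable def eisensteinHom : Eisenstein →+* ℂ where
  toFun z := z.re + z.im * chi 1
  map_one' := by simp [QuadraticAlgebra.re_one, QuadraticAlgebra.im_one]
  map_zero' := by simp
  map_add' x y := by simp; ring
  map_mul' x y := by
    simp only [QuadraticAlgebra.re_mul, QuadraticAlgebra.im_mul]
    have h : chi 1 * chi 1 = -1 - chi 1 := by
      rw [chi_one]
      have h := rootThree_sq
      linear_combination (Complex.I * Complex.I / 4) * h + 3 / 4 * Complex.I_mul_I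
    push_cast
    linear_combination (-(x.im : ℂ) * y.im) * h

theorem normSq_eisensteinHom (z : Eisenstein) :
    Complex.normSq (eisensteinHom z) = ((z.re ^ 2 - z.re * z.im + z.im ^ 2 : ℤ) : ℝ) := by
  change Complex.normSq (z.re + z.im * chi 1) = _
  rw [chi_one, Complex.normSq_apply]
  have : Real.sqrt 3 * Real.sqrt 3 = 3 := Real.mul_self_sqrt (by norm_num)
  simp
  linear_combination ((z.im : ℝ) ^ 2 / 4) * this

/-- The primitive sixth root of unity. -/
def sixthRoot : Eisensteinˣ := -cubeRoot ^ 2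

theorem map_sixthRoot : Units.map (eisensteinHom : Eisenstein →* ℂ) sixthRoot =
    rootA ^ (-4 : ℤ) := by
  apply Units.ext
  have : ((rootA ^ (-4 : ℤ) : ℂˣ) : ℂ) = ((rootA ^ (-2 : ℤ) : ℂˣ) : ℂ) * ((rootA ^ (-2 : ℤ) : ℂˣ) : ℂ) := by
    rw [← Units.val_mul, ← zpow_add]; norm_num
  rw [this, rootA_inv_sq]
  change eisensteinHom ((sixthRoot : Eisensteinˣ) : Eisenstein) = _
  rw [show ((sixthRoot : Eisensteinˣ) : Eisenstein) = ⟨1, 1⟩ by decide]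
  change (((1 : ℤ) : ℂ) + ((1 : ℤ) : ℂ) * chi 1) = _
  rw [chi_one]
  have h := rootThree_sq
  push_cast
  linear_combination (-1 / 4) * h - 1 / 4 * Complex.I_mul_I

/-- The factor 3 is the norm square of the loop value, by which the full state sum exceeds the
normalized bracket; writhe factors have norm 1. The second claim holds because exp(iπ/3) = 1 + ω and
norms of Eisenstein integers are integers. -/
theorem KnotDiagram.tri_eq (D : KnotDiagram) :
    D.knot.tri = Complex.normSq (ev rootA (loopBracket D.word id)) ∧
      ∃ N : ℤ, D.knot.tri = 3 * N := by
  have h1 : D.knot.tri = 3 * Complex.normSq (ev (rootA ^ (-4 : ℤ)) D.knot.jones) := by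
    rw [Knot.tri, rootA_zpow_neg_four, norm_pow, ← Complex.normSq_eq_norm_sq]
  constructor
  · rw [h1, D.ev_jones, X, map_mul, ← D.ev_bracket, map_mul, map_mul, ev_rootA_loopValue,
      ev_writheFactor, map_mul, Complex.normSq_ofReal, Real.mul_self_sqrt (by norm_num),
      Complex.normSq_eq_norm_sq ((rootA ^ _ : ℂˣ) : ℂ), norm_rootA_zpow]
    rcases Int.units_eq_one_or ((-1) ^ D.writhe) with h | h <;> rw [h] <;> simp
  · rw [h1, ← map_sixthRoot, ← map_ev, normSq_eisensteinHom]
    exact ⟨_, rfl⟩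

/-- A power of 3 that is three times an integer, hence at least 3, has an exponent at least 1. -/
theorem KnotDiagram.exists_beta (D : KnotDiagram) :
    ∃ j : ℕ, 1 ≤ j ∧ HasExponent D.word j ∧ D.knot.beta = j := by
  obtain ⟨h1, N, hN⟩ := D.tri_eq
  obtain ⟨j, hj⟩ := exists_hasExponent D.fits
  have h2 : D.knot.tri = 3 ^ j := h1.trans hj
  have hpos : (0 : ℝ) < 3 * N := by rw [← hN, h2]; positivity
  have hN1 : (1 : ℝ) ≤ N := by
    have : 0 < N := by
      have : (0 : ℝ) < N := by linarith
      exact_mod_cast this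
    exact_mod_cast this
  have hj1 : 1 ≤ j := by
    by_contra hc
    have : (3 : ℝ) ^ j ≤ 3 ^ (0 : ℤ) := zpow_le_zpow_right₀ (by norm_num) (by omega)
    rw [← h2, hN, zpow_zero] at this
    linarith
  obtain ⟨k, rfl⟩ : ∃ k : ℕ, j = k := ⟨j.toNat, by omega⟩
  refine ⟨k, by omega, hj, ?_⟩
  rw [Knot.beta, h2, zpow_natCast, Real.logb_pow, Real.logb_self_eq_one (by norm_num), mul_one]

theorem beta_eq_of_hasExponent {D : KnotDiagram} {j : ℤ} (h : HasExponent D.word j) :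
    D.knot.beta = j := by
  obtain ⟨k, -, h1, h2⟩ := D.exists_beta
  rw [h2, h.unique h1]
  rfl

theorem hasExponent_shapeOf {w : List Slice} {j : ℤ} :
    HasExponent (shapeOf w) j ↔ HasExponent w j := by
  rw [HasExponent, HasExponent, loopBracket_shapeOf]

/-! ### The four tangle values and local moves -/

/-- Norm squares of the four tangle values satisfy a quadratic relation. -/
theorem normSq_relation (x y : ℂ) :
    let A := Complex.normSq x
    let B := Complex.normSq y
    let C := Complex.normSq (((rootA ^ (1 : ℤ) : ℂˣ) : ℂ) * x + ((rootA ^ (-1 : ℤ) : ℂˣ) : ℂ) * y)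
    let D := Complex.normSq (((rootA ^ (-1 : ℤ) : ℂˣ) : ℂ) * x + ((rootA ^ (1 : ℤ) : ℂˣ) : ℂ) * y)
    A ^ 2 + B ^ 2 + C ^ 2 + D ^ 2 = A * B + A * C + A * D + B * C + B * D + C * D := by
  intro A B C D
  have hu : ∀ k : ℤ, Complex.normSq ((rootA ^ k : ℂˣ) : ℂ) = 1 := fun k => by
    rw [Complex.normSq_eq_norm_sq, norm_rootA_zpow, one_pow]
  have h3 : Real.sqrt 3 * Real.sqrt 3 = 3 := Real.mul_self_sqrt (by norm_num)
  have hC : C = Complex.normSq (((rootA ^ (2 : ℤ) : ℂˣ) : ℂ) * x + y) := by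
    have e : ((rootA ^ (1 : ℤ) : ℂˣ) : ℂ) * x + ((rootA ^ (-1 : ℤ) : ℂˣ) : ℂ) * y =
        ((rootA ^ (-1 : ℤ) : ℂˣ) : ℂ) * (((rootA ^ (2 : ℤ) : ℂˣ) : ℂ) * x + y) := by
      rw [mul_add, ← mul_assoc, ← Units.val_mul, ← zpow_add]; norm_num
    simp only [C, e, map_mul, hu, one_mul]
  have hD : D = Complex.normSq (((rootA ^ (-2 : ℤ) : ℂˣ) : ℂ) * x + y) := by
    have e : ((rootA ^ (-1 : ℤ) : ℂˣ) : ℂ) * x + ((rootA ^ (1 : ℤ) : ℂˣ) : ℂ) * y =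
        ((rootA ^ (1 : ℤ) : ℂˣ) : ℂ) * (((rootA ^ (-2 : ℤ) : ℂˣ) : ℂ) * x + y) := by
      rw [mul_add, ← mul_assoc, ← Units.val_mul, ← zpow_add]; norm_num
    simp only [D, e, map_mul, hu, one_mul]
  rw [rootA_sq] at hC
  rw [rootA_inv_sq] at hD
  have hA : A = x.re * x.re + x.im * x.im := Complex.normSq_apply x
  have hB : B = y.re * y.re + y.im * y.im := Complex.normSq_apply y
  have hC' : C = A + B + (-Real.sqrt 3 * (x.re * y.re + x.im * y.im) -
      (x.im * y.re - x.re * y.im)) := by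
    rw [hC, hA, hB, Complex.normSq_apply]
    simp
    linear_combination (x.re * x.re + x.im * x.im) / 4 * h3
  have hD' : D = A + B + (-Real.sqrt 3 * (x.re * y.re + x.im * y.im) +
      (x.im * y.re - x.re * y.im)) := by
    rw [hD, hA, hB, Complex.normSq_apply]
    simp
    linear_combination (x.re * x.re + x.im * x.im) / 4 * h3
  -- Here p and q denote the real and imaginary part of x times the conjugate of y. With C and D
  -- equal to A + B - √3 p ∓ q, the claim is an identity modulo AB = p² + q² and (√3)² = 3.
  have hAB : A * B = (x.re * y.re + x.im * y.im) ^ 2 + (x.im * y.re - x.re * y.im) ^ 2 := by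
    rw [hA, hB]; ring
  generalize x.re * y.re + x.im * y.im = p at *
  generalize x.im * y.re - x.re * y.im = q at *
  rw [hC', hD']
  linear_combination (-3) * hAB + p ^ 2 * h3

/-- If k ≥ 1 of the exponents vanish, reduction modulo 3 gives k ≡ k(k-1)/2, so k = 3. The remaining
power t then satisfies t² = 3t. -/
theorem pow_three_relation {a b c d : ℕ} (h0 : a = 0 ∨ b = 0 ∨ c = 0 ∨ d = 0)
    (h : (3 ^ a) ^ 2 + (3 ^ b) ^ 2 + (3 ^ c) ^ 2 + (3 ^ d) ^ 2 =
      3 ^ a * 3 ^ b + 3 ^ a * 3 ^ c + 3 ^ a * 3 ^ d + 3 ^ b * 3 ^ c + 3 ^ b * 3 ^ d + 3 ^ c * 3 ^ d) :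
    a ≤ 1 ∧ b ≤ 1 ∧ c ≤ 1 ∧ d ≤ 1 := by
  have key : ∀ n : ℕ, (n = 0 ∧ ((3 ^ n : ℕ) : ZMod 3) = 1) ∨ (n ≠ 0 ∧ ((3 ^ n : ℕ) : ZMod 3) = 0) := by
    intro n
    rcases n with _ | n
    · left; simp
    · right
      refine ⟨by omega, ?_⟩
      rw [pow_succ, Nat.cast_mul]
      exact mul_eq_zero_of_right _ (by decide)
  have single : ∀ n : ℕ, 1 + 1 + 1 + (3 ^ n) ^ 2 = 1 + 1 + 1 + 3 ^ n + 3 ^ n + 3 ^ n → n ≤ 1 := by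
    intro n hn
    by_contra hc
    have h1 : 3 ^ 2 ≤ 3 ^ n := Nat.pow_le_pow_right (by norm_num) (by omega)
    nlinarith
  have hz := congrArg (Nat.cast (R := ZMod 3)) h
  simp only [Nat.cast_add, Nat.cast_mul, Nat.cast_pow (3 ^ _) 2] at hz
  rcases key a with ⟨ha, ha'⟩ | ⟨ha, ha'⟩ <;> rcases key b with ⟨hb, hb'⟩ | ⟨hb, hb'⟩ <;>
    rcases key c with ⟨hc, hc'⟩ | ⟨hc, hc'⟩ <;> rcases key d with ⟨hd, hd'⟩ | ⟨hd, hd'⟩ <;>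
    rw [ha', hb', hc', hd'] at hz <;> first
      | (exfalso; revert hz; decide)
      | omega
      | skip
  · subst ha hb hc
    have := single d (by simp only [pow_zero, one_pow, one_mul, mul_one] at h; linarith)
    omega
  · subst ha hb hd
    have := single c (by simp only [pow_zero, one_pow, one_mul, mul_one] at h; linarith)
    omega
  · subst ha hc hd
    have := single b (by simp only [pow_zero, one_pow, one_mul, mul_one] at h; linarith)
    omega
  · subst hb hc hd
    have := single a (by simp only [pow_zero, one_pow, one_mul, mul_one] at h; linarith)
    omega

theorem zpow_three_relation {a b c d : ℤ}
    (h : ((3 : ℝ) ^ a) ^ 2 + (3 ^ b) ^ 2 + (3 ^ c) ^ 2 + (3 ^ d) ^ 2 =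
      3 ^ a * 3 ^ b + 3 ^ a * 3 ^ c + 3 ^ a * 3 ^ d + 3 ^ b * 3 ^ c + 3 ^ b * 3 ^ d + 3 ^ c * 3 ^ d) :
    ∃ μ, ∀ x ∈ [a, b, c, d], μ ≤ x ∧ x ≤ μ + 1 := by
  let μ := min (min a b) (min c d)
  obtain ⟨a', ha⟩ : ∃ n : ℕ, a = μ + n := ⟨(a - μ).toNat, by omega⟩
  obtain ⟨b', hb⟩ : ∃ n : ℕ, b = μ + n := ⟨(b - μ).toNat, by omega⟩
  obtain ⟨c', hc⟩ : ∃ n : ℕ, c = μ + n := ⟨(c - μ).toNat, by omega⟩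
  obtain ⟨d', hd⟩ : ∃ n : ℕ, d = μ + n := ⟨(d - μ).toNat, by omega⟩
  have h0 : a' = 0 ∨ b' = 0 ∨ c' = 0 ∨ d' = 0 := by omega
  have hμ : (3 : ℝ) ^ μ ≠ 0 := by positivity
  rw [ha, hb, hc, hd] at h
  simp only [zpow_add₀ (show (3 : ℝ) ≠ 0 by norm_num), zpow_natCast] at h
  have h' := pow_three_relation h0 (by
    have : ((3 : ℝ) ^ a') ^ 2 + (3 ^ b') ^ 2 + (3 ^ c') ^ 2 + (3 ^ d') ^ 2 =
        3 ^ a' * 3 ^ b' + 3 ^ a' * 3 ^ c' + 3 ^ a' * 3 ^ d' + 3 ^ b' * 3 ^ c' + 3 ^ b' * 3 ^ d' +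
          3 ^ c' * 3 ^ d' := by
      apply mul_left_cancel₀ (pow_ne_zero 2 hμ)
      linear_combination h
    exact_mod_cast this)
  refine ⟨μ, fun x hx => ?_⟩
  simp only [List.mem_cons, List.not_mem_nil, or_false] at hx
  omega

theorem fits_cross (s : Bool) {i n : ℕ} (h : i + 2 ≤ n) : Fits [(.cross s, i)] n n :=
  ⟨h, show n - 2 + 2 = n by omega⟩

theorem fits_hook {i n : ℕ} (h : i + 2 ≤ n) : Fits [(.cap, i), (.cup true, i)] n n :=
  ⟨h, show i ≤ n - 2 by omega, show n - 2 + 2 = n by omega⟩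

/-- The exponents of the four tangles in a common context differ by at most one. -/
theorem exists_exponents {u v : List Slice} {i n : ℕ} (hu : Fits u 0 n) (hv : Fits v n 0)
    (hi : i + 2 ≤ n) :
    ∃ μ, (∃ j, HasExponent (u ++ v) j ∧ μ ≤ j ∧ j ≤ μ + 1) ∧
      (∃ j, HasExponent (u ++ [(.cap, i), (.cup true, i)] ++ v) j ∧ μ ≤ j ∧ j ≤ μ + 1) ∧
      ∀ s, ∃ j, HasExponent (u ++ [(.cross s, i)] ++ v) j ∧ μ ≤ j ∧ j ≤ μ + 1 := by
  have f1 : Fits (u ++ v) 0 0 := hu.append hv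
  have f2 : Fits (u ++ [(.cap, i), (.cup true, i)] ++ v) 0 0 :=
    (hu.append (fits_hook hi)).append hv
  have f3 : ∀ s, Fits (u ++ [(.cross s, i)] ++ v) 0 0 := fun s =>
    (hu.append (fits_cross s hi)).append hv
  obtain ⟨a, ha⟩ := exists_hasExponent f1
  obtain ⟨b, hb⟩ := exists_hasExponent f2
  obtain ⟨c, hc⟩ := exists_hasExponent (f3 true)
  obtain ⟨d, hd⟩ := exists_hasExponent (f3 false)
  have key : ∀ s, ev rootA (loopBracket (u ++ [(.cross s, i)] ++ v) id) =
      ((rootA ^ (if s then 1 else -1 : ℤ) : ℂˣ) : ℂ) * ev rootA (loopBracket (u ++ v) id) +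
      ((rootA ^ (if s then -1 else 1 : ℤ) : ℂˣ) : ℂ) *
        ev rootA (loopBracket (u ++ [(.cap, i), (.cup true, i)] ++ v) id) := by
    intro s
    have := loopBracket_cross (v := v) (s := s) (i := i) hu pairing_id
    rw [List.append_assoc, List.singleton_append, this, map_add, map_mul, map_mul, eval₂_T, eval₂_T,
      List.append_assoc]
    rfl
  have h := normSq_relation (ev rootA (loopBracket (u ++ v) id))
    (ev rootA (loopBracket (u ++ [(.cap, i), (.cup true, i)] ++ v) id))
  have kt := key true
  have kf := key false
  simp only [if_true, if_false, Bool.false_eq_true] at kt kf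
  simp only [← kt, ← kf] at h
  rw [ha, hb, hc, hd] at h
  obtain ⟨μ, hμ⟩ := zpow_three_relation h
  simp only [List.mem_cons, List.not_mem_nil, or_false, forall_eq_or_imp, forall_eq] at hμ
  refine ⟨μ, ⟨a, ha, hμ.1⟩, ⟨b, hb, hμ.2.1⟩, ?_⟩
  rintro (_ | _)
  · exact ⟨d, hd, hμ.2.2.2⟩
  · exact ⟨c, hc, hμ.2.2.1⟩

theorem abs_beta_sub_le_of_crossingChange {D D' : KnotDiagram} (h : D.CrossingChange D') :
    |D.knot.beta - D'.knot.beta| ≤ 1 := by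
  obtain ⟨u, v, s, i, e1, e2⟩ := h
  have hf := D.fits
  rw [e1, List.append_assoc] at hf
  obtain ⟨n, hu, hi, hv⟩ := hf.split
  simp only [Tile.inp] at hi
  change Fits v (n - 2 + 2) 0 at hv
  rw [show n - 2 + 2 = n by omega] at hv
  obtain ⟨μ, -, -, hs⟩ := exists_exponents hu hv hi
  obtain ⟨j, hj, h1, h2⟩ := hs s
  obtain ⟨j', hj', h1', h2'⟩ := hs (!s)
  rw [← e1] at hj
  rw [← e2] at hj'
  rw [beta_eq_of_hasExponent hj, beta_eq_of_hasExponent hj', ← Int.cast_sub, ← Int.cast_abs]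
  have : |j - j'| ≤ 1 := by rw [abs_le]; omega
  exact_mod_cast this

theorem abs_beta_sub_le_of_banding {D D' : KnotDiagram} (h : D.Banding D') :
    |D.knot.beta - D'.knot.beta| ≤ 1 := by
  obtain ⟨u, l, l', v, hl, e1, e2⟩ := h
  have key : ∀ j j' μ : ℤ, HasExponent (u ++ l ++ v) j → HasExponent (u ++ l' ++ v) j' →
      μ ≤ j ∧ j ≤ μ + 1 → μ ≤ j' ∧ j' ≤ μ + 1 → |D.knot.beta - D'.knot.beta| ≤ 1 := by
    intro j j' μ hj hj' h1 h2
    rw [← e1] at hj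
    rw [← e2] at hj'
    rw [beta_eq_of_hasExponent (hasExponent_shapeOf.1 hj),
      beta_eq_of_hasExponent (hasExponent_shapeOf.1 hj'), ← Int.cast_sub, ← Int.cast_abs]
    have : |j - j'| ≤ 1 := by rw [abs_le]; omega
    exact_mod_cast this
  have hf : Fits (u ++ l ++ v) 0 0 := by rw [← e1]; exact fits_shapeOf.2 D.fits
  have hf' : Fits (u ++ l' ++ v) 0 0 := by rw [← e2]; exact fits_shapeOf.2 D'.fits
  rw [List.append_assoc] at hf hf'
  have fit : ∀ {s : Bool} {i : ℕ}, Fits (u ++ ([(.cross s, i)] ++ v)) 0 0 →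
      ∃ n, Fits u 0 n ∧ Fits v n 0 ∧ i + 2 ≤ n := by
    intro s i hf
    obtain ⟨n, hu, hi, hv⟩ := hf.split
    simp only [Tile.inp] at hi
    change Fits v (n - 2 + 2) 0 at hv
    rw [show n - 2 + 2 = n by omega] at hv
    exact ⟨n, hu, hv, hi⟩
  rcases hl with i | ⟨s, i⟩ | ⟨s, i⟩
  · obtain ⟨n, hu, hi, -, hv⟩ := hf'.split
    simp only [Tile.inp] at hi
    change Fits v (n - 2 + 2) 0 at hv
    rw [show n - 2 + 2 = n by omega] at hv
    obtain ⟨μ, ⟨j, hj, h1⟩, ⟨j', hj', h2⟩, -⟩ := exists_exponents hu hv hi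
    exact key j j' μ (by simpa using hj) hj' h1 h2
  · obtain ⟨n, hu, hv, hi⟩ := fit hf
    obtain ⟨μ, ⟨j, hj, h1⟩, -, h⟩ := exists_exponents hu hv hi
    obtain ⟨j', hj', h2⟩ := h s
    exact key j' j μ hj' (by simpa using hj) h2 h1
  · obtain ⟨n, hu, hv, hi⟩ := fit hf
    obtain ⟨μ, -, ⟨j, hj, h1⟩, h⟩ := exists_exponents hu hv hi
    obtain ⟨j', hj', h2⟩ := h s
    exact key j' j μ hj' hj h2 h1

/-! ## Orienting closed words -/

theorem exists_stepAt_cup (b : Bool) {i : ℕ} {o : List Bool} (h : i ≤ o.length) :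
    ∃ o', stepAt (.cup b) i o = some o' := by
  induction i generalizing o with
  | zero => exact ⟨_, rfl⟩
  | succ i ih =>
    rcases o with _ | ⟨a, o⟩
    · simp at h
    · obtain ⟨o', ho⟩ := ih (o := o) (by simpa using h)
      exact ⟨a :: o', by rw [stepAt_succ_cons, ho]; rfl⟩

theorem exists_stepAt_cross (s : Bool) {i : ℕ} {o : List Bool} (h : i + 2 ≤ o.length) :
    ∃ o', stepAt (.cross s) i o = some o' := by
  induction i generalizing o with
  | zero =>
    rcases o with _ | ⟨a, _ | ⟨c, o⟩⟩
    · simp at h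
    · simp at h
    · exact ⟨_, rfl⟩
  | succ i ih =>
    rcases o with _ | ⟨a, o⟩
    · simp at h
    · obtain ⟨o', ho⟩ := ih (o := o) (by simp at h; omega)
      exact ⟨a :: o', by rw [stepAt_succ_cons, ho]; rfl⟩

theorem exists_stepAt_cap {i : ℕ} {o : List Bool} (h : i + 2 ≤ o.length)
    (hne : o[i]? ≠ o[i + 1]?) : ∃ o', stepAt .cap i o = some o' := by
  induction i generalizing o with
  | zero =>
    rcases o with _ | ⟨a, _ | ⟨c, o⟩⟩
    · simp at h
    · simp at h
    · refine ⟨o, ?_⟩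
      rw [stepAt, if_neg]
      rintro rfl
      exact hne rfl
  | succ i ih =>
    rcases o with _ | ⟨a, o⟩
    · simp at h
    · obtain ⟨o', ho⟩ := ih (o := o) (by simp at h; omega) (by simpa using hne)
      exact ⟨a :: o', by rw [stepAt_succ_cons, ho]; rfl⟩

theorem stepAt_cross_eq (s s' : Bool) (i : ℕ) (o : List Bool) :
    stepAt (.cross s) i o = stepAt (.cross s') i o := by
  induction i generalizing o with
  | zero => rcases o with _ | ⟨a, _ | ⟨c, o⟩⟩ <;> rfl
  | succ i ih =>
    rcases o with _ | ⟨a, o⟩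
    · rfl
    · rw [stepAt_succ_cons, stepAt_succ_cons, ih]

/-- The pairing of the strands at the bottom of a word that leaves no strands. -/
def bottomPairing : List Slice → ℕ → ℕ
  | [] => id
  | (.cup _, i) :: w => capMatch i (bottomPairing w)
  | (.cap, i) :: w => cupMatch i (bottomPairing w)
  | (.cross _, i) :: w => swapMatch i (bottomPairing w)

theorem pairing_bottomPairing {w : List Slice} {n : ℕ} (hw : Fits w n 0) :
    Pairing n (bottomPairing w) := by
  induction w generalizing n with
  | nil => cases hw; exact pairing_id
  | cons x w ih =>
    obtain ⟨x, i⟩ := x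
    obtain ⟨hi, hw⟩ := hw
    rcases x with b | _ | s
    · simp only [Tile.inp, Tile.out] at hi hw
      exact (ih hw).cap (by omega)
    · simp only [Tile.inp, Tile.out] at hi hw
      have := (ih hw).cup (i := i) (by omega)
      rwa [show n - 2 + 0 + 2 = n by omega] at this
    · simp only [Tile.inp, Tile.out] at hi hw
      rw [show n - 2 + 2 = n by omega] at hw
      exact (ih hw).swap hi

theorem Pairing.lt {n : ℕ} {m : ℕ → ℕ} (hm : Pairing n m) {x : ℕ} (hx : x < n) : m x < n := by
  by_contra hc
  have := (hm.2 (m x)).2 (by omega)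
  rw [hm.1] at this
  omega

/-- The left end of the minimum is directed against the strand to which the arcs above join it, or
arbitrarily if these join the two ends to each other. The right end then comes out right, because
the minimum merges the two outer strands into one arc, whose ends are opposite by hypothesis. -/
theorem exists_opposite_cup {i : ℕ} {o : List Bool} {p : ℕ → ℕ} (hp : Pairing (o.length + 2) p)
    (hi : i ≤ o.length) (ho : Opposite o (capMatch i p)) :
    ∃ b o', stepAt (.cup b) i o = some o' ∧ Opposite o' p := by
  have key : ∀ b o', stepAt (.cup b) i o = some o' → ∀ x, x < o.length → p (shiftUp i x) ≠ i →
      p (shiftUp i x) ≠ i + 1 → o'[p (shiftUp i x)]? ≠ o'[shiftUp i x]? := by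
    intro b o' hs x hx h1 h2
    obtain ⟨-, -, h3⟩ := stepAt_cup hs
    obtain ⟨y, hy⟩ := Triple.exists_shiftUp h1 h2
    rw [hy, h3, h3, ← Triple.cap_of_other hp hi hy]
    exact ho x hx
  have lt : ∀ x, shiftUp i x < o.length + 2 → x < o.length := by
    intro x hx
    unfold shiftUp at hx
    split_ifs at hx <;> omega
  by_cases he : p i = i + 1
  · obtain ⟨o', hs⟩ := exists_stepAt_cup true hi
    refine ⟨true, o', hs, fun j hj => ?_⟩
    have he' : p (i + 1) = i := by rw [← he, hp.1]
    have hl := stepAt_length hs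
    simp only [Tile.inp, Tile.out] at hl
    obtain ⟨h1, h2, h3⟩ := stepAt_cup hs
    by_cases c1 : j = i
    · rw [c1, he, h1, h2]; simp
    by_cases c2 : j = i + 1
    · rw [c2, he', h1, h2]; simp
    obtain ⟨x, rfl⟩ := Triple.exists_shiftUp c1 c2
    refine key _ _ hs x (lt x (by omega)) ?_ ?_
    · exact fun h => c2 ((hp.1 _).symm.trans ((congrArg p h).trans he))
    · exact fun h => c1 ((hp.1 _).symm.trans ((congrArg p h).trans he'))
  · have hii := (hp.2 i)
    have hii' := (hp.2 (i + 1))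
    obtain ⟨x, hx⟩ := Triple.exists_shiftUp (i := i) (j := p i) (by rw [Ne, hii]; omega) he
    have he' : p (i + 1) ≠ i := fun h => he ((congrArg p h).symm.trans (hp.1 _))
    obtain ⟨y, hy⟩ := Triple.exists_shiftUp (i := i) (j := p (i + 1)) he' (by rw [Ne, hii']; omega)
    obtain ⟨e1, e2⟩ := Triple.cap_of_merge hp hi hx hy
    have hxl : x < o.length := lt x (by rw [← hx]; exact hp.lt (by omega))
    have hyl : y < o.length := lt y (by rw [← hy]; exact hp.lt (by omega))
    have hxy := ho x hxl
    rw [e1, List.getElem?_eq_getElem hxl, List.getElem?_eq_getElem hyl] at hxy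
    obtain ⟨o', hs⟩ := exists_stepAt_cup (!o[x]) hi
    have hl := stepAt_length hs
    simp only [Tile.inp, Tile.out] at hl
    obtain ⟨h1, h2, h3⟩ := stepAt_cup hs
    have gx : o'[shiftUp i x]? = some o[x] := by rw [h3, List.getElem?_eq_getElem hxl]
    have gy : o'[shiftUp i y]? = some o[y] := by rw [h3, List.getElem?_eq_getElem hyl]
    refine ⟨_, o', hs, fun j hj => ?_⟩
    by_cases c1 : j = i
    · rw [c1, hx, h1, gx]; simp
    by_cases c2 : j = i + 1
    · rw [c2, hy, h2, gy]; simpa using hxy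
    by_cases c3 : j = p i
    · rw [c3, hp.1, hx, h1, gx]; simp
    by_cases c4 : j = p (i + 1)
    · rw [c4, hp.1, hy, h2, gy]; simpa using fun h => hxy (congrArg some h.symm)
    obtain ⟨z, rfl⟩ := Triple.exists_shiftUp c1 c2
    refine key _ _ hs z (lt z (by omega)) ?_ ?_
    · exact fun h => c3 ((hp.1 _).symm.trans (congrArg p h))
    · exact fun h => c4 ((hp.1 _).symm.trans (congrArg p h))

/-- Reading upwards, the directions are kept opposite along the arcs of the part still to be read.
Choices occur only at the cups, so the underlying unoriented word is unchanged. -/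
theorem exists_orient {w : List Slice} {o : List Bool} (hw : Fits w o.length 0)
    (ho : Opposite o (bottomPairing w)) : ∃ w' z, shapeOf w' = shapeOf w ∧ orient w' o = some z := by
  induction w generalizing o with
  | nil =>
    rcases o with _ | ⟨a, o⟩
    · exact ⟨[], 0, rfl, rfl⟩
    · simp [Fits] at hw
  | cons x w ih =>
    obtain ⟨x, i⟩ := x
    obtain ⟨hi, hw⟩ := hw
    have finish : ∀ (y : Tile) (o' : List Bool), y.forget = x.forget → stepAt y i o = some o' →
        Opposite o' (bottomPairing w) →
        ∃ w' z, shapeOf w' = shapeOf ((x, i) :: w) ∧ orient w' o = some z := by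
      intro y o' hy hs ho'
      have hl := stepAt_length hs
      have e : y.inp = x.inp ∧ y.out = x.out := by
        cases x <;> cases y <;> simp_all [Tile.forget, Tile.inp, Tile.out]
      obtain ⟨w', z, h1, h2⟩ := ih (o := o') (by
        rwa [show o'.length = o.length - x.inp + x.out by omega]) ho'
      refine ⟨(y, i) :: w', crossingSign y i o + z, ?_, ?_⟩
      · change (y.forget, i) :: shapeOf w' = (x.forget, i) :: shapeOf w
        rw [h1, hy]
      · simp only [orient, hs, Option.bind_some, h2, Option.map_some]
    rcases x with b | _ | s
    · simp only [Tile.inp, Tile.out] at hi hw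
      obtain ⟨b', o', hs, ho'⟩ := exists_opposite_cup (pairing_bottomPairing hw) hi ho
      exact finish (.cup b') o' rfl hs ho'
    · simp only [Tile.inp, Tile.out] at hi hw
      have hne : o[i]? ≠ o[i + 1]? := by
        have := ho i (by omega)
        simp only [bottomPairing, cupMatch, if_true] at this
        exact this.symm
      obtain ⟨o', hs⟩ := exists_stepAt_cap hi hne
      obtain ⟨-, h2⟩ := stepAt_cap hs
      have hl := stepAt_length hs
      simp only [Tile.inp, Tile.out] at hl
      refine finish .cap o' rfl hs fun j hj => ?_
      have := ho (shiftUp i j) (by unfold shiftUp; split_ifs <;> omega)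
      obtain ⟨c1, c2⟩ := Triple.shiftUp_ne i j
      rw [bottomPairing, cupMatch, if_neg c1, if_neg c2, Triple.shiftDown_shiftUp] at this
      rwa [h2, h2]
    · simp only [Tile.inp, Tile.out] at hi hw
      obtain ⟨o', hs⟩ := exists_stepAt_cross s hi
      have h2 := stepAt_cross hs
      have hl := stepAt_length hs
      simp only [Tile.inp, Tile.out] at hl
      refine finish (.cross s) o' rfl hs fun j hj => ?_
      have := ho (Equiv.swap i (i + 1) j) (by
        rw [Equiv.swap_apply_def]; split_ifs <;> omega)
      rw [bottomPairing, swapMatch, Equiv.swap_apply_self] at this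
      rwa [h2, h2]

theorem orient_flip {u v : List Slice} {s s' : Bool} {i : ℕ} {o : List Bool} {z : ℤ}
    (h : orient (u ++ [(.cross s, i)] ++ v) o = some z) :
    ∃ z', orient (u ++ [(.cross s', i)] ++ v) o = some z' := by
  rw [List.append_assoc, List.singleton_append] at h ⊢
  induction u generalizing o z with
  | nil =>
    simp only [List.nil_append, orient] at h ⊢
    obtain ⟨o', hs, hz⟩ := Option.bind_eq_some_iff.1 h
    obtain ⟨z', hw', -⟩ := Option.map_eq_some_iff.1 hz
    exact ⟨crossingSign (.cross s') i o + z', by rw [stepAt_cross_eq s' s, hs, Option.bind_some, hw']; rfl⟩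
  | cons x u ih =>
    obtain ⟨x, k⟩ := x
    simp only [List.cons_append, orient] at h ⊢
    obtain ⟨o', hs, hz⟩ := Option.bind_eq_some_iff.1 h
    obtain ⟨z', hw', -⟩ := Option.map_eq_some_iff.1 hz
    obtain ⟨z'', h''⟩ := ih hw'
    exact ⟨crossingSign x k o + z'', by rw [hs, Option.bind_some, h'']; rfl⟩

theorem components_flip (u v : List Slice) (s s' : Bool) (i : ℕ) (m : ℕ → ℕ) :
    components (u ++ [(.cross s, i)] ++ v) m = components (u ++ [(.cross s', i)] ++ v) m := by
  rw [List.append_assoc, List.append_assoc, List.singleton_append, List.singleton_append]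
  induction u generalizing m with
  | nil => rfl
  | cons x u ih =>
    obtain ⟨x, k⟩ := x
    rcases x with b | _ | t <;> simp only [List.cons_append, components, ih]

/-! ## Realizing words by knot diagrams -/

/-- The closed word `w` is a knot whose bracket is `Y`. -/
structure Presents (w : List Slice) (Y : LaurentPolynomial ℤ) : Prop where
  fits : Fits w 0 0
  loopBracket_eq : loopBracket w id = loopValue * Y
  odd : Odd (ev (1 : ℤˣ) Y)

namespace Presents

variable {w : List Slice} {Y : LaurentPolynomial ℤ}

/-- At a = 1 the state sum is ±(-2)ᶜ for c components, and here it is -2 times an odd number. -/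
theorem components_eq (h : Presents w Y) : components w id = 1 := by
  have h1 := ev_one_loopBracket h.fits pairing_id
  rw [h.loopBracket_eq, map_mul, show ev (1 : ℤˣ) loopValue = -2 by simp [loopValue]] at h1
  obtain ⟨k, hk⟩ := h.odd
  rw [hk] at h1
  rcases hc : components w id with _ | _ | c
  · rw [hc] at h1
    rcases neg_one_pow_eq_or ℤ (crossings w) with h2 | h2 <;> rw [h2] at h1 <;> omega
  · rfl
  · rw [hc, pow_succ, pow_succ] at h1
    exfalso
    rcases neg_one_pow_eq_or ℤ (crossings w) with h2 | h2 <;> rw [h2] at h1 <;> omega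

theorem exists_diagram (h : Presents w Y) :
    ∃ D : KnotDiagram, D.shape = shapeOf w ∧ D.bracket = Y := by
  obtain ⟨w', z, h1, h2⟩ := exists_orient (w := w) (o := []) h.fits (fun j hj => by simp at hj)
  refine ⟨⟨w', z, h2, ?_⟩, h1, ?_⟩
  · rw [← components_shapeOf, h1, components_shapeOf, h.components_eq]
  · apply mul_left_cancel₀ loopValue_ne_zero
    rw [KnotDiagram.bracket_eq, ← h.loopBracket_eq]
    change loopBracket w' id = _
    rw [← loopBracket_shapeOf, h1, loopBracket_shapeOf]

/-- Orienting the word affects only its cups, so the crossing is still there; switching it preserves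
both the directions and the components. Thus the second diagram needs no orientation argument of its
own. -/
theorem exists_crossingChange {u v : List Slice} {s : Bool} {i : ℕ} {Y' : LaurentPolynomial ℤ}
    (h : Presents (u ++ [(.cross s, i)] ++ v) Y)
    (h' : loopBracket (u ++ [(.cross (!s), i)] ++ v) id = loopValue * Y') :
    ∃ D D' : KnotDiagram, D.CrossingChange D' ∧ D.bracket = Y ∧ D'.bracket = Y' := by
  obtain ⟨D, h1, h2⟩ := h.exists_diagram
  have h3 : D.word.map (fun x : Slice => (x.1.forget, x.2)) =
    (shapeOf u ++ [(.cross s, i)]) ++ shapeOf v := by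
      rw [show D.word.map (fun x : Slice => (x.1.forget, x.2)) = D.shape from rfl, h1,
        shapeOf_append, shapeOf_append]
      rfl
  obtain ⟨l, v', hw, h4, hv⟩ := List.map_eq_append_iff.1 h3
  obtain ⟨u', c, rfl, hu, hc⟩ := List.map_eq_append_iff.1 h4
  obtain ⟨⟨x, k⟩, rfl, hx⟩ := List.map_eq_singleton_iff.1 hc
  have hx' : x = .cross s ∧ k = i := by
    simp only [Prod.mk.injEq] at hx
    refine ⟨?_, hx.2⟩
    have := hx.1
    cases x <;> simp_all [Tile.forget]
  obtain ⟨rfl, rfl⟩ := hx'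
  have ho := D.orient_eq
  rw [hw] at ho
  obtain ⟨z', hz'⟩ := orient_flip (s' := !s) ho
  have hcomp := D.components_eq
  rw [hw, components_flip u' v' s (!s)] at hcomp
  refine ⟨D, ⟨_, z', hz', hcomp⟩, ⟨u', v', s, k, hw, rfl⟩, h2, ?_⟩
  apply mul_left_cancel₀ loopValue_ne_zero
  rw [KnotDiagram.bracket_eq, ← h', ← loopBracket_shapeOf, shapeOf_append, shapeOf_append,
    show shapeOf u' = shapeOf u from hu, show shapeOf v' = shapeOf v from hv,
    ← loopBracket_shapeOf (u ++ _ ++ v), shapeOf_append, shapeOf_append]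

/-- The two diagrams are oriented independently, since a band move compares unoriented words only.
Each side must therefore be known to be a knot. -/
theorem exists_banding {u l l' v : List Slice} {Y' : LaurentPolynomial ℤ}
    (hl : LocalBanding l l') (h : Presents (u ++ l ++ v) Y) (h' : Presents (u ++ l' ++ v) Y') :
    ∃ D D' : KnotDiagram, D.Banding D' ∧ D.bracket = Y ∧ D'.bracket = Y' := by
  obtain ⟨D, h1, h2⟩ := h.exists_diagram
  obtain ⟨D', h1', h2'⟩ := h'.exists_diagram
  refine ⟨D, D', ⟨shapeOf u, l, l', shapeOf v, hl, ?_, ?_⟩, h2, h2'⟩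
  · rw [h1, shapeOf_append, shapeOf_append]
    rcases hl <;> rfl
  · rw [h1', shapeOf_append, shapeOf_append]
    rcases hl <;> rfl

end Presents

/-! ## Determinant and span from the bracket -/

/-- The primitive eighth root of unity. -/
noncomputable def eighthRoot : ℂˣ := Units.mk0 (Complex.exp (Real.pi * Complex.I / 4))
  (Complex.exp_ne_zero _)

theorem eighthRoot_zpow_four : eighthRoot ^ (4 : ℤ) = -1 := by
  apply Units.ext
  rw [Units.val_zpow_eq_zpow_val, eighthRoot, Units.val_mk0, ← Complex.exp_int_mul,
    show ((4 : ℤ) : ℂ) * (Real.pi * Complex.I / 4) = Real.pi * Complex.I by push_cast; ring,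
    Complex.exp_pi_mul_I]
  rfl

theorem norm_eighthRoot_zpow (k : ℤ) : ‖((eighthRoot ^ k : ℂˣ) : ℂ)‖ = 1 := by
  rw [Units.val_zpow_eq_zpow_val, norm_zpow, eighthRoot, Units.val_mk0,
    show (Real.pi : ℂ) * Complex.I / 4 = ((Real.pi / 4 : ℝ) : ℂ) * Complex.I by push_cast; ring,
    Complex.norm_exp_ofReal_mul_I, one_zpow]

/-- At a = exp(iπ/4) one has a⁻⁴ = -1, and the writhe factor has norm 1. -/
theorem KnotDiagram.det_eq (D : KnotDiagram) : (D.knot.det : ℝ) = ‖ev eighthRoot D.bracket‖ := by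
  have h1 : eighthRoot ^ (-4 : ℤ) = Units.map (Int.castRingHom ℂ : ℤ →* ℂ) (-1) := by
    rw [zpow_neg, eighthRoot_zpow_four]
    apply Units.ext
    simp
  have h2 := D.ev_jones eighthRoot
  rw [h1, ← map_ev] at h2
  have h3 := congrArg norm h2
  rw [X, map_mul, norm_mul, ev_writheFactor, norm_mul, norm_eighthRoot_zpow] at h3
  rw [Knot.det, Nat.cast_natAbs, Int.cast_abs, show RingHom.id ℤ = Int.castRingHom ℤ from
    RingHom.ext_int _ _]
  rw [eq_intCast, Complex.norm_intCast] at h3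
  rw [h3]
  rcases Int.units_eq_one_or ((-1) ^ D.writhe) with h | h <;> rw [h] <;> simp

/-- The lowest exponent of `f` is `p` and the highest one is `q`. -/
structure Extent (f : LaurentPolynomial ℤ) (p q : ℤ) : Prop where
  low : f.coeff p ≠ 0
  high : f.coeff q ≠ 0
  mem : ∀ k, f.coeff k ≠ 0 → p ≤ k ∧ k ≤ q

namespace Extent

variable {f g : LaurentPolynomial ℤ} {p q p' q' : ℤ}

theorem coeff_eq_zero (h : Extent f p q) {k : ℤ} (hk : k < p ∨ q < k) : f.coeff k = 0 := by
  by_contra hc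
  have := h.mem k hc
  omega

theorem congr (h : Extent f p q) (hp : p' = p) (hq : q' = q) : Extent f p' q' := by
  subst hp hq; exact h

theorem T (k : ℤ) : Extent (T k) k k :=
  ⟨by rw [T_apply, if_pos rfl]; exact one_ne_zero, by rw [T_apply, if_pos rfl]; exact one_ne_zero,
    fun j hj => by
      rw [T_apply] at hj
      split_ifs at hj with h
      · omega
      · exact absurd rfl hj⟩

theorem one : Extent 1 0 0 := by
  rw [← T_zero]; exact Extent.T 0

theorem neg (h : Extent f p q) : Extent (-f) p q := by
  refine ⟨?_, ?_, fun k hk => h.mem k ?_⟩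
  · rw [AddMonoidAlgebra.coeff_neg, Finsupp.neg_apply]; exact neg_ne_zero.2 h.low
  · rw [AddMonoidAlgebra.coeff_neg, Finsupp.neg_apply]; exact neg_ne_zero.2 h.high
  · rw [AddMonoidAlgebra.coeff_neg, Finsupp.neg_apply] at hk; exact neg_ne_zero.1 hk

theorem T_mul (h : Extent f p q) (k : ℤ) : Extent (LaurentPolynomial.T k * f) (k + p) (k + q) := by
  refine ⟨?_, ?_, fun j hj => ?_⟩
  · rw [coeff_T_mul, add_sub_cancel_left]; exact h.low
  · rw [coeff_T_mul, add_sub_cancel_left]; exact h.high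
  · rw [coeff_T_mul] at hj
    have := h.mem _ hj
    omega

/-- A sum in which neither extreme cancels. -/
theorem add (hf : Extent f p q) (hg : Extent g p' q') (hp : p ≠ p') (hq : q ≠ q') :
    Extent (f + g) (min p p') (max q q') := by
  have e : ∀ k, (f + g).coeff k = f.coeff k + g.coeff k := fun k => by
    rw [AddMonoidAlgebra.coeff_add, Finsupp.add_apply]
  refine ⟨?_, ?_, fun k hk => ?_⟩
  · rw [e]
    rcases lt_or_gt_of_ne hp with h | h
    · rw [min_eq_left h.le, hg.coeff_eq_zero (.inl h), add_zero]; exact hf.low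
    · rw [min_eq_right h.le, hf.coeff_eq_zero (.inl h), zero_add]; exact hg.low
  · rw [e]
    rcases lt_or_gt_of_ne hq with h | h
    · rw [max_eq_right h.le, hf.coeff_eq_zero (.inr h), zero_add]; exact hg.high
    · rw [max_eq_left h.le, hg.coeff_eq_zero (.inr h), add_zero]; exact hf.high
  · rw [e] at hk
    by_cases h : f.coeff k = 0
    · have := hg.mem k (by rwa [h, zero_add] at hk)
      omega
    · have := hf.mem k h
      omega

theorem mul (hf : Extent f p q) (hg : Extent g p' q') : Extent (f * g) (p + p') (q + q') := by
  have hs : ∀ k, (f * g).coeff k ≠ 0 → p + p' ≤ k ∧ k ≤ q + q' := by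
    intro k hk
    classical
    have := AddMonoidAlgebra.support_coeff_mul_subset f g (Finsupp.mem_support_iff.2 hk)
    obtain ⟨a, ha, b, hb, rfl⟩ := Finset.mem_add.1 this
    have h1 := hf.mem a (Finsupp.mem_support_iff.1 ha)
    have h2 := hg.mem b (Finsupp.mem_support_iff.1 hb)
    omega
  refine ⟨?_, ?_, hs⟩
  · rw [AddMonoidAlgebra.coeff_mul_add_of_uniqueAdd]
    · exact mul_ne_zero hf.low hg.low
    · intro a b ha hb hab
      have h1 := hf.mem a (Finsupp.mem_support_iff.1 ha)
      have h2 := hg.mem b (Finsupp.mem_support_iff.1 hb)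
      omega
  · rw [AddMonoidAlgebra.coeff_mul_add_of_uniqueAdd]
    · exact mul_ne_zero hf.high hg.high
    · intro a b ha hb hab
      have h1 := hf.mem a (Finsupp.mem_support_iff.1 ha)
      have h2 := hg.mem b (Finsupp.mem_support_iff.1 hb)
      omega

end Extent

/-- The writhe factor only shifts exponents, and t = a⁻⁴ reverses their order and divides
differences by 4. -/
theorem KnotDiagram.span_eq {D : KnotDiagram} {p q d : ℤ} (h : Extent D.bracket p q)
    (hd : q - p = 4 * d) : D.knot.span = d := by
  have hX : Extent D.X (-3 * D.writhe + p) (-3 * D.writhe + q) := by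
    rw [X]
    rcases writheFactor_eq D.writhe with e | e <;> rw [e]
    · exact h.T_mul _
    · rw [neg_mul]; exact (h.T_mul _).neg
  have h4 := D.X_exponents
  obtain ⟨a, ha⟩ := h4 _ hX.low
  obtain ⟨b, hb⟩ := h4 _ hX.high
  have hj : ∀ k, D.knot.jones.coeff k = D.X.coeff (-4 * k) := fun k => rfl
  rw [span_eq_of_support (K := D.knot) (p := -b) (q := -a)]
  · omega
  · rw [hj, show -4 * -b = -3 * D.writhe + q by omega]; exact hX.high
  · rw [hj, show -4 * -a = -3 * D.writhe + p by omega]; exact hX.low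
  · intro k hk
    rw [hj] at hk
    have := hX.mem _ hk
    omega

/-! ## Connected sums -/

/-- `B` is a tangle on the first strand, with value `x`. -/
structure Summand (B : List Slice) (x : LaurentPolynomial ℤ) : Prop where
  fits : ∀ n, 1 ≤ n → Fits B n n
  loopBracket_eq : ∀ (v : List Slice) {n : ℕ} {m : ℕ → ℕ}, 1 ≤ n → Pairing n m →
    loopBracket (B ++ v) m = x * loopBracket v m

/-- `R` closes up two strands joined by a minimum, giving a link with bracket `Y`. -/
structure Closing (R : List Slice) (Y : LaurentPolynomial ℤ) : Prop where
  fits : Fits R 2 0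
  loopBracket_eq : loopBracket ((.cup true, 0) :: R) id = loopValue * Y

theorem closing_cap : Closing [(.cap, 0)] 1 where
  fits := ⟨le_refl _, rfl⟩
  loopBracket_eq := by
    have := cup_loop 0 0 (loopBracket []) id pairing_id
    rw [show loopBracket [] id = 1 from rfl] at this
    exact this

/-- A tangle on the first strand splits off as a scalar, so brackets multiply under connected sum.
-/
theorem Closing.sum {B R : List Slice} {x Y : LaurentPolynomial ℤ} (hB : Summand B x)
    (hR : Closing R Y) : Closing (B ++ R) (x * Y) where
  fits := (hB.fits 2 (by norm_num)).append hR.fits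
  loopBracket_eq := by
    have h := hB.loopBracket_eq R (by norm_num) (pairing_id.cup (i := 0) (by simp))
    change loopBracket (B ++ R) (cupMatch 0 id) = _
    rw [h, mul_left_comm, ← hR.loopBracket_eq]
    rfl

theorem Closing.presents {R : List Slice} {Y : LaurentPolynomial ℤ} (h : Closing R Y)
    (ho : Odd (ev (1 : ℤˣ) Y)) : Presents ((.cup true, 0) :: R) Y :=
  ⟨⟨le_refl _, h.fits⟩, h.loopBracket_eq, ho⟩

theorem exists_crossingChange_sum {B₁ B₂ R : List Slice} {s : Bool} {i : ℕ}
    {x x' Y : LaurentPolynomial ℤ} (h : Summand (B₁ ++ [(.cross s, i)] ++ B₂) x)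
    (h' : Summand (B₁ ++ [(.cross (!s), i)] ++ B₂) x') (hR : Closing R Y)
    (ho : Odd (ev (1 : ℤˣ) (x * Y))) :
    ∃ D D' : KnotDiagram, D.CrossingChange D' ∧ D.bracket = x * Y ∧ D'.bracket = x' * Y := by
  have e : ∀ t, (.cup true, 0) :: (B₁ ++ [(.cross t, i)] ++ B₂ ++ R) =
      ((.cup true, 0) :: B₁) ++ [(.cross t, i)] ++ (B₂ ++ R) := fun t => by simp
  have p := (hR.sum h).presents ho
  rw [e] at p
  exact p.exists_crossingChange (by rw [← e]; exact (hR.sum h').loopBracket_eq)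

theorem exists_banding_sum {B₁ B₂ R l l' : List Slice} (hl : LocalBanding l l')
    {x x' Y : LaurentPolynomial ℤ} (h : Summand (B₁ ++ l ++ B₂) x)
    (h' : Summand (B₁ ++ l' ++ B₂) x') (hR : Closing R Y)
    (ho : Odd (ev (1 : ℤˣ) (x * Y))) (ho' : Odd (ev (1 : ℤˣ) (x' * Y))) :
    ∃ D D' : KnotDiagram, D.Banding D' ∧ D.bracket = x * Y ∧ D'.bracket = x' * Y := by
  have e : ∀ l, (.cup true, 0) :: (B₁ ++ l ++ B₂ ++ R) =
      ((.cup true, 0) :: B₁) ++ l ++ (B₂ ++ R) := fun t => by simp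
  have p := (hR.sum h).presents ho
  have p' := (hR.sum h').presents ho'
  rw [e] at p p'
  exact p.exists_banding hl p'

/-! ## Rational tangles from braids on three strands -/

/-- The sign of a crossing. -/
def sgn (s : Bool) : ℤ := if s then 1 else -1

theorem sgn_not (s : Bool) : sgn (!s) = -sgn s := by cases s <;> rfl

theorem loopBracket_cross_cons (s : Bool) (i : ℕ) (v : List Slice) (m : ℕ → ℕ) :
    loopBracket ((.cross s, i) :: v) m = T (sgn s) * loopBracket v m +
      T (-sgn s) * capOp i (cupOp i (loopBracket v)) m := by
  rcases s <;> rfl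

theorem curl_coeff (s : Bool) :
    (T (sgn s) + T (-sgn s) * loopValue : LaurentPolynomial ℤ) = -T (-3 * sgn s) := by
  rcases s <;> simp only [sgn, loopValue, mul_sub, mul_neg, ← T_add] <;> norm_num
  abel

theorem loopBracket_cross_cap (s : Bool) {i n : ℕ} (v : List Slice) {m : ℕ → ℕ}
    (hm : Pairing n m) (hi : i + 2 ≤ n) :
    loopBracket ((.cross s, i) :: (.cap, i) :: v) m =
      -T (-3 * sgn s) * loopBracket ((.cap, i) :: v) m := by
  rw [loopBracket_cross_cons, ← curl_coeff]
  have : capOp i (cupOp i (loopBracket ((.cap, i) :: v))) m =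
      capOp i (fun m => loopValue * loopBracket v m) m :=
    cap_congr i n _ _ m hm hi fun n' m' _ h' => cup_loop i n' _ m' h'
  rw [this]
  change _ * capOp i (loopBracket v) m + _ = _ * capOp i (loopBracket v) m
  simp only [capOp]
  ring

theorem loopBracket_cross_cap_right (s : Bool) {i n : ℕ} (v : List Slice) {m : ℕ → ℕ}
    (hm : Pairing n m) (hi : i + 3 ≤ n) :
    loopBracket ((.cross s, i) :: (.cap, i + 1) :: v) m =
      T (sgn s) * loopBracket ((.cap, i + 1) :: v) m +
        T (-sgn s) * loopBracket ((.cap, i) :: v) m := by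
  rw [loopBracket_cross_cons]
  congr 2
  exact cap_congr i n _ _ m hm (by omega) fun n' m' _ h' => cup_zig i n' _ m' h' (by omega)

theorem loopBracket_cross_cap_left (s : Bool) {i n : ℕ} (v : List Slice) {m : ℕ → ℕ}
    (hm : Pairing n m) (hi : i + 3 ≤ n) :
    loopBracket ((.cross s, i + 1) :: (.cap, i) :: v) m =
      T (sgn s) * loopBracket ((.cap, i) :: v) m +
        T (-sgn s) * loopBracket ((.cap, i + 1) :: v) m := by
  rw [loopBracket_cross_cons]
  congr 2
  exact cap_congr (i + 1) n _ _ m hm (by omega) fun n' m' _ h' => cup_zag i n' _ m' h' (by omega)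

/-- The values `x`, `y` of the two closures of a braid on three strands, and the numerator `p` and
denominator `q` of the corresponding rational tangle. -/
inductive BraidValue : List Slice → LaurentPolynomial ℤ → LaurentPolynomial ℤ → ℤ → ℤ → Prop
  | nil : BraidValue [] 1 loopValue 1 0
  | zero {b x y p q} (s : Bool) : BraidValue b x y p q →
      BraidValue (b ++ [(.cross s, 0)]) (-T (-3 * sgn s) * x) (T (sgn s) * y + T (-sgn s) * x)
        p (q + sgn s * p)
  | one {b x y p q} (s : Bool) : BraidValue b x y p q →
      BraidValue (b ++ [(.cross s, 1)]) (T (sgn s) * x + T (-sgn s) * y) (-T (-3 * sgn s) * y)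
        (p - sgn s * q) q

namespace BraidValue

variable {b : List Slice} {x y : LaurentPolynomial ℤ} {p q : ℤ}

theorem fits (h : BraidValue b x y p q) {n : ℕ} (hn : 3 ≤ n) : Fits b n n := by
  induction h with
  | nil => exact rfl
  | zero s _ ih => exact ih.append (fits_cross s (by omega))
  | one s _ ih => exact ih.append (fits_cross s (by omega))

theorem fits_cup (h : BraidValue b x y p q) {n : ℕ} (hn : 1 ≤ n) :
    Fits ((.cup true, 1) :: b) n (n + 2) :=
  ⟨hn, h.fits (n := n + 2) (by omega)⟩

/-- For the empty braid one closure is a zigzag and the other a loop. Each further crossing meets a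
closing maximum either as a curl or as a skein relation whose hook term straightens to the other
closure. -/
theorem spec (h : BraidValue b x y p q) (v : List Slice) {n : ℕ} {m : ℕ → ℕ} (hn : 1 ≤ n)
    (hm : Pairing n m) :
    loopBracket ((.cup true, 1) :: b ++ (.cap, 0) :: v) m = x * loopBracket v m ∧
      loopBracket ((.cup true, 1) :: b ++ (.cap, 1) :: v) m = y * loopBracket v m := by
  induction h with
  | nil =>
    rw [one_mul]
    exact ⟨cup_zag 0 n (loopBracket v) m hm hn, cup_loop 1 n (loopBracket v) m hm⟩
  | @zero b x y p q s h ih =>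
    have e : ∀ l, (.cup true, 1) :: (b ++ [(.cross s, 0)]) ++ l =
        ((.cup true, 1) :: b) ++ (.cross s, 0) :: l := fun l => by simp
    rw [e, e]
    constructor
    · rw [loopBracket_scalar (fun m' hm' => loopBracket_cross_cap s v hm' (by omega)) (h.fits_cup hn)
        hm, ih.1]
      ring
    · rw [loopBracket_linear (fun m' hm' => loopBracket_cross_cap_right s v hm' (by omega))
        (h.fits_cup hn) hm, ih.1, ih.2]
      ring
  | @one b x y p q s h ih =>
    have e : ∀ l, (.cup true, 1) :: (b ++ [(.cross s, 1)]) ++ l =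
        ((.cup true, 1) :: b) ++ (.cross s, 1) :: l := fun l => by simp
    rw [e, e]
    constructor
    · rw [loopBracket_linear (fun m' hm' => loopBracket_cross_cap_left s v hm' (by omega))
        (h.fits_cup hn) hm, ih.1, ih.2]
      ring
    · rw [loopBracket_scalar (fun m' hm' => loopBracket_cross_cap s v hm' (by omega)) (h.fits_cup hn)
        hm, ih.2]
      ring

theorem numerator (h : BraidValue b x y p q) :
    Summand ((.cup true, 1) :: b ++ [(.cap, 0)]) x where
  fits n hn := (h.fits_cup hn).append ⟨by simp [Tile.inp], by simp [Tile.inp, Tile.out, Fits]⟩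
  loopBracket_eq v {n m} hn hm := by
    rw [List.append_assoc]
    exact (h.spec v hn hm).1

theorem denominator (h : BraidValue b x y p q) :
    Summand ((.cup true, 1) :: b ++ [(.cap, 1)]) y where
  fits n hn := (h.fits_cup hn).append
    ⟨by simp [Tile.inp]; omega, by simp [Tile.inp, Tile.out, Fits]⟩
  loopBracket_eq v {n m} hn hm := by
    rw [List.append_assoc]
    exact (h.spec v hn hm).2

/-- The saddle inserted before the closing maximum closes the braid the other way, and the new
minimum forms a zigzag with that maximum. Hence one band move leads from `numerator` to this tangle.
-/
theorem denominator' (h : BraidValue b x y p q) :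
    Summand ((.cup true, 1) :: b ++ [(.cap, 1), (.cup true, 1)] ++ [(.cap, 0)]) y where
  fits n hn := by
    rw [List.append_assoc]
    exact (h.fits_cup hn).append
      ⟨by simp [Tile.inp]; omega, by simp [Tile.inp, Tile.out]; omega,
        by simp [Tile.inp, Tile.out], by simp [Tile.inp, Tile.out, Fits]⟩
  loopBracket_eq v {n m} hn hm := by
    have := (h.spec ((.cup true, 1) :: (.cap, 0) :: v) hn hm).2
    rw [show loopBracket ((.cup true, 1) :: (.cap, 0) :: v) m = loopBracket v m from
      cup_zag 0 n (loopBracket v) m hm hn] at this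
    rw [← this]
    simp

theorem cancel_zero (h : BraidValue b x y p q) (s : Bool) :
    BraidValue (b ++ [(.cross s, 0)] ++ [(.cross (!s), 0)]) x y p q := by
  have h1 := (h.zero s).zero (!s)
  rw [sgn_not] at h1
  convert h1 using 1
  · rw [← mul_assoc, neg_mul_neg, ← T_add]
    simp
  · have h2 := curl_coeff s
    rcases s <;> simp only [sgn, mul_add, ← mul_assoc, ← T_add, mul_neg, neg_mul] <;>
      norm_num
  · ring

/-- At the eighth root of unity the two closures are given by the numerator and the denominator. -/
theorem ev_eighthRoot (h : BraidValue b x y p q) : ∃ k : ℤ,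
    ev eighthRoot x = ((eighthRoot ^ k : ℂˣ) : ℂ) * p ∧
      ev eighthRoot y = ((eighthRoot ^ (k - 2) : ℂˣ) : ℂ) * q := by
  have h4 : ∀ k : ℤ, ((eighthRoot ^ (k + 4) : ℂˣ) : ℂ) = -((eighthRoot ^ k : ℂˣ) : ℂ) := fun k => by
    rw [zpow_add, eighthRoot_zpow_four]; simp
  induction h with
  | nil =>
    refine ⟨0, by simp, ?_⟩
    rw [loopValue, map_sub, map_neg, eval₂_T, eval₂_T, show (2 : ℤ) = -2 + 4 by norm_num, h4]
    simp
  | @zero b x y p q s h ih =>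
    obtain ⟨k, h1, h2⟩ := ih
    refine ⟨k + sgn s, ?_, ?_⟩
    · rw [map_mul, map_neg, eval₂_T, h1, ← mul_assoc, neg_mul, ← Units.val_mul, ← zpow_add]
      rcases s
      · rw [show -3 * sgn false + k = (k + sgn false) + 4 by simp [sgn]; ring, h4, neg_neg]
      · rw [← h4, show -3 * sgn true + k + 4 = k + sgn true by simp [sgn]; ring]
    · rw [map_add, map_mul, map_mul, eval₂_T, eval₂_T, h1, h2, ← mul_assoc, ← mul_assoc,
        ← Units.val_mul, ← Units.val_mul, ← zpow_add, ← zpow_add]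
      rw [Int.cast_add, Int.cast_mul]
      rcases s
      · rw [show -sgn false + k = k + sgn false - 2 + 4 by simp [sgn]; ring, h4,
          show sgn false + (k - 2) = k + sgn false - 2 by ring]
        simp [sgn]; ring
      · rw [show -sgn true + k = k + sgn true - 2 by simp [sgn]; ring,
          show sgn true + (k - 2) = k + sgn true - 2 by ring]
        simp [sgn]; ring
  | @one b x y p q s h ih =>
    obtain ⟨k, h1, h2⟩ := ih
    refine ⟨k + sgn s, ?_, ?_⟩
    · rw [map_add, map_mul, map_mul, eval₂_T, eval₂_T, h1, h2, ← mul_assoc, ← mul_assoc,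
        ← Units.val_mul, ← Units.val_mul, ← zpow_add, ← zpow_add]
      rw [Int.cast_sub, Int.cast_mul]
      rcases s
      · rw [show -sgn false + (k - 2) = k + sgn false by simp [sgn]; ring,
          show sgn false + k = k + sgn false by ring]
        simp [sgn]; ring
      · rw [show k + sgn true = (-sgn true + (k - 2)) + 4 by simp [sgn]; ring, h4,
          show sgn true + k = (-sgn true + (k - 2)) + 4 by simp [sgn]; ring, h4]
        simp [sgn]; ring
    · rw [map_mul, map_neg, eval₂_T, h2, ← mul_assoc, neg_mul, ← Units.val_mul, ← zpow_add]
      rcases s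
      · rw [show -3 * sgn false + (k - 2) = (k + sgn false - 2) + 4 by simp [sgn]; ring, h4, neg_neg]
      · rw [← h4, show -3 * sgn true + (k - 2) + 4 = k + sgn true - 2 by simp [sgn]; ring]

theorem norm_numerator (h : BraidValue b x y p q) : ‖ev eighthRoot x‖ = |(p : ℝ)| := by
  obtain ⟨k, h1, -⟩ := h.ev_eighthRoot
  rw [h1, norm_mul, norm_eighthRoot_zpow, one_mul, Complex.norm_intCast]

theorem norm_denominator (h : BraidValue b x y p q) : ‖ev eighthRoot y‖ = |(q : ℝ)| := by
  obtain ⟨k, -, h1⟩ := h.ev_eighthRoot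
  rw [h1, norm_mul, norm_eighthRoot_zpow, one_mul, Complex.norm_intCast]

/-- Modulo 2 the recursions for closures at a = 1 and for numerator and denominator coincide. The
parities of `p` and `q` thus decide which closures are knots. -/
theorem ev_one (h : BraidValue b x y p q) :
    2 ∣ ev (1 : ℤˣ) x - p ∧ 2 ∣ ev (1 : ℤˣ) y - q := by
  induction h with
  | nil => simp [loopValue]
  | zero s _ ih =>
    simp only [map_add, map_mul, map_neg, eval₂_T, one_zpow, Units.val_one]
    rcases s <;> simp only [sgn, if_true, if_false, Bool.false_eq_true] <;> omega
  | one s _ ih =>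
    simp only [map_add, map_mul, map_neg, eval₂_T, one_zpow, Units.val_one]
    rcases s <;> simp only [sgn, if_true, if_false, Bool.false_eq_true] <;> omega

theorem odd_numerator (h : BraidValue b x y p q) (hp : Odd p) : Odd (ev (1 : ℤˣ) x) := by
  have := h.ev_one.1
  rw [Int.odd_iff] at hp ⊢
  omega

theorem odd_denominator (h : BraidValue b x y p q) (hq : Odd q) : Odd (ev (1 : ℤˣ) y) := by
  have := h.ev_one.2
  rw [Int.odd_iff] at hq ⊢
  omega

end BraidValue

theorem exists_braidValue_zero {p q : ℤ} (s : Bool) (h : ∃ b x y, BraidValue b x y p (q - sgn s * p)) :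
    ∃ b x y, BraidValue b x y p q := by
  obtain ⟨b, x, y, h⟩ := h
  have := h.zero s
  rw [sub_add_cancel] at this
  exact ⟨_, _, _, this⟩

theorem exists_braidValue_one {p q : ℤ} (s : Bool) (h : ∃ b x y, BraidValue b x y (p + sgn s * q) q) :
    ∃ b x y, BraidValue b x y p q := by
  obtain ⟨b, x, y, h⟩ := h
  have := h.one s
  rw [add_sub_cancel_right] at this
  exact ⟨_, _, _, this⟩

/-- All rational tangles arise. -/
theorem exists_braidValue {p q : ℤ} (h : IsCoprime p q) : ∃ b x y, BraidValue b x y p q := by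
  induction hN : p.natAbs + q.natAbs using Nat.strong_induction_on generalizing p q with
  | _ N ih =>
    subst hN
    have base : ∃ b x y, BraidValue b x y 1 0 := ⟨_, _, _, .nil⟩
    -- The pair returns with opposite sign through (1, 0), (1, 1), (0, 1), (-1, 1), (-1, 0).
    have base' : ∃ b x y, BraidValue b x y (-1) 0 :=
      exists_braidValue_zero true <| exists_braidValue_one true <| exists_braidValue_one true <|
        exists_braidValue_zero true base
    by_cases hq : q = 0
    · subst hq
      rw [isCoprime_zero_right, Int.isUnit_iff] at h
      rcases h with rfl | rfl
      · exact base
      · exact base'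
    by_cases hp : p = 0
    · subst hp
      rw [isCoprime_zero_left, Int.isUnit_iff] at h
      rcases h with rfl | rfl
      · exact exists_braidValue_one true <| exists_braidValue_zero true base
      · exact exists_braidValue_one true <| exists_braidValue_zero true base'
    -- Euclidean step: the entry of smaller absolute value is added to or subtracted from the other
    -- one, according to the sign of `p * q`, so that the sum of absolute values drops.
    rcases le_or_gt q.natAbs p.natAbs with hle | hlt
    · by_cases hs : 0 < p * q
      · refine exists_braidValue_one false (ih _ ?_ ?_ rfl)
        · rcases pos_and_pos_or_neg_and_neg_of_mul_pos hs with h | h <;> simp [sgn] <;> omega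
        · rw [mul_comm]; exact h.add_mul_left_left _
      · refine exists_braidValue_one true (ih _ ?_ ?_ rfl)
        · have hs' : p * q < 0 := lt_of_le_of_ne (not_lt.1 hs) (mul_ne_zero hp hq)
          rcases mul_neg_iff.1 hs' with h | h <;> simp [sgn] <;> omega
        · rw [mul_comm]; exact h.add_mul_left_left _
    · by_cases hs : 0 < p * q
      · refine exists_braidValue_zero true (ih _ ?_ ?_ rfl)
        · rcases pos_and_pos_or_neg_and_neg_of_mul_pos hs with h | h <;> simp [sgn] <;> omega
        · rw [sub_eq_add_neg, ← neg_mul, mul_comm]; exact h.add_mul_left_right _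
      · refine exists_braidValue_zero false (ih _ ?_ ?_ rfl)
        · have hs' : p * q < 0 := lt_of_le_of_ne (not_lt.1 hs) (mul_ne_zero hp hq)
          rcases mul_neg_iff.1 hs' with h | h <;> simp [sgn] <;> omega
        · rw [sub_eq_add_neg, ← neg_mul, mul_comm]; exact h.add_mul_left_right _

/-! ## Alternating braids -/

/-- Extents of two Laurent polynomials, subject to inequalities that exclude cancellation in the
recursion for the two closures of a braid. -/
structure Extents (x y : LaurentPolynomial ℤ) (α A β B : ℤ) : Prop where
  extent_x : Extent x α A
  extent_y : Extent y β B
  low : α < β + 2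
  high : A < B + 2

namespace Extents

variable {x y : LaurentPolynomial ℤ} {α A β B : ℤ}

/-- With this sign of the crossing the lowest term of the new second closure comes from `x` and the
highest from `y`. The inequalities say exactly that, and they persist. -/
theorem zero (h : Extents x y α A β B) :
    Extents (-T (-3 * sgn true) * x) (T (sgn true) * y + T (-sgn true) * x)
      (α - 3) (A - 3) (α - 1) (B + 1) where
  extent_x := by
    rw [neg_mul]
    exact (h.extent_x.T_mul _).neg.congr (by simp [sgn]; ring) (by simp [sgn]; ring)
  extent_y := by
    have h1 := h.low
    have h2 := h.high
    refine ((h.extent_y.T_mul _).add (h.extent_x.T_mul _) ?_ ?_).congr ?_ ?_ <;>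
      simp only [sgn, if_true] <;> omega
  low := by omega
  high := by have := h.high; omega

theorem one (h : Extents x y α A β B) :
    Extents (T (sgn false) * x + T (-sgn false) * y) (-T (-3 * sgn false) * y)
      (α - 1) (B + 1) (β + 3) (B + 3) where
  extent_x := by
    have h1 := h.low
    have h2 := h.high
    refine ((h.extent_x.T_mul _).add (h.extent_y.T_mul _) ?_ ?_).congr ?_ ?_ <;>
      simp only [sgn, if_false, Bool.false_eq_true] <;> omega
  extent_y := by
    rw [neg_mul]
    exact (h.extent_y.T_mul _).neg.congr (by simp [sgn]; ring) (by simp [sgn]; ring)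
  low := by have := h.low; omega
  high := by omega

theorem congr (h : Extents x y α A β B) {α' A' β' B' : ℤ} (h1 : α' = α)
    (h2 : A' = A) (h3 : β' = β) (h4 : B' = B) : Extents x y α' A' β' B' := by
  subst h1 h2 h3 h4; exact h

end Extents

/-- A braid all of whose crossings are alternating, with the extents of its two closures. -/
structure Alternating (b : List Slice) (x y : LaurentPolynomial ℤ) (α A β B p q : ℤ) : Prop where
  value : BraidValue b x y p q
  extents : Extents x y α A β B

namespace Alternating

variable {b : List Slice} {x y : LaurentPolynomial ℤ} {α A β B p q : ℤ}

theorem zero (h : Alternating b x y α A β B p q) :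
    Alternating (b ++ [(.cross true, 0)]) (-T (-3 * sgn true) * x)
      (T (sgn true) * y + T (-sgn true) * x) (α - 3) (A - 3) (α - 1) (B + 1) p (q + p) where
  value := by simpa [sgn] using h.value.zero true
  extents := h.extents.zero

theorem one (h : Alternating b x y α A β B p q) :
    Alternating (b ++ [(.cross false, 1)]) (T (sgn false) * x + T (-sgn false) * y)
      (-T (-3 * sgn false) * y) (α - 1) (B + 1) (β + 3) (B + 3) (p + q) q where
  value := by simpa [sgn] using h.value.one false
  extents := h.extents.one

theorem congr (h : Alternating b x y α A β B p q) {α' A' β' B' p' q' : ℤ} (h1 : α' = α)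
    (h2 : A' = A) (h3 : β' = β) (h4 : B' = B) (h5 : p' = p) (h6 : q' = q) :
    Alternating b x y α' A' β' B' p' q' := by
  subst h1 h2 h3 h4 h5 h6; exact h

theorem zeros (h : Alternating b x y α A β B p q) (e : ℕ) : ∃ x' y',
    Alternating (b ++ List.replicate (e + 1) (.cross true, 0)) x' y'
      (α - 3 * (e + 1)) (A - 3 * (e + 1)) (α - 1 - 3 * e) (B + 1 + e) p (q + (e + 1) * p) := by
  induction e with
  | zero => exact ⟨_, _, h.zero.congr (by simp) (by simp) (by simp) (by simp) rfl (by simp)⟩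
  | succ e ih =>
    obtain ⟨x', y', h'⟩ := ih
    rw [List.replicate_succ', ← List.append_assoc]
    refine ⟨_, _, h'.zero.congr ?_ ?_ ?_ ?_ ?_ ?_⟩ <;> push_cast <;> ring

theorem ones (h : Alternating b x y α A β B p q) (e : ℕ) : ∃ x' y',
    Alternating (b ++ List.replicate (e + 1) (.cross false, 1)) x' y'
      (α - (e + 1)) (B + 1 + 3 * e) (β + 3 * (e + 1)) (B + 3 * (e + 1)) (p + (e + 1) * q) q := by
  induction e with
  | zero => exact ⟨_, _, h.one.congr (by simp) (by simp) (by simp) (by simp) (by simp) rfl⟩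
  | succ e ih =>
    obtain ⟨x', y', h'⟩ := ih
    rw [List.replicate_succ', ← List.append_assoc]
    refine ⟨_, _, h'.one.congr ?_ ?_ ?_ ?_ ?_ ?_⟩ <;> push_cast <;> ring

/-- The empty braid has extents 0, 0 and -2, 2 and violates the strict inequality for the low ends,
so the recursion starts with one crossing, where `y` is the value of a curl. -/
theorem start : ∃ x y, Alternating [(.cross true, 0)] x y (-3) (-3) 3 3 1 1 := by
  refine ⟨-T (-3 * sgn true) * 1, T (sgn true) * loopValue + T (-sgn true) * 1, ?_, ?_, ?_, by norm_num,
    by norm_num⟩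
  · simpa [sgn] using BraidValue.nil.zero true
  · rw [mul_one]
    exact (Extent.T _).neg
  · rw [mul_one, show sgn true = - sgn false by rfl, neg_neg, add_comm, curl_coeff]
    exact (Extent.T _).neg

/-- Powers of the first generator. -/
theorem twist (e : ℕ) : ∃ x y, Alternating (List.replicate (e + 2) (.cross true, 0)) x y
    (-3 * (e + 2)) (-3 * (e + 2)) (2 - 3 * (e + 2)) (e + 2 + 2) 1 (e + 2) := by
  obtain ⟨x, y, h⟩ := start
  obtain ⟨x', y', h'⟩ := h.zeros e
  refine ⟨x', y', ?_⟩
  rw [show List.replicate (e + 2) ((Tile.cross true, 0) : Slice) =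
    [(.cross true, 0)] ++ List.replicate (e + 1) (.cross true, 0) from rfl]
  refine h'.congr ?_ ?_ ?_ ?_ ?_ ?_ <;> ring

end Alternating

/-! ## Evaluation of explicit diagrams

Polynomials in `t = a²` are lists of integers; linear combinations of pairings are lists. -/

/-- The polynomial in `a²` with the given coefficients. -/
noncomputable def polyVal : List ℤ → LaurentPolynomial ℤ
  | [] => 0
  | c :: P => C c + T 2 * polyVal P

/-- Addition of coefficient lists. -/
def addList : List ℤ → List ℤ → List ℤ
  | [], Q => Q
  | P, [] => P
  | c :: P, d :: Q => (c + d) :: addList P Q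

theorem polyVal_addList (P Q : List ℤ) : polyVal (addList P Q) = polyVal P + polyVal Q := by
  induction P generalizing Q with
  | nil => simp [addList, polyVal]
  | cons c P ih =>
    rcases Q with _ | ⟨d, Q⟩
    · simp [addList, polyVal]
    · rw [addList, polyVal, polyVal, polyVal, ih, map_add]
      ring

/-- Negation of coefficient lists. -/
def negList : List ℤ → List ℤ
  | [] => []
  | c :: P => -c :: negList P

theorem polyVal_negList (P : List ℤ) : polyVal (negList P) = -polyVal P := by
  induction P with
  | nil => simp [negList, polyVal]
  | cons c P ih =>
    rw [negList, polyVal, polyVal, ih, map_neg]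
    ring

theorem polyVal_shift (P : List ℤ) : polyVal (0 :: P) = T 2 * polyVal P := by
  rw [polyVal, map_zero, zero_add]

/-- Multiplication by `a² δ`. -/
def loopList (P : List ℤ) : List ℤ := negList (addList P (0 :: 0 :: P))

theorem polyVal_loopList (P : List ℤ) : polyVal (loopList P) = T 2 * (loopValue * polyVal P) := by
  rw [loopList, polyVal_negList, polyVal_addList, polyVal_shift, polyVal_shift, loopValue,
    ← mul_assoc, ← mul_assoc, mul_sub, mul_neg, ← T_add, ← T_add]
  norm_num
  ring

/-- The list of values of a pairing. -/
def table (n : ℕ) (m : ℕ → ℕ) : List ℕ := (List.range n).map m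

/-- The pairing with a given list of values. -/
def lookup (l : List ℕ) (j : ℕ) : ℕ := l.getD j j

theorem lookup_table {n : ℕ} {m : ℕ → ℕ} (hm : Pairing n m) : lookup (table n m) = m := by
  funext j
  by_cases hj : j < n
  · simp [lookup, table, hj]
  · rw [lookup, table, List.getD_eq_default _ _ (by simpa using hj)]
    exact ((hm.2 j).2 (by omega)).symm

/-- The coefficient of the pairing `l` in a linear combination is increased by `P`. -/
def addTerm (l : List ℕ) (P : List ℤ) : List (List ℕ × List ℤ) → List (List ℕ × List ℤ)
  | [] => [(l, P)]
  | (l', P') :: S => if l = l' then (l', addList P P') :: S else (l', P') :: addTerm l P S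

/-- The value of a linear form at a linear combination of pairings. -/
noncomputable def total (f : (ℕ → ℕ) → LaurentPolynomial ℤ) :
    List (List ℕ × List ℤ) → LaurentPolynomial ℤ
  | [] => 0
  | (l, P) :: S => polyVal P * f (lookup l) + total f S

theorem total_addTerm (f : (ℕ → ℕ) → LaurentPolynomial ℤ) (l : List ℕ) (P : List ℤ)
    (S : List (List ℕ × List ℤ)) :
    total f (addTerm l P S) = polyVal P * f (lookup l) + total f S := by
  induction S with
  | nil => rfl
  | cons a S ih =>
    obtain ⟨l', P'⟩ := a
    rw [addTerm]
    split_ifs with h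
    · rw [total, total, polyVal_addList, h]
      ring
    · rw [total, total, ih]
      ring

/-- All pairings occurring in a linear combination are pairings of `n` strands. -/
def AllPairings (n : ℕ) (S : List (List ℕ × List ℤ)) : Prop :=
  ∀ a ∈ S, a.1.length = n ∧ Pairing n (lookup a.1)

theorem AllPairings.addTerm {n : ℕ} {S : List (List ℕ × List ℤ)} (hS : AllPairings n S)
    {m : ℕ → ℕ} (hm : Pairing n m) (P : List ℤ) :
    AllPairings n (KnotGraphs.addTerm (table n m) P S) := by
  have ht : (table n m).length = n ∧ Pairing n (lookup (table n m)) := by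
    rw [lookup_table hm]
    exact ⟨by simp [table], hm⟩
  induction S with
  | nil =>
    intro a ha
    rw [KnotGraphs.addTerm, List.mem_singleton] at ha
    rw [ha]
    exact ht
  | cons b S ih =>
    obtain ⟨l', P'⟩ := b
    have hb := hS (l', P') List.mem_cons_self
    have hS' : AllPairings n S := fun a ha => hS a (List.mem_cons_of_mem _ ha)
    rw [KnotGraphs.addTerm]
    split_ifs with h
    · intro a ha
      rcases List.mem_cons.1 ha with rfl | ha
      · exact hb
      · exact hS' a ha
    · intro a ha
      rcases List.mem_cons.1 ha with rfl | ha
      · exact hb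
      · exact ih hS' a ha

/-- The contribution of one pairing to the linear combination above a tile, up to a power of `a`. -/
def stepTerm : Tile → ℕ → List ℕ → List ℤ → List (List ℕ × List ℤ) → List (List ℕ × List ℤ)
  | .cup _, i, l, P, S => addTerm (table (l.length + 2) (cupMatch i (lookup l))) P S
  | .cap, i, l, P, S => addTerm (table (l.length - 2) (capMatch i (lookup l)))
      (if lookup l i = i + 1 then loopList P else 0 :: P) S
  | .cross s, i, l, P, S => addTerm (table l.length (lookup l))
      (if s then 0 :: 0 :: P else 0 :: P)
      (addTerm (table l.length (cupMatch i (capMatch i (lookup l))))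
        (if s then (if lookup l i = i + 1 then loopList P else 0 :: P)
          else 0 :: (if lookup l i = i + 1 then loopList P else 0 :: P)) S)

/-- The linear combination above a tile. -/
def stepState (x : Tile) (i : ℕ) : List (List ℕ × List ℤ) → List (List ℕ × List ℤ)
  | [] => []
  | (l, P) :: S => stepTerm x i l P (stepState x i S)

/-- The linear combination above a word. -/
def runState : List Slice → List (List ℕ × List ℤ) → List (List ℕ × List ℤ)
  | [], S => S
  | (x, i) :: w, S => runState w (stepState x i S)

/-- The exponent of the power of `a` omitted in `stepTerm`. -/
def tileShift : Tile → ℤ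
  | .cup _ => 0
  | .cap => 2
  | .cross _ => 3

/-- The exponent of the power of `a` omitted in `runState`. -/
def wordShift : List Slice → ℤ
  | [] => 0
  | (x, _) :: w => tileShift x + wordShift w

/-- A factor a² per maximum and a³ per crossing clears negative powers and leaves even ones, so that
lists of coefficients in a² suffice; `wordShift` collects these factors. -/
theorem total_stepTerm (x : Tile) (i n : ℕ) (w : List Slice) (l : List ℕ) (P : List ℤ)
    (S : List (List ℕ × List ℤ)) (hl : l.length = n) (hm : Pairing n (lookup l))
    (hi : i + x.inp ≤ n) (hS : AllPairings (n - x.inp + x.out) S) :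
    AllPairings (n - x.inp + x.out) (stepTerm x i l P S) ∧
    total (loopBracket w) (stepTerm x i l P S) =
      T (tileShift x) * (polyVal P * loopBracket ((x, i) :: w) (lookup l)) +
        total (loopBracket w) S := by
  subst hl
  rcases x with b | _ | s
  · simp only [Tile.inp, Tile.out, Nat.sub_zero, add_zero] at hi hS ⊢
    have h1 := hm.cup hi
    refine ⟨hS.addTerm h1 P, ?_⟩
    rw [stepTerm, total_addTerm, lookup_table h1, tileShift, T_zero, one_mul]
    rfl
  · simp only [Tile.inp, Tile.out, add_zero] at hi hS ⊢
    obtain ⟨n, hn⟩ : ∃ n, l.length = n + 2 := ⟨l.length - 2, by omega⟩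
    rw [stepTerm]
    simp only [hn, Nat.add_sub_cancel] at *
    have h1 := hm.cap (i := i) (by omega)
    refine ⟨hS.addTerm h1 _, ?_⟩
    rw [total_addTerm, lookup_table h1, tileShift]
    change _ = T 2 * (polyVal P * capOp i (loopBracket w) (lookup l)) + _
    rw [capOp, loopFactor]
    split_ifs
    · rw [polyVal_loopList]; ring
    · rw [polyVal_shift]; ring
  · simp only [Tile.inp, Tile.out] at hi hS ⊢
    obtain ⟨n, hn⟩ : ∃ n, l.length = n + 2 := ⟨l.length - 2, by omega⟩
    rw [stepTerm]
    simp only [hn, Nat.add_sub_cancel] at *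
    have h1 := (hm.cap (i := i) (by omega)).cup (i := i) (by omega)
    refine ⟨(hS.addTerm h1 _).addTerm hm _, ?_⟩
    rw [total_addTerm, total_addTerm, lookup_table h1, lookup_table hm, loopBracket_cross_cons,
      tileShift, capOp, cupOp, loopFactor]
    have e1 : (T 3 * T (-1) : LaurentPolynomial ℤ) = T 2 := by rw [← T_add]; norm_num
    have e2 : (T 3 * T 1 : LaurentPolynomial ℤ) = T 2 * T 2 := by rw [← T_add, ← T_add]; norm_num
    rcases s
    · simp only [sgn, if_false, Bool.false_eq_true, neg_neg, mul_add]
      rw [mul_left_comm (polyVal P) (T (-1)), mul_left_comm (polyVal P) (T 1), ← mul_assoc (T 3),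
        ← mul_assoc (T 3), e1, e2]
      split_ifs <;> simp only [polyVal_shift, polyVal_loopList] <;> ring
    · simp only [sgn, if_true, mul_add]
      rw [mul_left_comm (polyVal P) (T (-1)), mul_left_comm (polyVal P) (T 1), ← mul_assoc (T 3),
        ← mul_assoc (T 3), e1, e2]
      split_ifs <;> simp only [polyVal_shift, polyVal_loopList] <;> ring

theorem total_stepState (x : Tile) (i n : ℕ) (w : List Slice) (S : List (List ℕ × List ℤ))
    (hi : i + x.inp ≤ n) (hS : AllPairings n S) :
    AllPairings (n - x.inp + x.out) (stepState x i S) ∧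
    total (loopBracket w) (stepState x i S) =
      T (tileShift x) * total (loopBracket ((x, i) :: w)) S := by
  induction S with
  | nil => exact ⟨fun a ha => by simp [stepState] at ha, by simp [stepState, total]⟩
  | cons a S ih =>
    obtain ⟨l, P⟩ := a
    obtain ⟨h1, h2⟩ := ih fun b hb => hS b (List.mem_cons_of_mem _ hb)
    obtain ⟨h3, h4⟩ := hS (l, P) List.mem_cons_self
    obtain ⟨h5, h6⟩ := total_stepTerm x i n w l P _ h3 h4 hi h1
    refine ⟨h5, ?_⟩
    rw [stepState, h6, h2, total]
    ring

theorem total_runState (w : List Slice) (n : ℕ) (S : List (List ℕ × List ℤ))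
    (hw : Fits w n 0) (hS : AllPairings n S) :
    total (loopBracket []) (runState w S) = T (wordShift w) * total (loopBracket w) S := by
  induction w generalizing n S with
  | nil => simp [runState, wordShift]
  | cons x w ih =>
    obtain ⟨x, i⟩ := x
    obtain ⟨h1, h2⟩ := hw
    obtain ⟨h3, h4⟩ := total_stepState x i n w S h1 hS
    rw [runState, ih _ _ h2 h3, h4, wordShift, add_comm, T_add, mul_assoc]

theorem polyVal_append_replicate (P : List ℤ) (j : ℕ) :
    polyVal (P ++ List.replicate j 0) = polyVal P := by
  induction P with
  | nil =>
    induction j with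
    | zero => rfl
    | succ j ih => rw [List.nil_append] at ih ⊢; rw [List.replicate_succ, polyVal_shift, ih,
        polyVal, mul_zero]
  | cons c P ih => rw [List.cons_append, polyVal, ih, polyVal]

/-- Division by the loop value is replaced by multiplication: the quotient `Z` is supplied and
checked. The `2` undoes the a² inside `loopList`, and the `j` zeros appear because the computed
lists are not trimmed. -/
theorem loopBracket_eq_polyVal {w : List Slice} (hw : Fits w 0 0) {Z : List ℤ} (j : ℕ)
    (h : runState w [([], [1])] = [([], loopList Z ++ List.replicate j 0)]) :
    loopBracket w id = loopValue * (T (2 - wordShift w) * polyVal Z) := by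
  have hS : AllPairings 0 [([], [1])] := by
    intro a ha
    rw [List.mem_singleton] at ha
    rw [ha]
    exact ⟨rfl, pairing_id⟩
  have h1 := total_runState w 0 _ hw hS
  rw [h, total, total, total, total, polyVal_append_replicate, polyVal_loopList, polyVal, polyVal] at h1
  have h2 : loopBracket [] (lookup []) = 1 := rfl
  rw [h2, show lookup [] = id from rfl] at h1
  have h3 := congrArg (T (-wordShift w) * ·) h1
  simp only [← mul_assoc, ← T_add] at h3
  simp only [map_one, mul_zero, add_zero, mul_one, one_mul, neg_add_cancel, T_zero] at h3
  rw [← h3, sub_eq_neg_add, T_add]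
  ring

theorem extent_polyVal_shift {p q : ℤ} {P : List ℤ} (h : Extent (polyVal P) p q) :
    Extent (polyVal (0 :: P)) (p + 2) (q + 2) := by
  rw [polyVal_shift]
  exact (h.T_mul 2).congr (add_comm _ _) (add_comm _ _)

theorem extent_polyVal_replicate {p q : ℤ} {P : List ℤ} (h : Extent (polyVal P) p q) (j : ℕ) :
    Extent (polyVal (List.replicate j 0 ++ P)) (2 * j + p) (2 * j + q) := by
  induction j with
  | zero => simpa using h
  | succ j ih =>
    rw [List.replicate_succ, List.cons_append]
    exact (extent_polyVal_shift ih).congr (by push_cast; ring) (by push_cast; ring)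

theorem extent_C {e : ℤ} (he : e ≠ 0) : Extent (C e) 0 0 := by
  have e0 : ∀ k : ℤ, (C e : LaurentPolynomial ℤ).coeff k = if k = 0 then e else 0 := fun k => by
    rw [C_apply]
  refine ⟨by rw [e0, if_pos rfl]; exact he, by rw [e0, if_pos rfl]; exact he, fun k hk => ?_⟩
  rw [e0] at hk
  split_ifs at hk with h
  · omega
  · exact absurd rfl hk

theorem extent_polyVal_single {c : ℤ} (hc : c ≠ 0) (k : ℤ) (j : ℕ) :
    Extent (T k * polyVal (List.replicate j 0 ++ [c])) (k + 2 * j) (k + 2 * j) := by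
  have h : Extent (polyVal [c]) 0 0 := by
    rw [polyVal, polyVal, mul_zero, add_zero]
    exact extent_C hc
  exact ((extent_polyVal_replicate h j).T_mul k).congr (by ring) (by ring)

theorem extent_polyVal {c d : ℤ} (hc : c ≠ 0) (hd : d ≠ 0) (k : ℤ) (j : ℕ) (Q : List ℤ) :
    Extent (T k * polyVal (List.replicate j 0 ++ ([c] ++ Q ++ [d]))) (k + 2 * j)
      (k + 2 * j + 2 * Q.length + 2) := by
  have h1 : ∀ Q : List ℤ, ∃ p, 0 ≤ p ∧ Extent (polyVal (Q ++ [d])) p (2 * Q.length) := by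
    intro Q
    induction Q with
    | nil => exact ⟨0, le_rfl, by simpa [polyVal] using extent_C hd⟩
    | cons e Q ih =>
      obtain ⟨p, h1, h2⟩ := ih
      by_cases he : e = 0
      · subst he
        exact ⟨p + 2, by omega,
          (extent_polyVal_shift h2).congr rfl (by push_cast [List.length_cons]; ring)⟩
      · have h3 := (extent_C he).add (h2.T_mul 2) (by omega) (by omega)
        refine ⟨0, le_rfl, h3.congr (by omega) ?_⟩
        rw [List.length_cons]; push_cast; omega
  have h2 : Extent (polyVal ([c] ++ Q ++ [d])) 0 (2 * Q.length + 2) := by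
    obtain ⟨p, h1, h2⟩ := h1 Q
    exact ((extent_C hc).add (h2.T_mul 2) (by omega) (by omega)).congr (by omega) (by omega)
  exact ((extent_polyVal_replicate h2 j).T_mul k).congr (by ring) (by ring)

/-- Evaluation of a polynomial at `1`. -/
theorem ev_one_polyVal (P : List ℤ) : ev (1 : ℤˣ) (polyVal P) = P.sum := by
  induction P with
  | nil => simp [polyVal]
  | cons c P ih =>
    rw [polyVal, map_add, map_mul, ih, eval₂_T, eval₂_C]
    simp

/-! ## Adjacent values of invariants -/

/-- Two values of an invariant are taken at adjacent vertices. -/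
def Joined {V α : Type*} (G : SimpleGraph V) (p : V → α) (a b : α) : Prop :=
  ∃ v w, G.Adj v w ∧ p v = a ∧ p w = b

theorem Joined.symm {V α : Type*} {G : SimpleGraph V} {p : V → α} {a b : α}
    (h : Joined G p a b) : Joined G p b a := by
  obtain ⟨v, w, h, hv, hw⟩ := h
  exact ⟨w, v, h.symm, hw, hv⟩

theorem joined_gordian {α : Type*} {p : Knot → α} {a b : α} {D D' : KnotDiagram}
    (h : D.CrossingChange D') (ha : p D.knot = a) (hb : p D'.knot = b) (hab : a ≠ b) :
    Joined gordian p a b :=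
  ⟨D.knot, D'.knot, ⟨fun e => hab (by rw [← ha, ← hb, e]), D, D', rfl, rfl, h⟩, ha, hb⟩

theorem joined_hTwoGordian {α : Type*} {p : Knot → α} {a b : α} {D D' : KnotDiagram}
    (h : D.Banding D') (ha : p D.knot = a) (hb : p D'.knot = b) (hab : a ≠ b) :
    Joined hTwoGordian p a b :=
  ⟨D.knot, D'.knot, ⟨fun e => hab (by rw [← ha, ← hb, e]), D, D', rfl, rfl, .inl h⟩, ha, hb⟩

theorem odd_ev_mul {x Y : LaurentPolynomial ℤ} (hx : Odd (ev (1 : ℤˣ) x))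
    (hY : Odd (ev (1 : ℤˣ) Y)) : Odd (ev (1 : ℤˣ) (x * Y)) := by
  rw [map_mul]; exact hx.mul hY

/-! ### Determinants -/

theorem KnotDiagram.det_eq_of_bracket {D : KnotDiagram} {x Y : LaurentPolynomial ℤ} {a g : ℤ}
    (h : D.bracket = x * Y) (hx : ‖ev eighthRoot x‖ = |(a : ℝ)|)
    (hY : ‖ev eighthRoot Y‖ = |(g : ℝ)|) : D.knot.det = (a * g).natAbs := by
  have h1 := D.det_eq
  rw [h, map_mul, norm_mul, hx, hY, ← abs_mul, ← Int.cast_mul, ← Int.cast_abs] at h1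
  rw [Int.abs_eq_natAbs, Int.cast_natCast] at h1
  exact_mod_cast h1

theorem exists_closing_det {g : ℤ} (hg : Odd g) : ∃ R Y, Closing R Y ∧ Odd (ev (1 : ℤˣ) Y) ∧
    ‖ev eighthRoot Y‖ = |(g : ℝ)| := by
  obtain ⟨b, x, y, h⟩ := exists_braidValue (p := g) (q := 1) isCoprime_one_right
  refine ⟨_, _, closing_cap.sum h.numerator, ?_, ?_⟩
  · rw [mul_one]; exact h.odd_numerator hg
  · rw [mul_one]; exact h.norm_numerator

theorem exists_factors {n n' : ℕ} (hn : Odd n) : ∃ g a a' : ℤ, (n : ℤ) = a * g ∧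
    (n' : ℤ) = a' * g ∧ IsCoprime a a' := by
  have hn0 : 0 < n := hn.pos
  obtain ⟨g, a, a', hg, hc, h1, h2⟩ := Nat.exists_coprime' (Nat.gcd_pos_of_pos_left n' hn0)
  refine ⟨g, a, a', ?_, ?_, Nat.isCoprime_iff_coprime.2 hc⟩
  · exact_mod_cast h1
  · exact_mod_cast h2

/-- With a and a' the coprime cofactors and p their mean, the pair (p, p - a) is coprime. One more
crossing of either sign yields the numerators p - (p - a) = a and p + (p - a) = a'. -/
theorem joined_gordian_det {n n' : ℕ} (hn : Odd n) (hn' : Odd n') (hne : n ≠ n') :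
    Joined gordian Knot.det n n' := by
  obtain ⟨g, a, a', h1, h2, hc⟩ := exists_factors (n' := n') hn
  have ho : Odd (a * g) := by rw [← h1]; exact_mod_cast hn
  have ho' : Odd (a' * g) := by rw [← h2]; exact_mod_cast hn'
  obtain ⟨ha, hg⟩ := Int.odd_mul.1 ho
  have ha' := (Int.odd_mul.1 ho').1
  obtain ⟨p, hp⟩ := ha.add_odd ha'
  have hq : a' = p + (p - a) := by omega
  have hpa : a = p - (p - a) := by ring
  have hc' : IsCoprime p (p - a) := by
    obtain ⟨u, v, huv⟩ := hc
    exact ⟨u + v, v - u, by rw [← huv]; linear_combination (-v) * hq⟩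
  obtain ⟨b, x, y, hb⟩ := exists_braidValue hc'
  obtain ⟨R, Y, hR, hRo, hRg⟩ := exists_closing_det hg
  have e : ∀ s, (.cup true, 1) :: (b ++ [((.cross s, 1) : Slice)]) ++ [(.cap, 0)] =
      ((.cup true, 1) :: b) ++ [(.cross s, 1)] ++ [(.cap, 0)] := fun s => by simp
  have s1 := (hb.one true).numerator
  have s2 := (hb.one (!true)).numerator
  rw [e] at s1 s2
  obtain ⟨D, D', hD, hx, hx'⟩ := exists_crossingChange_sum s1 s2 hR
    (odd_ev_mul ((hb.one true).odd_numerator (by rw [sgn, if_pos rfl, one_mul, ← hpa]; exact ha)) hRo)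
  refine joined_gordian hD ?_ ?_ hne
  · rw [KnotDiagram.det_eq_of_bracket hx (hb.one true).norm_numerator hRg, sgn, if_pos rfl, one_mul,
      ← hpa, ← h1, Int.natAbs_natCast]
  · rw [KnotDiagram.det_eq_of_bracket hx' (hb.one (!true)).norm_numerator hRg, sgn_not, sgn,
      if_pos rfl, neg_mul, one_mul, sub_neg_eq_add, ← hq, ← h2, Int.natAbs_natCast]

theorem BraidValue.exists_banding {b : List Slice} {x y Y : LaurentPolynomial ℤ} {p q : ℤ}
    {R : List Slice} (h : BraidValue b x y p q) (hR : Closing R Y) (hp : Odd p) (hq : Odd q)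
    (ho : Odd (ev (1 : ℤˣ) Y)) :
    ∃ D D' : KnotDiagram, D.Banding D' ∧ D.bracket = x * Y ∧ D'.bracket = y * Y := by
  refine exists_banding_sum (B₁ := (.cup true, 1) :: b) (B₂ := [(.cap, 0)]) (.saddle 1) ?_
    h.denominator' hR (odd_ev_mul (h.odd_numerator hp) ho) (odd_ev_mul (h.odd_denominator hq) ho)
  rw [List.append_nil]
  exact h.numerator

/-- The cofactors themselves serve as numerator and denominator, and a band move exchanges the two
closures. -/
theorem joined_hTwoGordian_det {n n' : ℕ} (hn : Odd n) (hn' : Odd n') (hne : n ≠ n') :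
    Joined hTwoGordian Knot.det n n' := by
  obtain ⟨g, a, a', h1, h2, hc⟩ := exists_factors (n' := n') hn
  have ho : Odd (a * g) := by rw [← h1]; exact_mod_cast hn
  have ho' : Odd (a' * g) := by rw [← h2]; exact_mod_cast hn'
  obtain ⟨ha, hg⟩ := Int.odd_mul.1 ho
  have ha' := (Int.odd_mul.1 ho').1
  obtain ⟨b, x, y, hb⟩ := exists_braidValue hc
  obtain ⟨R, Y, hR, hRo, hRg⟩ := exists_closing_det hg
  obtain ⟨D, D', hD, hx, hx'⟩ := hb.exists_banding hR ha ha' hRo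
  refine joined_hTwoGordian hD ?_ ?_ hne
  · rw [KnotDiagram.det_eq_of_bracket hx hb.norm_numerator hRg, ← h1, Int.natAbs_natCast]
  · rw [KnotDiagram.det_eq_of_bracket hx' hb.norm_denominator hRg, ← h2, Int.natAbs_natCast]

/-! ### The invariant `β` -/

/-- The summand 1 comes from the loop value, of norm square 3. -/
theorem KnotDiagram.beta_eq_of_normSq {D : KnotDiagram} {x Y : LaurentPolynomial ℤ} {i j : ℕ}
    (h : D.bracket = x * Y) (hx : Complex.normSq (ev rootA x) = 3 ^ i)
    (hY : Complex.normSq (ev rootA Y) = 3 ^ j) : D.knot.beta = i + j + 1 := by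
  have : HasExponent D.word (i + j + 1 : ℕ) := by
    rw [HasExponent, ← D.bracket_eq, h, map_mul, map_mul, map_mul, map_mul, ev_rootA_loopValue, hx,
      hY, Complex.normSq_ofReal, Real.mul_self_sqrt (by norm_num), zpow_natCast]
    ring
  rw [beta_eq_of_hasExponent this]
  push_cast
  ring

theorem normSq_ev_rootA_T (k : ℤ) : Complex.normSq (ev rootA (T k)) = 1 := by
  rw [eval₂_T, Complex.normSq_eq_norm_sq, norm_rootA_zpow, one_pow]

/-- The braid closing to the trefoil. -/
theorem exists_braidValue_trefoil : ∃ x y x' y',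
    BraidValue ([(.cross true, 0), (.cross true, 0)] ++ [(.cross true, 0)]) x y 1 3 ∧
    BraidValue ([(.cross true, 0), (.cross true, 0)] ++ [(.cross (!true), 0)]) x' y' 1 1 ∧
    Complex.normSq (ev rootA x) = 1 ∧ Complex.normSq (ev rootA y) = 3 ∧
    Complex.normSq (ev rootA y') = 1 := by
  have h1 := BraidValue.nil.zero true
  have h2 := h1.cancel_zero true
  have h3 := (h1.zero true).zero true
  refine ⟨_, _, _, _, h3, h2, ?_, ?_, ?_⟩
  · simp only [map_mul, map_neg, Complex.normSq_neg, normSq_ev_rootA_T, mul_one]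
  -- The bracket of the trefoil, a⁻⁷ (1 - a⁴ - a¹²). At the chosen root a⁴ = exp(-iπ/3) and a¹² =
  -- -1, which leaves norm square 3.
  · have e : (T (sgn true) * (T (sgn true) * (T (sgn true) * loopValue + T (-sgn true) * 1) +
        T (-sgn true) * (-T (-3 * sgn true) * 1)) +
        T (-sgn true) * (-T (-3 * sgn true) * (-T (-3 * sgn true) * 1)) : LaurentPolynomial ℤ) =
        T (-7) * (1 - T 2 * T 2 - (T 2 * T 2) * (T 2 * T 2) * (T 2 * T 2)) := by
      simp only [sgn, if_true, loopValue, mul_add, mul_sub, mul_neg, neg_mul, mul_one, ← T_add]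
      norm_num
      abel
    rw [e, map_mul, map_mul, normSq_ev_rootA_T, one_mul]
    simp only [map_sub, map_mul, map_one, eval₂_T, rootA_sq]
    have h3 := rootThree_sq
    have e4 : (-(rootThree / 2) + 1 / 2 * Complex.I) * (-(rootThree / 2) + 1 / 2 * Complex.I) =
        1 / 2 - rootThree / 2 * Complex.I := by
      linear_combination (1 / 4 : ℂ) * h3 + (1 / 4 : ℂ) * Complex.I_mul_I
    have e12 : (1 / 2 - rootThree / 2 * Complex.I) * (1 / 2 - rootThree / 2 * Complex.I) *
        (1 / 2 - rootThree / 2 * Complex.I) = -1 := by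
      linear_combination (3 / 8 - rootThree * Complex.I / 8) * (Complex.I_mul_I * rootThree ^ 2) -
        (3 / 8 - rootThree * Complex.I / 8) * h3
    rw [e4, e12, show (1 : ℂ) - (1 / 2 - rootThree / 2 * Complex.I) - -1 =
      ((3 / 2 : ℝ) : ℂ) + ((Real.sqrt 3 / 2 : ℝ) : ℂ) * Complex.I by push_cast; ring,
      Complex.normSq_add_mul_I, div_pow, div_pow, Real.sq_sqrt (by norm_num)]
    norm_num
  · have := curl_coeff (!true)
    rw [sgn_not, neg_neg] at this
    rw [mul_one, add_comm, this, map_neg, Complex.normSq_neg, normSq_ev_rootA_T]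

/-- Each trefoil summand multiplies the norm square by 3. -/
theorem exists_closing_beta (n : ℕ) : ∃ R Y, Closing R Y ∧ Odd (ev (1 : ℤˣ) Y) ∧
    Complex.normSq (ev rootA Y) = 3 ^ n := by
  induction n with
  | zero => exact ⟨_, _, closing_cap, by simp, by simp⟩
  | succ n ih =>
    obtain ⟨R, Y, h1, h2, h3⟩ := ih
    obtain ⟨x, y, x', y', hb, -, -, hy, -⟩ := exists_braidValue_trefoil
    refine ⟨_, _, h1.sum hb.denominator, odd_ev_mul (hb.odd_denominator (by decide)) h2, ?_⟩
    rw [map_mul, map_mul, hy, h3]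
    ring

theorem joined_gordian_beta (n : ℕ) : Joined gordian Knot.beta (n + 1) (n + 2) := by
  obtain ⟨R, Y, h1, h2, h3⟩ := exists_closing_beta n
  obtain ⟨x, y, x', y', hb, hb', -, hy, hy'⟩ := exists_braidValue_trefoil
  have s1 := hb.denominator
  have s2 := hb'.denominator
  rw [← List.cons_append] at s1 s2
  obtain ⟨D, D', hD, e, e'⟩ :=
    exists_crossingChange_sum s1 s2 h1 (odd_ev_mul (hb.odd_denominator (by decide)) h2)
  refine (joined_gordian hD ?_ ?_ (by norm_num)).symm
  · rw [KnotDiagram.beta_eq_of_normSq e (i := 1) (by rw [hy, pow_one]) h3]; push_cast; ring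
  · rw [KnotDiagram.beta_eq_of_normSq e' (i := 0) (by rw [hy', pow_zero]) h3]; push_cast; ring

/-- The two closures of the trefoil braid have norm squares 1 and 3, and a band move exchanges them
next to `n` further trefoils. -/
theorem joined_hTwoGordian_beta (n : ℕ) : Joined hTwoGordian Knot.beta (n + 1) (n + 2) := by
  obtain ⟨R, Y, h1, h2, h3⟩ := exists_closing_beta n
  obtain ⟨x, y, x', y', hb, hb', hx, hy, hy'⟩ := exists_braidValue_trefoil
  obtain ⟨D, D', hD, e, e'⟩ := hb.exists_banding h1 (by decide) (by decide) h2
  refine joined_hTwoGordian hD ?_ ?_ (by norm_num)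
  · rw [KnotDiagram.beta_eq_of_normSq e (i := 0) (by rw [hx, pow_zero]) h3]; push_cast; ring
  · rw [KnotDiagram.beta_eq_of_normSq e' (i := 1) (by rw [hy, pow_one]) h3]; push_cast; ring

theorem exists_nat_add {c s : ℤ} (h : c ≤ s) : ∃ m : ℕ, s = m + c := ⟨(s - c).toNat, by omega⟩

/-! ### Spans -/

theorem KnotDiagram.span_eq_of_bracket {D : KnotDiagram} {x Y : LaurentPolynomial ℤ}
    {α A β B d : ℤ} (h : D.bracket = x * Y) (hx : Extent x α A) (hY : Extent Y β B)
    (hd : A - α + (B - β) = 4 * d) : D.knot.span = d :=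
  KnotDiagram.span_eq (h ▸ hx.mul hY) (by linarith)

/-- The first closure of the alternating braid `σ₀ᵉ σ₁⁻ᵐ`. -/
theorem exists_alternating (e m : ℕ) : ∃ x y,
    Alternating (List.replicate (e + 2) (.cross true, 0) ++ List.replicate (m + 1) (.cross false, 1))
      x y (-3 * e - m - 7) (e + 3 * m + 5) (-3 * e + 3 * m - 1) (e + 3 * m + 7)
      (1 + (m + 1) * (e + 2)) (e + 2) := by
  obtain ⟨x, y, h⟩ := Alternating.twist e
  obtain ⟨x', y', h'⟩ := h.ones m
  exact ⟨x', y', h'.congr (by ring) (by ring) (by ring) (by ring) (by ring) rfl⟩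

theorem summand_nil : Summand [] 1 where
  fits _ _ := rfl
  loopBracket_eq _ _ _ _ _ := (one_mul _).symm

/-- The closure of σ₀² σ₁⁻⁽ᵐ⁺¹⁾ is alternating with `m + 3` crossings, and its span is that number.
-/
theorem exists_summand_span {s : ℤ} (hs : s = 0 ∨ 3 ≤ s) : ∃ B x α A, Summand B x ∧
    Odd (ev (1 : ℤˣ) x) ∧ Extent x α A ∧ A - α = 4 * s := by
  rcases hs with rfl | hs
  · exact ⟨_, _, _, _, summand_nil, by simp, Extent.one, by norm_num⟩
  · obtain ⟨m, rfl⟩ := exists_nat_add (c := 3) (s := s) (by omega)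
    obtain ⟨x, y, h⟩ := exists_alternating 0 m
    exact ⟨_, _, _, _, h.value.numerator, h.value.odd_numerator ⟨m + 1, by push_cast; ring⟩,
      h.extents.extent_x, by push_cast; ring⟩

theorem exists_closing_span {s : ℤ} (hs : s = 0 ∨ 3 ≤ s) : ∃ R Y β B, Closing R Y ∧
    Odd (ev (1 : ℤˣ) Y) ∧ Extent Y β B ∧ B - β = 4 * s := by
  obtain ⟨B, x, α, A, h, ho, hx, hd⟩ := exists_summand_span hs
  exact ⟨_, x, _, _, (mul_one x) ▸ closing_cap.sum h, ho, hx, hd⟩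

theorem Extent.eq_T_mul {u : LaurentPolynomial ℤ} {k : ℤ} (h : Extent u k k) (j : ℤ) :
    ∃ k', Extent (-LaurentPolynomial.T j * u) k' k' := by
  rw [neg_mul]
  exact ⟨_, (h.T_mul j).neg⟩

/-- The third braid strand carries a curl only: since `y` is the loop value times `x`, both terms of
the skein relation combine to a unit multiple, so `x` stays a monomial. -/
theorem BraidValue.ones_of_split {b : List Slice} {u : LaurentPolynomial ℤ} {p k : ℤ}
    (h : BraidValue b u (loopValue * u) p 0) (hu : Extent u k k) (m : ℕ) : ∃ u' k',
    BraidValue (b ++ List.replicate m (.cross false, 1)) u' (loopValue * u') p 0 ∧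
      Extent u' k' k' := by
  induction m with
  | zero => exact ⟨u, k, by simpa using h, hu⟩
  | succ m ih =>
    obtain ⟨u', k', h', hu'⟩ := ih
    have h1 := h'.one false
    have e : (T (sgn false) * u' + T (-sgn false) * (loopValue * u') : LaurentPolynomial ℤ) =
        -T (-3 * sgn false) * u' := by
      rw [← curl_coeff]; ring
    rw [e, mul_zero, sub_zero, mul_left_comm, List.append_assoc, ← List.replicate_succ'] at h1
    obtain ⟨k'', hk⟩ := hu'.eq_T_mul (-3 * sgn false)
    exact ⟨_, _, h1, hk⟩

/-- A change of a crossing in a braid, in the presence of a further summand. -/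
theorem exists_crossingChange_braid {b c R : List Slice} {x y x' y' Y : LaurentPolynomial ℤ}
    {p q p' q' : ℤ} (h : BraidValue (b ++ [(.cross true, 0)] ++ c) x y p q)
    (h' : BraidValue (b ++ [(.cross (!true), 0)] ++ c) x' y' p' q') (hR : Closing R Y)
    (hp : Odd p) (ho : Odd (ev (1 : ℤˣ) Y)) :
    ∃ D D' : KnotDiagram, D.CrossingChange D' ∧ D.bracket = x * Y ∧ D'.bracket = x' * Y := by
  have e : ∀ s, (.cup true, 1) :: (b ++ [((.cross s, 0) : Slice)] ++ c) ++ [(.cap, 0)] =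
      ((.cup true, 1) :: b) ++ [(.cross s, 0)] ++ (c ++ [(.cap, 0)]) := fun s => by simp
  have s1 := h.numerator
  have s2 := h'.numerator
  rw [e] at s1 s2
  exact exists_crossingChange_sum s1 s2 hR (odd_ev_mul (h.odd_numerator hp) ho)

/-- Changing one of the two crossings σ₀² cancels both. What remains is a power of σ₁, that is a
chain of curls, so the summand of span `k` becomes trivial. -/
theorem joined_gordian_span_add {s k : ℤ} (hs : s = 0 ∨ 3 ≤ s) (hk : 3 ≤ k) :
    Joined gordian Knot.span s (s + k) := by
  obtain ⟨m, rfl⟩ := exists_nat_add (c := 3) (s := k) (by omega)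
  obtain ⟨R, Y, β, B, hR, ho, hY, hd⟩ := exists_closing_span hs
  obtain ⟨x, y, h⟩ := exists_alternating 0 m
  have h0 := BraidValue.nil
  rw [← mul_one loopValue] at h0
  obtain ⟨u, j, h', hu⟩ := (h0.cancel_zero true).ones_of_split Extent.one (m + 1)
  obtain ⟨D, D', hD, e, e'⟩ := exists_crossingChange_braid (b := [(.cross true, 0)]) h.value h' hR
    ⟨m + 1, by push_cast; ring⟩ ho
  refine (joined_gordian hD ?_ ?_ (by omega)).symm
  · exact KnotDiagram.span_eq_of_bracket e h.extents.extent_x hY (by rw [hd]; push_cast; ring)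
  · exact KnotDiagram.span_eq_of_bracket e' hu hY (by rw [hd]; ring)

/-- A crossing change turns σ₀⁴ into σ₀² in an alternating braid and so removes two crossings. -/
theorem joined_gordian_span_add_two {s : ℤ} (hs : 3 ≤ s) :
    Joined gordian Knot.span s (s + 2) := by
  obtain ⟨m, rfl⟩ := exists_nat_add (c := 3) (s := s) (by omega)
  obtain ⟨x, y, h⟩ := exists_alternating 2 m
  obtain ⟨x₀, y₀, h₀⟩ := Alternating.twist 0
  obtain ⟨x', y', h'⟩ :=
    Alternating.ones ⟨h₀.value.cancel_zero true, h₀.extents⟩ m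
  obtain ⟨D, D', hD, e, e'⟩ := exists_crossingChange_braid
    (b := List.replicate 2 (.cross true, 0) ++ [(.cross true, 0)]) h.value h'.value closing_cap
    ⟨2 * m + 2, by push_cast; ring⟩ (by simp)
  refine (joined_gordian hD ?_ ?_ (by omega)).symm
  · exact KnotDiagram.span_eq_of_bracket e h.extents.extent_x Extent.one (by push_cast; ring)
  · exact KnotDiagram.span_eq_of_bracket e' h'.extents.extent_x Extent.one (by push_cast; ring)

theorem Alternating.joined_span {b : List Slice} {x y : LaurentPolynomial ℤ} {α A β B p q s s' : ℤ}
    (h : Alternating b x y α A β B p q) (hp : Odd p) (hq : Odd q) (hs : A - α = 4 * s)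
    (hs' : B - β = 4 * s') (hne : s ≠ s') : Joined hTwoGordian Knot.span s s' := by
  obtain ⟨D, D', hD, e, e'⟩ := h.value.exists_banding closing_cap hp hq (by simp)
  exact joined_hTwoGordian hD
    (KnotDiagram.span_eq_of_bracket e h.extents.extent_x Extent.one (by linarith))
    (KnotDiagram.span_eq_of_bracket e' h.extents.extent_y Extent.one (by linarith)) hne

/-- One closure of a power of σ₀ is a chain of curls, of span 0; the other has span equal to the
exponent and is a knot when that is odd. -/
theorem joined_hTwoGordian_span_zero_odd {n : ℤ} (hn : 3 ≤ n) (ho : Odd n) :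
    Joined hTwoGordian Knot.span 0 n := by
  obtain ⟨e, rfl⟩ := exists_nat_add (c := 2) (s := n) (by omega)
  obtain ⟨x, y, h⟩ := Alternating.twist e
  exact h.joined_span odd_one ho (by ring) (by ring) (by omega)

/-- In σ₀² σ₁⁻⁽ᵐ⁺¹⁾ σ₀ᵖ the last factor only adds curls to the first closure, which keeps span `s`,
and adds `p` crossings to the second. Oddness of `p` makes the second closure a knot. -/
theorem joined_hTwoGordian_span_add_odd {s p : ℤ} (hs : 3 ≤ s) (hp : 0 < p) (ho : Odd p) :
    Joined hTwoGordian Knot.span s (s + p) := by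
  obtain ⟨m, rfl⟩ := exists_nat_add (c := 3) (s := s) (by omega)
  obtain ⟨e, rfl⟩ := exists_nat_add (c := 1) (s := p) (by omega)
  obtain ⟨x, y, h⟩ := exists_alternating 0 m
  obtain ⟨x', y', h'⟩ := h.zeros e
  have h1 : Odd (1 + ((m : ℤ) + 1) * ((0 : ℕ) + 2)) := ⟨m + 1, by push_cast; ring⟩
  refine h'.joined_span h1 ?_ (by push_cast; ring) (by push_cast; ring) (by omega)
  rw [add_comm, Nat.cast_zero, zero_add]
  exact (ho.mul h1).add_even even_two

/-- Here the last factor is σ₁⁻ᵖ, which adds curls to the second closure and `p` crossings to the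
first. For odd `s` it follows σ₀ˢ; for even `s` the start σ₀⁽ˢ⁻²⁾ σ₁⁻¹ σ₀ is used instead, so that
both closures are knots. -/
theorem joined_hTwoGordian_span_add_even {s p : ℤ} (hs : 3 ≤ s) (hp : 0 < p) (he : Even p) :
    Joined hTwoGordian Knot.span s (s + p) := by
  obtain ⟨k, rfl⟩ := exists_nat_add (c := 1) (s := p) (by omega)
  rcases Int.even_or_odd s with hs' | hs'
  · obtain ⟨m, rfl⟩ := exists_nat_add (c := 4) (s := s) (by obtain ⟨r, hr⟩ := hs'; omega)
    have hm : Even (m : ℤ) := by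
      have := hs'.sub (show Even (4 : ℤ) by decide)
      simpa using this
    obtain ⟨x, y, h⟩ := exists_alternating m 0
    obtain ⟨x', y', h'⟩ := h.zero.ones k
    have h2 : Odd (1 + (((0 : ℕ) : ℤ) + 1) * (m + 2)) := by
      rw [Nat.cast_zero, zero_add, one_mul]
      exact odd_one.add_even (hm.add even_two)
    have h3 : Odd ((m + 2 : ℤ) + (1 + (((0 : ℕ) : ℤ) + 1) * (m + 2))) := (hm.add even_two).add_odd h2
    exact (h'.joined_span (h2.add_even (he.mul_right _)) h3 (s := m + 4 + (k + 1)) (s' := m + 4)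
      (by push_cast; ring) (by push_cast; ring) (by omega)).symm
  · obtain ⟨m, rfl⟩ := exists_nat_add (c := 2) (s := s) (by omega)
    obtain ⟨x, y, h⟩ := exists_alternating m k
    exact (h.joined_span (odd_one.add_even (he.mul_right _)) hs' (s := m + 2 + (k + 1))
      (s' := m + 2) (by ring) (by ring) (by omega)).symm

/-! ### Explicit diagrams -/

/-- The tangle between two columns with two and three crossings, with two strands at the place of a
third column. -/
def pretzelBase : List Slice :=
  [(.cup true, 0), (.cup true, 0), (.cup true, 1), (.cup true, 3), (.cross true, 2),
    (.cross true, 2), (.cross false, 4), (.cross false, 4), (.cross false, 4), (.cap, 5), (.cap, 3)]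

theorem fits_pretzelBase : Fits pretzelBase 0 4 := by
  simp [pretzelBase, Fits, Tile.inp, Tile.out]

theorem fits_zero_cross (s : Bool) : Fits [(.cross s, 0)] 4 4 := by
  simp [Fits, Tile.inp, Tile.out]

theorem fits_caps {i : ℕ} (hi : i ≤ 2) : Fits [(.cap, i), (.cap, 0)] 4 0 := by
  simpa [Fits, Tile.inp, Tile.out] using hi

theorem fits_pretzelBase_twice :
    Fits (pretzelBase ++ [(.cross true, 0)] ++ [(.cross true, 0)]) 0 4 :=
  (fits_pretzelBase.append (fits_zero_cross _)).append (fits_zero_cross _)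

theorem loopBracket_pretzel_two_horizontal : loopBracket (pretzelBase ++ [(.cross true, 0)] ++
    [(.cross true, 0)] ++ [(.cap, 0), (.cap, 0)]) id =
      loopValue * (T (-27) * polyVal (List.replicate 9 0 ++ [-1])) :=
  loopBracket_eq_polyVal (fits_pretzelBase_twice.append (fits_caps (by norm_num)))
    10 (by decide +kernel)

theorem loopBracket_pretzel_two : loopBracket (pretzelBase ++ [(.cross true, 0)] ++
    [(.cross true, 0)] ++ [(.cap, 1), (.cap, 0)]) id =
      loopValue * (T (-27) * polyVal (List.replicate 10 0 ++
        ([2] ++ [0, -1, 0, 2, 0, -1, 0, 1, 0] ++ [-1]))) :=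
  loopBracket_eq_polyVal (fits_pretzelBase_twice.append (fits_caps (by norm_num)))
    0 (by decide +kernel)

theorem loopBracket_pretzel_three : loopBracket (pretzelBase ++ [(.cross true, 0)] ++
    [(.cross true, 0)] ++ [(.cross true, 0)] ++ [(.cap, 1), (.cap, 0)]) id =
      loopValue * (T (-30) * polyVal (List.replicate 10 0 ++
        ([-1] ++ [0, 2, 0, -1, 0, 2, 0, -1, 0, 1, 0] ++ [-1]))) :=
  loopBracket_eq_polyVal ((fits_pretzelBase_twice.append (fits_zero_cross _)).append
    (fits_caps (by norm_num))) 0 (by decide +kernel)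

theorem loopBracket_pretzel_one : loopBracket (pretzelBase ++ [(.cross true, 0)] ++
    [(.cross true, 0)] ++ [(.cross (!true), 0)] ++ [(.cap, 1), (.cap, 0)]) id =
      loopValue * (T (-30) * polyVal (List.replicate 11 0 ++
        ([1] ++ [0, -1, 0, 2, 0, -1, 0, 1, 0] ++ [-1]))) :=
  loopBracket_eq_polyVal ((fits_pretzelBase_twice.append (fits_zero_cross _)).append
    (fits_caps (by norm_num))) 0 (by decide +kernel)

/-- This pair lies outside the other families: a summand would need span 2. The third pretzel column
passes from three crossings to one. -/
theorem joined_gordian_span_five_six : Joined gordian Knot.span 5 6 := by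
  have h : Presents _ _ := ⟨(fits_pretzelBase_twice.append (fits_zero_cross _)).append
    (fits_caps (by norm_num)), loopBracket_pretzel_three, by
      rw [map_mul, eval₂_T, ev_one_polyVal, one_zpow, Units.val_one, one_mul]; decide⟩
  obtain ⟨D, D', hD, e, e'⟩ := h.exists_crossingChange loopBracket_pretzel_one
  refine (joined_gordian hD ?_ ?_ (by norm_num)).symm
  · exact KnotDiagram.span_eq (e ▸ extent_polyVal (by norm_num) (by norm_num) _ _ _)
      (by simp)
  · exact KnotDiagram.span_eq (e' ▸ extent_polyVal (by norm_num) (by norm_num) _ _ _)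
      (by simp)

/-! ### A pretzel family with a trivial horizontal resolution -/

/-- The word `u` leaves four strands, which can be joined by maxima in two ways. -/
structure TwoClosures (u : List Slice) (x y : LaurentPolynomial ℤ) : Prop where
  fits : Fits u 0 4
  zero_eq : loopBracket (u ++ [(.cap, 0), (.cap, 0)]) id = loopValue * x
  one_eq : loopBracket (u ++ [(.cap, 1), (.cap, 0)]) id = loopValue * y

theorem TwoClosures.cross {u : List Slice} {x y : LaurentPolynomial ℤ} (h : TwoClosures u x y)
    (s : Bool) : TwoClosures (u ++ [(.cross s, 0)]) (-T (-3 * sgn s) * x)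
      (T (sgn s) * y + T (-sgn s) * x) where
  fits := h.fits.append (fits_zero_cross s)
  zero_eq := by
    rw [List.append_assoc]
    change loopBracket (u ++ (.cross s, 0) :: (.cap, 0) :: [(.cap, 0)]) id = _
    rw [loopBracket_scalar (fun m hm => loopBracket_cross_cap s [(.cap, 0)] hm (by norm_num))
      h.fits pairing_id, h.zero_eq]
    ring
  one_eq := by
    rw [List.append_assoc]
    change loopBracket (u ++ (.cross s, 0) :: (.cap, 0 + 1) :: [(.cap, 0)]) id = _
    rw [loopBracket_linear (fun m hm => loopBracket_cross_cap_right s [(.cap, 0)] hm (by norm_num))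
      h.fits pairing_id, h.zero_eq, h.one_eq]
    ring

/-- Resolving the last crossing horizontally leaves a zigzag, hence the closure `x`. The parities
make both ends of the move knots. -/
theorem TwoClosures.exists_banding {u : List Slice} {x y : LaurentPolynomial ℤ}
    (h : TwoClosures u x y) (s : Bool) (hx : Odd (ev (1 : ℤˣ) x))
    (hy : Even (ev (1 : ℤˣ) y)) : ∃ D D' : KnotDiagram, D.Banding D' ∧
      D.bracket = T (sgn s) * y + T (-sgn s) * x ∧ D'.bracket = x := by
  have h' := h.cross s
  have p : Presents (u ++ [(.cross s, 0)] ++ [(.cap, 1), (.cap, 0)]) _ :=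
    ⟨h'.fits.append (fits_caps (by norm_num)), h'.one_eq, by
      rw [map_add, map_mul, map_mul, eval₂_T, eval₂_T]
      simpa using hy.add_odd hx⟩
  refine p.exists_banding (.resolve_horizontal s 0) ⟨?_, ?_, hx⟩
  · exact (h.fits.append (by simp [Fits, Tile.inp, Tile.out])).append (fits_caps (by norm_num))
  · rw [← h.zero_eq, List.append_assoc]
    have := loopBracket_scalar (v := (.cap, 0) :: (.cup true, 0) :: (.cap, 0 + 1) :: [(.cap, 0)])
      (v' := [(.cap, 0), (.cap, 0)]) (c := 1) (n' := 4) (fun m hm => by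
        rw [one_mul]
        exact cap_congr 0 4 _ _ m hm (by norm_num) fun n' m' hn' hm' =>
          cup_zig 0 n' _ m' hm' (by omega)) h.fits pairing_id
    rw [one_mul] at this
    exact this

/-- The third column has `j + 2` crossings. The closure `x` is a monomial throughout, while the
extents of `y` grow by the alternating recursion from the values computed for `j = 0`. -/
theorem exists_twoClosures (j : ℕ) : ∃ u x y β, TwoClosures u x y ∧
    Extents x y (-9 - 3 * j) (-9 - 3 * j) β (13 + j) ∧ Odd (ev (1 : ℤˣ) x) ∧
    2 ∣ ev (1 : ℤˣ) y - j := by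
  induction j with
  | zero =>
    refine ⟨_, _, _, -7, ⟨fits_pretzelBase_twice, loopBracket_pretzel_two_horizontal,
      loopBracket_pretzel_two⟩, ⟨?_, ?_, ?_, ?_⟩, ?_, ?_⟩
    · exact (extent_polyVal_single (by norm_num) _ _).congr (by norm_num) (by norm_num)
    · exact (extent_polyVal (by norm_num) (by norm_num) _ _ _).congr (by norm_num) (by norm_num)
    · norm_num
    · norm_num
    · rw [map_mul, eval₂_T, ev_one_polyVal, one_zpow, Units.val_one, one_mul]; decide
    · rw [map_mul, eval₂_T, ev_one_polyVal, one_zpow, Units.val_one, one_mul]; decide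
  | succ j ih =>
    obtain ⟨u, x, y, β, h, he, hx, hy⟩ := ih
    refine ⟨_, _, _, _, h.cross true, he.zero.congr ?_ ?_ rfl ?_, ?_, ?_⟩
    · push_cast; ring
    · push_cast; ring
    · push_cast; ring
    · rw [map_mul, map_neg, eval₂_T]
      simpa using hx
    · rw [map_add, map_mul, map_mul, eval₂_T, eval₂_T]
      simp only [one_zpow, Units.val_one, one_mul]
      obtain ⟨r, hr⟩ := hx
      push_cast
      omega

/-- The member with index `j = n - 6` is used; one more crossing in the column gives the knot of
span `n`. -/
theorem joined_hTwoGordian_span_zero_even {n : ℤ} (hn : 6 ≤ n) (he : Even n) :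
    Joined hTwoGordian Knot.span 0 n := by
  obtain ⟨j, rfl⟩ := exists_nat_add (c := 6) (s := n) hn
  obtain ⟨u, x, y, β, h, hE, hx, hy⟩ := exists_twoClosures j
  obtain ⟨D, D', hD, e, e'⟩ := h.exists_banding true hx (by
    rw [Int.even_iff] at he ⊢
    omega)
  refine (joined_hTwoGordian hD ?_ ?_ (by omega)).symm
  · exact KnotDiagram.span_eq (e ▸ hE.zero.extent_y) (by ring)
  · exact KnotDiagram.span_eq (e' ▸ hE.extent_x) (by ring)

/-! ### A crossing change raising the span from three to four -/

/-- A closed braid on four strands, up to its third crossing. -/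
def braidBase : List Slice :=
  [(.cup true, 1), (.cup true, 2), (.cup true, 3), (.cross true, 2), (.cross false, 1)]

/-- A closed braid on four strands, from its fourth crossing on. -/
def braidTop : List Slice :=
  [(.cross false, 1), (.cross false, 0), (.cross true, 1), (.cross true, 1), (.cross true, 2),
    (.cross true, 2), (.cross true, 1), (.cross false, 0), (.cap, 3), (.cap, 2), (.cap, 1),
    (.cap, 0)]

theorem fits_braid (s : Bool) : Fits (braidBase ++ [(.cross s, 2)] ++ braidTop) 2 0 := by
  simp [braidBase, braidTop, Fits, Tile.inp, Tile.out]

theorem fits_cup_braid (s : Bool) :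
    Fits ((.cup true, 0) :: (braidBase ++ [(.cross s, 2)] ++ braidTop)) 0 0 :=
  ⟨le_rfl, fits_braid s⟩

theorem closing_braid_span_three : Closing (braidBase ++ [(.cross false, 2)] ++ braidTop)
    (T (-39) * polyVal (List.replicate 13 0 ++ ([1] ++ [0, -1, 0, 0, 0] ++ [-1]))) :=
  ⟨fits_braid _, loopBracket_eq_polyVal (fits_cup_braid _) 8 (by decide +kernel)⟩

theorem closing_braid_span_four : Closing (braidBase ++ [(.cross (!false), 2)] ++ braidTop)
    (T (-39) * polyVal (List.replicate 20 0 ++ ([-1] ++ [0, 1, 0, -1, 0, 1, 0] ++ [-1]))) :=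
  ⟨fits_braid _, loopBracket_eq_polyVal (fits_cup_braid _) 0 (by decide +kernel)⟩

/-- The four-strand pair is summed with a fixed knot of span `s - 3`, which must itself be 0 or at
least 3. This is why 4 and 5 are missing. -/
theorem joined_gordian_span_add_one {s : ℤ} (hs : s = 3 ∨ 6 ≤ s) :
    Joined gordian Knot.span s (s + 1) := by
  obtain ⟨B, x, α, A, hB, ho, hx, hd⟩ := exists_summand_span (s := s - 3) (by omega)
  have h1 := closing_braid_span_three.sum hB
  have h2 := closing_braid_span_four.sum hB
  have p := h1.presents (odd_ev_mul ho (by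
    rw [map_mul, eval₂_T, ev_one_polyVal, one_zpow, Units.val_one, one_mul]; decide))
  have e : ∀ t, (.cup true, 0) :: (B ++ (braidBase ++ [((.cross t, 2) : Slice)] ++ braidTop)) =
      ((.cup true, 0) :: B ++ braidBase) ++ [(.cross t, 2)] ++ braidTop := fun t => by simp
  rw [e] at p
  obtain ⟨D, D', hD, e, e'⟩ := p.exists_crossingChange (by rw [← e]; exact h2.loopBracket_eq)
  refine joined_gordian hD ?_ ?_ (by omega)
  · exact KnotDiagram.span_eq_of_bracket e hx (extent_polyVal (by norm_num) (by norm_num) _ _ _)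
      (by rw [hd]; simp; ring)
  · exact KnotDiagram.span_eq_of_bracket e' hx (extent_polyVal (by norm_num) (by norm_num) _ _ _)
      (by rw [hd]; simp; ring)

/-! ## Metric graphs -/

namespace MetricGraph

variable {V : Type*} {G : SimpleGraph V}

open Classical in
/-- A point is a vertex or lies in the interior of an edge. -/
theorem support_cases (x : MetricGraph G) :
    (∃ u, x.weight.support = {u} ∧ x.weight u = 1) ∨
    ∃ u v, G.Adj u v ∧ x.weight.support = {u, v} ∧ 0 < x.weight u ∧ 0 < x.weight v ∧
      x.weight u + x.weight v = 1 := by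
  obtain ⟨u, v, huv, hs⟩ := x.support_subset
  have hsum := x.sum_eq_one
  have single : ∀ w, x.weight.support = {w} →
      ∃ u, x.weight.support = {u} ∧ x.weight u = 1 := fun w hw => by
    refine ⟨w, hw, ?_⟩
    rw [Finsupp.sum, hw, Finset.sum_singleton] at hsum
    exact hsum
  have hne : x.weight.support.Nonempty := by
    rw [Finset.nonempty_iff_ne_empty]
    intro h
    rw [Finsupp.sum, h, Finset.sum_empty] at hsum
    exact zero_ne_one hsum
  have hs' : x.weight.support ⊆ {u, v} := by
    intro w hw
    simpa using hs (Finset.mem_coe.2 hw)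
  by_cases hu : u ∈ x.weight.support
  · by_cases hv : v ∈ x.weight.support
    · have he : x.weight.support = {u, v} := by
        refine Finset.Subset.antisymm hs' ?_
        intro w hw
        rcases Finset.mem_insert.1 hw with rfl | hw
        · exact hu
        · rw [Finset.mem_singleton.1 hw]; exact hv
      rcases huv with rfl | huv
      · exact .inl (single u (by simpa using he))
      · refine .inr ⟨u, v, huv, he, ?_, ?_, ?_⟩
        · exact lt_of_le_of_ne (x.nonneg u) (Finsupp.mem_support_iff.1 hu).symm
        · exact lt_of_le_of_ne (x.nonneg v) (Finsupp.mem_support_iff.1 hv).symm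
        · rw [Finsupp.sum, he, Finset.sum_pair huv.ne] at hsum
          exact hsum
    · refine .inl (single u (Finset.eq_singleton_iff_unique_mem.2 ⟨hu, fun w hw => ?_⟩))
      rcases Finset.mem_insert.1 (hs' hw) with h | h
      · exact h
      · exact absurd (Finset.mem_singleton.1 h ▸ hw) hv
  · refine .inl (single v (Finset.eq_singleton_iff_unique_mem.2 ?_))
    have : ∀ w ∈ x.weight.support, w = v := fun w hw => by
      rcases Finset.mem_insert.1 (hs' hw) with h | h
      · exact absurd (h ▸ hw) hu
      · exact Finset.mem_singleton.1 h
    obtain ⟨w, hw⟩ := hne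
    exact ⟨this w hw ▸ hw, this⟩

theorem weight_le_one (x : MetricGraph G) (v : V) : x.weight v ≤ 1 := by
  by_cases hv : v ∈ x.weight.support
  · rw [← x.sum_eq_one]
    exact Finset.single_le_sum (f := fun v => x.weight v) (fun v _ => x.nonneg v) hv
  · rw [Finsupp.notMem_support_iff.1 hv]; exact zero_le_one

/-- The length of a path from `x` to `y` through the vertices `u` and `w`. -/
theorem term_nonneg (x y : MetricGraph G) (u w : V) :
    0 ≤ (1 - x.weight u) + (G.dist u w : ℝ) + (1 - y.weight w) := by
  have h1 := x.weight_le_one u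
  have h2 := y.weight_le_one w
  have h3 : (0 : ℝ) ≤ G.dist u w := Nat.cast_nonneg _
  linarith

theorem dist_nonneg (x y : MetricGraph G) : 0 ≤ dist x y := by
  rw [dist]
  split_ifs
  · exact div_nonneg (Finset.sum_nonneg fun _ _ => abs_nonneg _) zero_le_two
  · exact Real.iInf_nonneg fun p => term_nonneg x y _ _

theorem dist_le {x y : MetricGraph G} (h : ¬OnCommonEdge x y) {u w : V}
    (hu : u ∈ x.weight.support) (hw : w ∈ y.weight.support) :
    dist x y ≤ (1 - x.weight u) + (G.dist u w : ℝ) + (1 - y.weight w) := by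
  rw [dist, if_neg h]
  exact ciInf_le (f := fun p : x.weight.support × y.weight.support =>
      (1 - x.weight p.1) + (G.dist (p.1 : V) (p.2 : V) : ℝ) + (1 - y.weight p.2))
    ⟨0, by rintro _ ⟨p, rfl⟩; exact term_nonneg x y _ _⟩ (⟨u, hu⟩, ⟨w, hw⟩)

theorem dist_eq_of_onCommonEdge {x y : MetricGraph G} {u v : V} (huv : G.Adj u v)
    (hx : (x.weight.support : Set V) ⊆ {u, v}) (hy : (y.weight.support : Set V) ⊆ {u, v}) :
    x.weight u + x.weight v = 1 ∧ y.weight u + y.weight v = 1 ∧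
      dist x y = |x.weight u - y.weight u| := by
  classical
  have sub : ∀ z : V →₀ ℝ, (z.support : Set V) ⊆ {u, v} → z.support ⊆ {u, v} := fun z hz w hw => by
    simpa using hz (Finset.mem_coe.2 hw)
  have total : ∀ z : MetricGraph G, (z.weight.support : Set V) ⊆ {u, v} →
      z.weight u + z.weight v = 1 := fun z hz => by
    rw [← z.sum_eq_one, Finsupp.sum_of_support_subset _ (sub _ hz) _ (fun _ _ => rfl),
      Finset.sum_pair huv.ne]
  have e1 := total x hx
  have e2 := total y hy
  refine ⟨e1, e2, ?_⟩
  have hd : (x.weight - y.weight).support ⊆ {u, v} :=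
    (Finsupp.support_sub).trans (Finset.union_subset (sub _ hx) (sub _ hy))
  rw [dist, if_pos ⟨u, v, huv, hx, hy⟩,
    Finsupp.sum_of_support_subset _ hd _ (fun _ _ => abs_zero), Finset.sum_pair huv.ne,
    Finsupp.sub_apply, Finsupp.sub_apply,
    show x.weight v - y.weight v = -(x.weight u - y.weight u) by linarith, abs_neg]
  ring

theorem exists_half_le (x : MetricGraph G) : ∃ u ∈ x.weight.support, 1 / 2 ≤ x.weight u := by
  rcases x.support_cases with ⟨u, hs, h1⟩ | ⟨u, v, -, hs, -, -, h1⟩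
  · exact ⟨u, by rw [hs]; exact Finset.mem_singleton_self u, by rw [h1]; norm_num⟩
  · rcases le_total (1 / 2) (x.weight u) with h | h
    · exact ⟨u, by rw [hs]; simp, h⟩
    · exact ⟨v, by rw [hs]; simp, by linarith⟩

theorem exists_other (x : MetricGraph G) {u : V} (hu : u ∈ x.weight.support)
    (h : x.weight u ≠ 1) : ∃ v ∈ x.weight.support, G.Adj u v ∧ x.weight v = 1 - x.weight u := by
  classical
  rcases x.support_cases with ⟨w, hs, h1⟩ | ⟨w, w', ha, hs, -, -, h1⟩
  · rw [hs, Finset.mem_singleton] at hu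
    exact absurd h1 (hu ▸ h)
  · rw [hs] at hu ⊢
    rcases Finset.mem_insert.1 hu with rfl | hu
    · exact ⟨w', by simp, ha, by linarith⟩
    · rw [Finset.mem_singleton] at hu
      subst hu
      exact ⟨w, by simp, ha.symm, by linarith⟩

/-- If only one pair of vertices has distance `2` then the metric graph has diameter at most `2`. -/
theorem dist_le_two {p q : V} (h2 : ∀ u v, G.dist u v ≤ 2)
    (h1 : ∀ u v, 1 < G.dist u v → (u = p ∧ v = q) ∨ (u = q ∧ v = p)) (x y : MetricGraph G) :
    dist x y ≤ 2 := by
  by_cases hc : OnCommonEdge x y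
  · obtain ⟨u, v, huv, hx, hy⟩ := hc
    rw [(dist_eq_of_onCommonEdge huv hx hy).2.2, abs_le]
    have := x.nonneg u
    have := y.nonneg u
    have := x.weight_le_one u
    have := y.weight_le_one u
    constructor <;> linarith
  -- The only bad case is that the nearest vertices are the exceptional pair. Then a route may leave
  -- through the other end of either edge, because every neighbour of one exceptional vertex is
  -- within 1 of the other.
  have far : ∀ p q : V, (∀ u v, 1 < G.dist u v → (u = p ∧ v = q) ∨ (u = q ∧ v = p)) →
      1 < G.dist p q → p ∈ x.weight.support → q ∈ y.weight.support → dist x y ≤ 2 := by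
    intro p q h1 hpq hp hq
    have hpq0 : p ≠ q := fun e => by rw [e, SimpleGraph.dist_self] at hpq; omega
    have near : ∀ u, G.Adj p u → (G.dist u q : ℝ) ≤ 1 := fun u hu => by
      by_contra hc
      rcases h1 u q (by exact_mod_cast not_le.1 hc) with ⟨e, -⟩ | ⟨-, e⟩
      · exact hu.ne e.symm
      · exact hpq0 e.symm
    have near' : ∀ w, G.Adj q w → (G.dist p w : ℝ) ≤ 1 := fun w hw => by
      by_contra hc
      rcases h1 p w (by exact_mod_cast not_le.1 hc) with ⟨-, e⟩ | ⟨e, -⟩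
      · exact hw.ne e.symm
      · exact hpq0 e
    by_cases hxp : x.weight p = 1
    · by_cases hyq : y.weight q = 1
      · have := dist_le hc hp hq
        have h3 : (G.dist p q : ℝ) ≤ 2 := by exact_mod_cast h2 p q
        linarith
      · obtain ⟨w, hw, hqw, hyw⟩ := y.exists_other hq hyq
        have := dist_le hc hp hw
        have := near' w hqw
        have := y.weight_le_one q
        linarith
    · obtain ⟨u, hu, hpu, hxu⟩ := x.exists_other hp hxp
      have h3 := dist_le hc hu hq
      have h4 := near u hpu
      by_cases hyq : y.weight q = 1
      · have := x.weight_le_one p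
        linarith
      · obtain ⟨w, hw, hqw, hyw⟩ := y.exists_other hq hyq
        -- The two routes, each using one exceptional vertex and the opposite end at the other
        -- point, have total length at most 4, so one of them has length at most 2.
        have h5 := dist_le hc hp hw
        have h6 := near' w hqw
        linarith
  obtain ⟨u, hu, hxu⟩ := x.exists_half_le
  obtain ⟨w, hw, hyw⟩ := y.exists_half_le
  by_cases hd : 1 < G.dist u w
  · rcases h1 u w hd with ⟨rfl, rfl⟩ | ⟨rfl, rfl⟩
    · exact far _ _ h1 hd hu hw
    · exact far _ _ (fun a b hab => (h1 a b hab).symm) hd hu hw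
  · have h3 := dist_le hc hu hw
    have h4 : (G.dist u w : ℝ) ≤ 1 := by exact_mod_cast not_lt.1 hd
    linarith

theorem IsGeodesic.left_mem {x y : MetricGraph G} {S : Set (MetricGraph G)}
    (h : IsGeodesic x y S) : x ∈ S := by
  obtain ⟨γ, h0, -, -, rfl⟩ := h
  exact ⟨0, ⟨le_rfl, dist_nonneg x y⟩, h0⟩

theorem IsGeodesic.right_mem {x y : MetricGraph G} {S : Set (MetricGraph G)}
    (h : IsGeodesic x y S) : y ∈ S := by
  obtain ⟨γ, -, h1, -, rfl⟩ := h
  exact ⟨_, ⟨dist_nonneg x y, le_rfl⟩, h1⟩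

/-- The distances of `p` from the two ends add up to the length of the geodesic, so one of them is
at most half of it. -/
theorem IsGeodesic.dist_le {x y p : MetricGraph G} {S : Set (MetricGraph G)}
    (h : IsGeodesic x y S) (hp : p ∈ S) {r : ℝ} (hr : dist x y ≤ 2 * r) :
    dist p x ≤ r ∨ dist p y ≤ r := by
  obtain ⟨γ, h0, h1, h2, rfl⟩ := h
  obtain ⟨s, hs, rfl⟩ := hp
  have e0 := h2 s hs 0 ⟨le_rfl, dist_nonneg x y⟩
  have e1 := h2 s hs _ ⟨dist_nonneg x y, le_rfl⟩
  rw [h0, sub_zero, abs_of_nonneg hs.1] at e0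
  rw [h1, abs_sub_comm, abs_of_nonneg (sub_nonneg.2 hs.2)] at e1
  rw [e0, e1]
  by_contra! hc
  linarith

end MetricGraph

open MetricGraph in
/-- Graphs of diameter two have thin triangles. -/
theorem isHyperbolic_of_dist_le_two {V : Type*} {G : SimpleGraph V} (hG : G.Connected)
    (h : ∀ x y : MetricGraph G, dist x y ≤ 2) {δ : ℝ} (hδ : 1 ≤ δ) : IsHyperbolic G δ := by
  refine ⟨hG, fun x y z a b c ha hb hc => ⟨fun p hp => ?_, fun p hp => ?_, fun p hp => ?_⟩⟩
  · rcases ha.dist_le hp (r := δ) (by linarith [h x y]) with h | h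
    · exact ⟨x, .inr hc.left_mem, h⟩
    · exact ⟨y, .inl hb.left_mem, h⟩
  · rcases hb.dist_le hp (r := δ) (by linarith [h y z]) with h | h
    · exact ⟨y, .inl ha.right_mem, h⟩
    · exact ⟨z, .inr hc.right_mem, h⟩
  · rcases hc.dist_le hp (r := δ) (by linarith [h x z]) with h | h
    · exact ⟨x, .inl ha.left_mem, h⟩
    · exact ⟨z, .inr hb.right_mem, h⟩

/-- Graphs in which all vertices but two are adjacent. -/
theorem isHyperbolic_of_almost_complete {V : Type*} {G : SimpleGraph V} {p q c : V}
    (h : ∀ u v, u ≠ v → G.Adj u v ∨ (u = p ∧ v = q) ∨ (u = q ∧ v = p)) (hp : G.Adj p c)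
    (hq : G.Adj c q) : G.ediam ≤ 2 ∧ ∀ δ : ℝ, 1 ≤ δ → IsHyperbolic G δ := by
  have hw : ∀ u v, ∃ w : G.Walk u v, w.length ≤ 2 := by
    intro u v
    by_cases huv : u = v
    · subst huv
      exact ⟨.nil, by simp⟩
    rcases h u v huv with h | ⟨rfl, rfl⟩ | ⟨rfl, rfl⟩
    · exact ⟨.cons h .nil, by simp⟩
    · exact ⟨.cons hp (.cons hq .nil), by simp⟩
    · exact ⟨.cons hq.symm (.cons hp.symm .nil), by simp⟩
  have hG : G.Connected := by
    rw [SimpleGraph.connected_iff]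
    exact ⟨fun u v => (hw u v).elim fun w _ => w.reachable, ⟨p⟩⟩
  have h2 : ∀ u v, G.dist u v ≤ 2 := fun u v =>
    (hw u v).elim fun w hl => (SimpleGraph.dist_le w).trans hl
  refine ⟨?_, fun δ hδ => isHyperbolic_of_dist_le_two hG
    (MetricGraph.dist_le_two (p := p) (q := q) h2 fun u v huv => ?_) hδ⟩
  · refine SimpleGraph.ediam_le_of_edist_le fun u v => ?_
    obtain ⟨w, hl⟩ := hw u v
    exact (SimpleGraph.edist_le w).trans (by exact_mod_cast hl)
  · have hne : u ≠ v := fun e => by rw [e, SimpleGraph.dist_self] at huv; omega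
    rcases h u v hne with h | h
    · rw [SimpleGraph.dist_eq_one_iff_adj.2 h] at huv
      omega
    · exact h

/-! ### Graphs on a line -/

namespace MetricGraph

variable {V : Type*} {G : SimpleGraph V}

/-- The position of a point with respect to a map of the vertices to the line. -/
noncomputable def position (f : V → ℤ) (x : MetricGraph G) : ℝ :=
  x.weight.sum fun v t => t * f v

/-- The vertices that bound a point from below and above. -/
theorem exists_bounds {f : V → ℤ} (hadj : ∀ u v, G.Adj u v ↔ |f u - f v| = 1)
    (x : MetricGraph G) : ∃ u v, u ∈ x.weight.support ∧ v ∈ x.weight.support ∧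
      (∀ w ∈ x.weight.support, w = u ∨ w = v) ∧
      (u = v ∧ x.weight u = 1 ∧ position f x = f u ∨
        f v = f u + 1 ∧ x.weight u + x.weight v = 1 ∧ position f x = f u + x.weight v ∧
          0 < x.weight u ∧ 0 < x.weight v) := by
  classical
  rcases x.support_cases with ⟨u, hs, h1⟩ | ⟨u, v, ha, hs, hu, hv, h1⟩
  · refine ⟨u, u, by simp [hs], by simp [hs], by simp [hs], .inl ⟨rfl, h1, ?_⟩⟩
    rw [position, Finsupp.sum, hs, Finset.sum_singleton, h1, one_mul]
  · have hp : position f x = x.weight u * f u + x.weight v * f v := by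
      rw [position, Finsupp.sum, hs, Finset.sum_pair ha.ne]
    rcases eq_or_eq_neg_of_abs_eq ((hadj u v).1 ha) with h | h
    · refine ⟨v, u, by simp [hs], by simp [hs], ?_, .inr ⟨by omega, by linarith, ?_, hv, hu⟩⟩
      · intro w hw
        rw [hs] at hw
        simpa [or_comm] using hw
      · rw [hp, show f u = f v + 1 by omega, show x.weight v = 1 - x.weight u by linarith]
        push_cast; ring
    · refine ⟨u, v, by simp [hs], by simp [hs], ?_, .inr ⟨by omega, by linarith, ?_, hu, hv⟩⟩
      · intro w hw
        rw [hs] at hw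
        simpa using hw
      · rw [hp, show f v = f u + 1 by omega, show x.weight u = 1 - x.weight v by linarith]
        push_cast; ring

theorem abs_position_sub {f : V → ℤ} (hadj : ∀ u v, G.Adj u v ↔ |f u - f v| = 1)
    (x : MetricGraph G) {w : V} (hw : w ∈ x.weight.support) :
    |position f x - f w| = 1 - x.weight w := by
  obtain ⟨u, v, -, -, h, ⟨rfl, h1, h2⟩ | ⟨h1, h2, h3, h4, h5⟩⟩ := exists_bounds hadj x
  · obtain rfl : w = u := (h w hw).elim id id
    rw [h1, h2]; simp
  · rcases h w hw with rfl | rfl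
    · rw [h3, add_sub_cancel_left, abs_of_pos h5]; linarith
    · rw [h3, h1, abs_sub_comm, abs_of_nonneg] <;> push_cast <;> linarith

/-- The path leaves `x` through its upper vertex and enters `y` through its lower one; its length is
the difference of the positions. -/
theorem dist_le_sub {f : V → ℤ} (hadj : ∀ u v, G.Adj u v ↔ |f u - f v| = 1)
    (hf : Function.Injective f) (hd : ∀ u v, (G.dist u v : ℤ) = |f u - f v|)
    {x y : MetricGraph G} (hc : ¬OnCommonEdge x y) (hle : position f x ≤ position f y) :
    dist x y ≤ position f y - position f x := by
  obtain ⟨u, u', hu, hu', hx, hx'⟩ := exists_bounds hadj x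
  obtain ⟨w, w', hw, hw', hy, hy'⟩ := exists_bounds hadj y
  have ax := abs_position_sub hadj x hu'
  have ay := abs_position_sub hadj y hw
  have bx : position f x ≤ f u' ∧ (f u' - 1 : ℝ) < position f x := by
    rcases hx' with ⟨rfl, h1, h2⟩ | ⟨h1, h2, h3, h4, h5⟩
    · rw [h2]; constructor <;> linarith
    · rw [h3, h1]; push_cast; constructor <;> linarith
  have bY : (f w : ℝ) ≤ position f y ∧ position f y < f w + 1 := by
    rcases hy' with ⟨rfl, h1, h2⟩ | ⟨h1, h2, h3, h4, h5⟩
    · rw [h2]; constructor <;> linarith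
    · rw [h3]; constructor <;> linarith
  -- Otherwise the upper vertex of `x` is just above the lower vertex of `y`, and both points lie on
  -- that edge.
  have hkey : f u' ≤ f w := by
    by_contra! hlt
    have h1 : f u' = f w + 1 := by
      have : (f u' : ℝ) < f w + 2 := by linarith [bx.2, bY.2]
      have : f u' < f w + 2 := by exact_mod_cast this
      omega
    refine hc ⟨w, u', (hadj w u').2 (by rw [h1]; simp), fun z hz => ?_, fun z hz => ?_⟩
    · rcases hx z hz with rfl | rfl
      · rcases hx' with ⟨rfl, -, -⟩ | ⟨h2, -⟩
        · simp
        · exact .inl (hf (by omega))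
      · simp
    · rcases hy z hz with rfl | rfl
      · simp
      · rcases hy' with ⟨rfl, -, -⟩ | ⟨h2, -⟩
        · simp
        · exact .inr (hf (by omega))
  have h1 := dist_le hc hu' hw
  have h2 : (G.dist u' w : ℝ) = f w - f u' := by
    have := hd u' w
    rw [abs_sub_comm, abs_of_nonneg (by omega)] at this
    exact_mod_cast this
  rw [abs_of_nonpos (by linarith)] at ax
  rw [abs_of_nonneg (by linarith)] at ay
  linarith

theorem dist_comm (x y : MetricGraph G) : dist x y = dist y x := by
  rw [dist, dist]
  have hc : OnCommonEdge x y ↔ OnCommonEdge y x :=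
    ⟨fun ⟨u, v, h, h1, h2⟩ => ⟨u, v, h, h2, h1⟩, fun ⟨u, v, h, h1, h2⟩ => ⟨u, v, h, h2, h1⟩⟩
  by_cases h : OnCommonEdge x y
  · rw [if_pos h, if_pos (hc.1 h), ← neg_sub y.weight x.weight]
    congr 1
    rw [Finsupp.sum_neg_index (by simp)]
    simp
  · rw [if_neg h, if_neg fun h' => h (hc.2 h')]
    refine (Equiv.prodComm _ _).iInf_congr fun p => ?_
    simp only [Equiv.prodComm_apply, Prod.fst_swap, Prod.snd_swap]
    rw [SimpleGraph.dist_comm]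
    ring

/-- On a line the distance is the difference of the positions. -/
theorem dist_eq_abs_sub {f : V → ℤ} (hadj : ∀ u v, G.Adj u v ↔ |f u - f v| = 1)
    (hf : Function.Injective f) (hd : ∀ u v, (G.dist u v : ℤ) = |f u - f v|)
    (x y : MetricGraph G) : dist x y = |position f x - position f y| := by
  classical
  by_cases hc : OnCommonEdge x y
  · obtain ⟨u, v, huv, hx, hy⟩ := hc
    obtain ⟨h1, h2, h3⟩ := dist_eq_of_onCommonEdge huv hx hy
    have pos : ∀ z : MetricGraph G, (z.weight.support : Set V) ⊆ {u, v} →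
        position f z = z.weight u * f u + z.weight v * f v := fun z hz => by
      have : z.weight.support ⊆ {u, v} := fun w hw => by simpa using hz (Finset.mem_coe.2 hw)
      rw [position, Finsupp.sum_of_support_subset _ this (fun v t => t * (f v : ℝ))
        (fun _ _ => zero_mul _),
        Finset.sum_pair huv.ne]
    have h4 : |(f u - f v : ℝ)| = 1 := by
      have := (hadj u v).1 huv
      exact_mod_cast this
    rw [h3, pos x hx, pos y hy, show x.weight u * f u + x.weight v * f v -
      (y.weight u * f u + y.weight v * f v) = (x.weight u - y.weight u) * (f u - f v) by
        linear_combination (f v : ℝ) * (h1 - h2), abs_mul, h4, mul_one]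
  · refine le_antisymm ?_ ?_
    · rcases le_total (position f x) (position f y) with h | h
      · rw [abs_of_nonpos (by linarith)]
        linarith [dist_le_sub hadj hf hd hc h]
      · rw [abs_of_nonneg (by linarith), dist_comm]
        exact dist_le_sub hadj hf hd
          (fun ⟨u, v, h, h1, h2⟩ => hc ⟨u, v, h, h2, h1⟩) h
    · obtain ⟨u₀, -, hu₀, -⟩ := exists_bounds hadj x
      obtain ⟨w₀, -, hw₀, -⟩ := exists_bounds hadj y
      rw [dist, if_neg hc]
      have : Nonempty (x.weight.support × y.weight.support) := ⟨(⟨u₀, hu₀⟩, ⟨w₀, hw₀⟩)⟩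
      refine le_ciInf fun ⟨⟨u, hu⟩, ⟨w, hw⟩⟩ => ?_
      have h1 := abs_position_sub hadj x hu
      have h2 := abs_position_sub hadj y hw
      have h3 : (G.dist u w : ℝ) = |(f u - f w : ℝ)| := by
        have := hd u w
        exact_mod_cast this
      simp only
      rw [← h1, ← h2, h3]
      calc |position f x - position f y|
          ≤ |position f x - f u| + |(f u : ℝ) - position f y| := abs_sub_le _ _ _
        _ ≤ |position f x - f u| + (|(f u : ℝ) - f w| + |(f w : ℝ) - position f y|) := by
            gcongr; exact abs_sub_le _ _ _
        _ = _ := by rw [abs_sub_comm (f w : ℝ)]; ring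

end MetricGraph

open MetricGraph in
/-- Graphs on a line have `0`-thin triangles. -/
theorem isHyperbolic_of_line {V : Type*} {G : SimpleGraph V} {f : V → ℤ} (hG : G.Connected)
    (hadj : ∀ u v, G.Adj u v ↔ |f u - f v| = 1) (hf : Function.Injective f)
    (hd : ∀ u v, (G.dist u v : ℤ) = |f u - f v|) {δ : ℝ} (hδ : 0 ≤ δ) : IsHyperbolic G δ := by
  have hdist := dist_eq_abs_sub hadj hf hd
  have between : ∀ {x y p : MetricGraph G} {S}, IsGeodesic x y S → p ∈ S →
      |position f p - position f x| + |position f p - position f y| =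
        |position f x - position f y| := by
    rintro x y p S ⟨γ, h0, h1, h2, rfl⟩ ⟨s, hs, rfl⟩
    have e0 := h2 s hs 0 ⟨le_rfl, dist_nonneg x y⟩
    have e1 := h2 s hs _ ⟨dist_nonneg x y, le_rfl⟩
    rw [h0, sub_zero, abs_of_nonneg hs.1, hdist] at e0
    rw [h1, abs_sub_comm s, abs_of_nonneg (sub_nonneg.2 hs.2), hdist] at e1
    rw [e0, e1, ← hdist]
    ring
  -- A geodesic passes every position between those of its ends: the parameter is the distance of
  -- `r` from the starting position, and only one position has the right distances from both ends.
  have covers : ∀ {x y : MetricGraph G} {S} (r : ℝ), IsGeodesic x y S →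
      |r - position f x| + |r - position f y| = |position f x - position f y| →
      ∃ q ∈ S, position f q = r := by
    intro x y S r hS hr
    have hS' := hS
    obtain ⟨γ, h0, h1, h2, rfl⟩ := hS
    have hs : |r - position f x| ∈ Set.Icc 0 (dist x y) := by
      refine ⟨abs_nonneg _, ?_⟩
      rw [hdist, ← hr]
      linarith [abs_nonneg (r - position f y)]
    refine ⟨_, ⟨_, hs, rfl⟩, ?_⟩
    have hb := between hS' ⟨_, hs, rfl⟩
    have e0 := h2 _ hs 0 ⟨le_rfl, dist_nonneg x y⟩
    rw [h0, sub_zero, abs_abs, hdist] at e0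
    generalize position f (γ |r - position f x|) = t at *
    generalize position f x = a at *
    generalize position f y = b at *
    clear * - hb e0 hr
    rcases abs_cases (t - a) with h | h <;> rcases abs_cases (t - b) with h' | h' <;>
      rcases abs_cases (r - a) with g | g <;> rcases abs_cases (r - b) with g' | g' <;>
      rcases abs_cases (a - b) with k | k <;> linarith
  -- A position between those of `x` and `y` is also between `x` and `z` or between `z` and `y`, so
  -- another side contains a point at the very same position, hence at distance 0.
  have thin : ∀ {x y z : MetricGraph G} {S S' : Set (MetricGraph G)} (r : ℝ),
      (∀ r, |r - position f x| + |r - position f z| = |position f x - position f z| →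
        ∃ q ∈ S, position f q = r) →
      (∀ r, |r - position f y| + |r - position f z| = |position f y - position f z| →
        ∃ q ∈ S', position f q = r) →
      |r - position f x| + |r - position f y| = |position f x - position f y| →
      ∃ q ∈ S ∪ S', position f q = r := by
    intro x y z S S' r h1 h2 h3
    have : |r - position f x| + |r - position f z| = |position f x - position f z| ∨
        |r - position f y| + |r - position f z| = |position f y - position f z| := by
      generalize position f x = a at *
      generalize position f y = b at *
      generalize position f z = c at *
      clear * - h3
      by_contra! hc
      obtain ⟨c1, c2⟩ := hc
      rcases abs_cases (r - a) with h | h <;> rcases abs_cases (r - b) with h' | h' <;>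
        rcases abs_cases (r - c) with g | g <;> rcases abs_cases (a - b) with k | k <;>
        rcases abs_cases (a - c) with g' | g' <;> rcases abs_cases (b - c) with l | l <;>
        first
        | linarith
        | exact c1 (by linarith)
        | exact c2 (by linarith)
    rcases this with h | h
    · obtain ⟨q, hq, e⟩ := h1 r h
      exact ⟨q, .inl hq, e⟩
    · obtain ⟨q, hq, e⟩ := h2 r h
      exact ⟨q, .inr hq, e⟩
  have swap : ∀ {r a b : ℝ}, |r - b| + |r - a| = |b - a| → |r - a| + |r - b| = |a - b| := by
    intro r a b h
    rw [add_comm, h, abs_sub_comm]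
  refine ⟨hG, fun x y z a b c ha hb hc => ⟨fun p hp => ?_, fun p hp => ?_, fun p hp => ?_⟩⟩
  · obtain ⟨q, hq, e⟩ := thin (position f p) (fun r => covers r hc) (fun r => covers r hb)
      (between ha hp)
    exact ⟨q, hq.symm, by rw [hdist, e, sub_self, abs_zero]; exact hδ⟩
  · obtain ⟨q, hq, e⟩ := thin (position f p) (fun r h => covers r ha (swap h))
      (fun r h => covers r hc (swap h)) (between hb hp)
    exact ⟨q, hq, by rw [hdist, e, sub_self, abs_zero]; exact hδ⟩
  · obtain ⟨q, hq, e⟩ := thin (position f p) (fun r => covers r ha)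
      (fun r h => covers r hb (swap h)) (between hc hp)
    exact ⟨q, hq, by rw [hdist, e, sub_self, abs_zero]; exact hδ⟩

/-! ## The quotient graphs -/

theorem Joined.adj {V α : Type*} {G : SimpleGraph V} {p : V → α} {v w : V}
    (h : Joined G p (p v) (p w)) (hne : p v ≠ p w) :
    (quotientGraph G p).Adj (cls p v) (cls p w) := by
  obtain ⟨v', w', h, hv, hw⟩ := h
  exact ⟨fun e => hne (Quotient.exact e), v', w', Quotient.sound hv, Quotient.sound hw, h⟩

/-- Quotients in which all values but two are joined. -/
theorem isHyperbolic_quotientGraph {V α : Type*} {G : SimpleGraph V} {p : V → α} {a b c : V}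
    (h : ∀ v w, p v ≠ p w → Joined G p (p v) (p w) ∨ (p v = p a ∧ p w = p b) ∨
      (p v = p b ∧ p w = p a)) (ha : Joined G p (p a) (p c)) (hac : p a ≠ p c)
    (hb : Joined G p (p c) (p b)) (hbc : p c ≠ p b) :
    (quotientGraph G p).ediam ≤ 2 ∧ ∀ δ : ℝ, 1 ≤ δ → IsHyperbolic (quotientGraph G p) δ := by
  refine isHyperbolic_of_almost_complete (p := cls p a) (q := cls p b) (c := cls p c) ?_
    (ha.adj hac) (hb.adj hbc)
  intro u u'
  induction u using Quotient.inductionOn with | _ v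
  induction u' using Quotient.inductionOn with | _ w
  intro hne
  have hne' : p v ≠ p w := fun e => hne (Quotient.sound e)
  rcases h v w hne' with h | ⟨h1, h2⟩ | ⟨h1, h2⟩
  · exact .inl (h.adj hne')
  · exact .inr (.inl ⟨Quotient.sound h1, Quotient.sound h2⟩)
  · exact .inr (.inr ⟨Quotient.sound h1, Quotient.sound h2⟩)

/-! ### The infinite path -/

theorem exists_walk_infinitePath (m : ℕ+) (k : ℕ) :
    ∀ n : ℕ+, (n : ℕ) = m + k → ∃ w : infinitePath.Walk m n, w.length = k := by
  induction k with
  | zero =>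
    intro n hn
    obtain rfl : n = m := PNat.eq (by simpa using hn)
    exact ⟨.nil, rfl⟩
  | succ k ih =>
    intro n hn
    obtain ⟨n', hn'⟩ : ∃ n' : ℕ+, (n' : ℕ) = m + k := ⟨⟨m + k, by have := m.pos; omega⟩, rfl⟩
    obtain ⟨w, hw⟩ := ih n' hn'
    have hadj : infinitePath.Adj n' n := .inl (PNat.eq (by
      rw [PNat.add_coe, hn, hn', PNat.one_coe, add_assoc]))
    exact ⟨w.concat hadj, by rw [SimpleGraph.Walk.length_concat, hw]⟩

theorem connected_infinitePath : infinitePath.Connected := by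
  rw [SimpleGraph.connected_iff]
  refine ⟨fun m n => ?_, ⟨1⟩⟩
  rcases le_total m n with h | h
  · obtain ⟨w, -⟩ := exists_walk_infinitePath m (n - m : ℕ) n (by
      have : (m : ℕ) ≤ n := h
      omega)
    exact w.reachable
  · obtain ⟨w, -⟩ := exists_walk_infinitePath n (m - n : ℕ) m (by
      have : (n : ℕ) ≤ m := h
      omega)
    exact w.reachable.symm

/-- Every edge is a bridge: once {m, m + 1} is deleted, a walk that starts at or below `m` never
gets above it. -/
theorem isTree_infinitePath : infinitePath.IsTree := by
  refine ⟨connected_infinitePath, SimpleGraph.isAcyclic_iff_forall_adj_isBridge.2 ?_⟩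
  have key : ∀ m : ℕ+, infinitePath.IsBridge s(m, m + 1) := by
    intro m
    rw [SimpleGraph.isBridge_iff]
    rintro ⟨w⟩
    have : ∀ u v : ℕ+, (infinitePath.deleteEdges {s(m, m + 1)}).Walk u v → u ≤ m → v ≤ m := by
      intro u v w
      induction w with
      | nil => exact id
      | @cons u v w h _ ih =>
        intro hu
        refine ih ?_
        rw [SimpleGraph.deleteEdges_adj] at h
        obtain ⟨h1 | h1, h2⟩ := h
        · by_contra hc
          refine h2 ?_
          have : u = m := by
            refine le_antisymm hu ?_
            rw [← h1, not_le, PNat.lt_add_one_iff] at hc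
            exact hc
          rw [← h1, this]
          exact Set.mem_singleton _
        · rw [← h1] at hu
          exact (PNat.lt_add_right v 1).le.trans hu
    exact absurd (this _ _ w le_rfl) (not_le.2 (PNat.lt_add_right m 1))
  rintro v w (h | h)
  · rw [← h]; exact key v
  · rw [← h, Sym2.eq_swap]; exact key w

/-- Graphs isomorphic to the infinite path. -/
theorem isHyperbolic_of_iso {V : Type*} {G : SimpleGraph V} (e : G ≃g infinitePath) {δ : ℝ}
    (hδ : 0 ≤ δ) : IsHyperbolic G δ := by
  have hG : G.Connected := e.connected_iff.2 connected_infinitePath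
  have hadj : ∀ u v, G.Adj u v ↔ |((e u : ℕ) : ℤ) - ((e v : ℕ) : ℤ)| = 1 := by
    intro u v
    rw [← e.map_adj_iff]
    change e u + 1 = e v ∨ e v + 1 = e u ↔ _
    rw [← PNat.coe_inj, ← PNat.coe_inj, PNat.add_coe, PNat.add_coe, PNat.one_coe,
      abs_eq zero_le_one]
    omega
  refine isHyperbolic_of_line (f := fun v => ((e v : ℕ) : ℤ)) hG hadj
    (fun u v h => e.injective (PNat.eq (Int.ofNat_inj.1 h))) (fun u v => ?_) hδ
  have lower : ∀ {u v : V} (w : G.Walk u v), |((e u : ℕ) : ℤ) - ((e v : ℕ) : ℤ)| ≤ w.length := by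
    intro u v w
    induction w with
    | nil => simp
    | @cons u v w h _ ih =>
      have h1 := (hadj u v).1 h
      rw [SimpleGraph.Walk.length_cons]
      push_cast
      exact (abs_sub_le _ _ _).trans (by linarith)
  have upper : ∀ u v : V, (e u : ℕ) ≤ e v → (G.dist u v : ℤ) ≤ ((e v : ℕ) : ℤ) - ((e u : ℕ) : ℤ) := by
    intro u v h
    obtain ⟨w, hw⟩ := exists_walk_infinitePath (e u) (e v - e u : ℕ) (e v) (by omega)
    have h1 := SimpleGraph.dist_le (w.map e.symm.toHom)
    rw [SimpleGraph.Walk.length_map, hw] at h1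
    change G.dist (e.symm (e u)) (e.symm (e v)) ≤ _ at h1
    rw [e.symm_apply_apply, e.symm_apply_apply] at h1
    omega
  obtain ⟨w, hw⟩ := hG.exists_walk_length_eq_dist u v
  have h1 := lower w
  rw [hw] at h1
  refine le_antisymm ?_ h1
  rcases le_total (e u : ℕ) (e v) with h | h
  · have := upper u v h
    rw [abs_sub_comm, abs_of_nonneg] <;> omega
  · have := upper v u h
    rw [SimpleGraph.dist_comm, abs_of_nonneg] <;> omega

/-! ### The quotient by β and the infinite path -/

theorem Knot.exists_beta (K : Knot) : ∃ j : ℕ+, K.beta = (j : ℕ) := by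
  obtain ⟨D, rfl⟩ := K.exists_diagram
  obtain ⟨j, h1, -, h2⟩ := D.exists_beta
  exact ⟨⟨j, h1⟩, h2⟩

/-- The quotient by `β` is the infinite path. -/
theorem exists_iso_beta {G : SimpleGraph Knot}
    (h1 : ∀ K K', G.Adj K K' → |K.beta - K'.beta| ≤ 1)
    (h2 : ∀ n : ℕ, Joined G Knot.beta (n + 1) (n + 2)) :
    ∃ e : quotientGraph G Knot.beta ≃g infinitePath,
      ∀ K : Knot, ((e (cls Knot.beta K) : ℕ) : ℝ) = K.beta := by
  choose b hb using Knot.exists_beta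
  have hcast : ∀ m n : ℕ+, ((m : ℕ) : ℝ) = (n : ℕ) → m = n := fun m n h =>
    PNat.eq (by exact_mod_cast h)
  let f : Quotient (Setoid.ker Knot.beta) → ℕ+ := Quotient.lift b fun K K' h => by
    refine hcast _ _ ?_
    rw [← hb, ← hb]
    exact h
  have hf : ∀ K, ((f (cls Knot.beta K) : ℕ) : ℝ) = K.beta := fun K => (hb K).symm
  have hbij : Function.Bijective f := by
    constructor
    · intro q q'
      induction q using Quotient.inductionOn with | _ K
      induction q' using Quotient.inductionOn with | _ K'
      intro h
      refine Quotient.sound ?_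
      change K.beta = K'.beta
      rw [hb, hb]
      exact congrArg (fun n : ℕ+ => ((n : ℕ) : ℝ)) h
    · intro n
      -- The joined pairs are indexed from 0, so the value `n` is the first member of the pair with
      -- index `n - 1`.
      obtain ⟨K, -, -, hK, -⟩ := h2 (n - 1 : ℕ)
      refine ⟨cls Knot.beta K, hcast _ _ ?_⟩
      rw [hf, hK, Nat.cast_sub n.pos]
      simp
  refine ⟨⟨Equiv.ofBijective f hbij, ?_⟩, hf⟩
  have step : ∀ K K', b K + 1 = b K' →
      (quotientGraph G Knot.beta).Adj (cls Knot.beta K) (cls Knot.beta K') := by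
    intro K K' h
    have h3 : ((b K' : ℕ) : ℝ) = (b K : ℕ) + 1 := by rw [← h]; push_cast; rfl
    refine Joined.adj ?_ (by rw [hb, hb, h3]; simp)
    have := h2 (b K - 1 : ℕ)
    rw [hb, hb, h3]
    rw [Nat.cast_sub (b K).pos] at this
    convert this using 1 <;> push_cast <;> ring
  intro q q'
  induction q using Quotient.inductionOn with | _ K
  induction q' using Quotient.inductionOn with | _ K'
  change b K + 1 = b K' ∨ b K' + 1 = b K ↔ _
  constructor
  · rintro (h | h)
    · exact step _ _ h
    · exact (step _ _ h).symm
  · rintro ⟨hne, L, L', hL, hL', hadj⟩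
    have e1 : L.beta = K.beta := Quotient.exact hL
    have e2 : L'.beta = K'.beta := Quotient.exact hL'
    have h3 := h1 _ _ hadj
    rw [e1, e2, hb, hb] at h3
    have h4 : |((b K : ℕ) : ℤ) - ((b K' : ℕ) : ℤ)| ≤ 1 := by exact_mod_cast h3
    have h5 : (b K : ℕ) ≠ b K' := fun h => hne (Quotient.sound (by
      change K.beta = K'.beta
      rw [hb, hb, h]))
    rw [← PNat.coe_inj, ← PNat.coe_inj, PNat.add_coe, PNat.add_coe, PNat.one_coe]
    rw [abs_le] at h4
    omega

theorem abs_beta_sub_le_of_gordian {K K' : Knot} (h : gordian.Adj K K') :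
    |K.beta - K'.beta| ≤ 1 := by
  obtain ⟨-, D, D', rfl, rfl, h⟩ := h
  exact abs_beta_sub_le_of_crossingChange h

theorem abs_beta_sub_le_of_hTwoGordian {K K' : Knot} (h : hTwoGordian.Adj K K') :
    |K.beta - K'.beta| ≤ 1 := by
  obtain ⟨-, D, D', rfl, rfl, h | h⟩ := h
  · exact abs_beta_sub_le_of_banding h
  · rw [abs_sub_comm]
    exact abs_beta_sub_le_of_banding h

/-! ### Values -/

theorem bracket_unknotDiagram : unknotDiagram.bracket = 1 := by
  have h := closing_cap.loopBracket_eq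
  rw [mul_one] at h
  refine mul_left_cancel₀ loopValue_ne_zero ?_
  rw [KnotDiagram.bracket_eq, mul_one]
  exact h

theorem det_unknot : unknot.det = 1 := by
  have := KnotDiagram.det_eq_of_bracket (D := unknotDiagram) (x := 1) (Y := 1) (a := 1) (g := 1)
    (by rw [bracket_unknotDiagram, one_mul]) (by simp) (by simp)
  change unknotDiagram.knot.det = 1
  simpa using this

theorem span_unknot : unknot.span = 0 :=
  KnotDiagram.span_eq (D := unknotDiagram) (bracket_unknotDiagram ▸ Extent.one) (by ring)

theorem range_det : Set.range Knot.det = {n | Odd n} := by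
  ext n
  constructor
  · rintro ⟨K, rfl⟩
    exact K.odd_det
  · intro hn
    by_cases h : n = 1
    · exact ⟨unknot, by rw [det_unknot, h]⟩
    · obtain ⟨K, -, -, hK, -⟩ := joined_gordian_det hn odd_one h
      exact ⟨K, hK⟩

theorem range_span : Set.range Knot.span = {n | n = 0 ∨ 3 ≤ n} := by
  ext n
  constructor
  · rintro ⟨K, rfl⟩
    exact K.span_eq_zero_or
  · rintro (rfl | hn)
    · exact ⟨unknot, span_unknot⟩
    · obtain ⟨K, -, -, hK, -⟩ := (joined_gordian_span_add (s := 0) (.inl rfl) hn).symm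
      exact ⟨K, by rw [hK, zero_add]⟩

/-- A difference of at least 3 is handled by trivializing a summand, and a difference of 2 cannot
start at 0. A difference of 1 needs `s = 3`, `s = 5` or `s ≥ 6`; the pair 4, 5 stays undecided. -/
theorem joined_gordian_span {s s' : ℤ} (hs : s = 0 ∨ 3 ≤ s) (hs' : s' = 0 ∨ 3 ≤ s')
    (h : s < s') : Joined gordian Knot.span s s' ∨ s = 4 ∧ s' = 5 := by
  by_cases h3 : s + 3 ≤ s'
  · have := joined_gordian_span_add hs (k := s' - s) (by omega)
    rw [add_sub_cancel] at this
    exact .inl this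
  by_cases h2 : s' = s + 2
  · subst h2
    exact .inl (joined_gordian_span_add_two (by omega))
  obtain rfl : s' = s + 1 := by omega
  by_cases h4 : s = 4
  · exact .inr ⟨h4, by omega⟩
  by_cases h5 : s = 5
  · subst h5
    exact .inl joined_gordian_span_five_six
  exact .inl (joined_gordian_span_add_one (by omega))

/-- Positive spans are joined according to the parity of their difference. From span 0 the torus
braids reach odd values and the pretzel family even values from 6 on, so only 4 stays undecided. -/
theorem joined_hTwoGordian_span {s s' : ℤ} (hs : s = 0 ∨ 3 ≤ s) (hs' : s' = 0 ∨ 3 ≤ s')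
    (h : s < s') : Joined hTwoGordian Knot.span s s' ∨ s = 0 ∧ s' = 4 := by
  rcases hs with rfl | hs
  · rcases Int.even_or_odd s' with he | ho
    · by_cases h4 : s' = 4
      · exact .inr ⟨rfl, h4⟩
      · exact .inl (joined_hTwoGordian_span_zero_even (by
          obtain ⟨r, hr⟩ := he
          omega) he)
    · exact .inl (joined_hTwoGordian_span_zero_odd (by omega) ho)
  · refine .inl ?_
    rcases Int.even_or_odd (s' - s) with he | ho
    · have := joined_hTwoGordian_span_add_even hs (sub_pos.2 h) he
      rwa [add_sub_cancel] at this
    · have := joined_hTwoGordian_span_add_odd hs (sub_pos.2 h) ho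
      rwa [add_sub_cancel] at this

theorem exists_span {n : ℤ} (hn : n = 0 ∨ 3 ≤ n) : ∃ K : Knot, K.span = n := by
  have : n ∈ Set.range Knot.span := by rw [range_span]; exact hn
  exact this

theorem isHyperbolic_span {G : SimpleGraph Knot} {a b c : ℤ}
    (h : ∀ {s s' : ℤ}, (s = 0 ∨ 3 ≤ s) → (s' = 0 ∨ 3 ≤ s') → s < s' →
      Joined G Knot.span s s' ∨ s = a ∧ s' = b)
    (ha : a = 0 ∨ 3 ≤ a) (hb : b = 0 ∨ 3 ≤ b) (hc : c = 0 ∨ 3 ≤ c)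
    (hac : Joined G Knot.span a c) (hca : a ≠ c) (hcb : Joined G Knot.span c b) (hbc : c ≠ b) :
    (quotientGraph G Knot.span).ediam ≤ 2 ∧
      ∀ δ : ℝ, 1 ≤ δ → IsHyperbolic (quotientGraph G Knot.span) δ := by
  obtain ⟨A, rfl⟩ := exists_span ha
  obtain ⟨B, rfl⟩ := exists_span hb
  obtain ⟨C, rfl⟩ := exists_span hc
  refine isHyperbolic_quotientGraph (a := A) (b := B) (c := C) (fun K K' hne => ?_) hac hca hcb hbc
  rcases lt_or_gt_of_ne hne with hlt | hlt
  · rcases h K.span_eq_zero_or K'.span_eq_zero_or hlt with h | h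
    · exact .inl h
    · exact .inr (.inl h)
  · rcases h K'.span_eq_zero_or K.span_eq_zero_or hlt with h | h
    · exact .inl h.symm
    · exact .inr (.inr h.symm)

theorem isHyperbolic_det {G : SimpleGraph Knot}
    (h : ∀ {n n' : ℕ}, Odd n → Odd n' → n ≠ n' → Joined G Knot.det n n') :
    (quotientGraph G Knot.det).ediam ≤ 2 ∧
      ∀ δ : ℝ, 1 ≤ δ → IsHyperbolic (quotientGraph G Knot.det) δ := by
  obtain ⟨K, L, -, hK, hL⟩ := joined_gordian_det odd_one (show Odd 3 by decide) (by decide)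
  -- All values are joined, so no exceptional pair is needed: it is taken degenerate, with two equal
  -- members, and any other class serves as common neighbour.
  refine isHyperbolic_quotientGraph (a := K) (b := K) (c := L)
    (fun v w hne => .inl (h v.odd_det w.odd_det hne)) ?_ ?_ ?_ ?_
  · exact h K.odd_det L.odd_det (by rw [hK, hL]; decide)
  · rw [hK, hL]; decide
  · exact h L.odd_det K.odd_det (by rw [hK, hL]; decide)
  · rw [hK, hL]; decide

end KnotGraphs
-- The theorem
open KnotGraphs in
theorem theorem1p1 :
    (∀ G ∈ ({gordian, hTwoGordian} : Set (SimpleGraph Knot)),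
      IsGromovHyperbolic (quotientGraph G Knot.beta) ∧
      IsGromovHyperbolic (quotientGraph G Knot.det) ∧
      IsGromovHyperbolic (quotientGraph G Knot.span)) ∧
    -- the quotients by `β`
    (∀ G ∈ ({gordian, hTwoGordian} : Set (SimpleGraph Knot)),
      (∃ e : quotientGraph G Knot.beta ≃g infinitePath,
        ∀ K : Knot, ((e (cls Knot.beta K) : ℕ) : ℝ) = K.beta) ∧
      (quotientGraph G Knot.beta).IsTree ∧
      ∀ δ : ℝ, 0 ≤ δ → IsHyperbolic (quotientGraph G Knot.beta) δ) ∧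
    -- the quotients by the determinant
    Set.range Knot.det = {n | Odd n} ∧
    (∀ G ∈ ({gordian, hTwoGordian} : Set (SimpleGraph Knot)),
      (∀ K : Knot, K.det ≠ unknot.det →
        (quotientGraph G Knot.det).Adj (cls Knot.det K) (cls Knot.det unknot)) ∧
      (quotientGraph G Knot.det).ediam ≤ 2 ∧
      ∀ δ : ℝ, 1 ≤ δ → IsHyperbolic (quotientGraph G Knot.det) δ) ∧
    -- the quotients by the span of the Jones polynomial
    Set.range Knot.span = {n | n = 0 ∨ 3 ≤ n} ∧
    (∀ K : Knot, K.span ≠ unknot.span →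
      (quotientGraph gordian Knot.span).Adj (cls Knot.span K) (cls Knot.span unknot)) ∧
    (∀ K : Knot, 3 ≤ K.span → Odd K.span →
      (quotientGraph hTwoGordian Knot.span).Adj (cls Knot.span K) (cls Knot.span unknot)) ∧
    (∀ K K' : Knot, 3 ≤ K.span → K'.span = K.span + 1 →
      (quotientGraph hTwoGordian Knot.span).Adj (cls Knot.span K) (cls Knot.span K')) ∧
    (∀ G ∈ ({gordian, hTwoGordian} : Set (SimpleGraph Knot)),
      (quotientGraph G Knot.span).ediam ≤ 2 ∧
      ∀ δ : ℝ, 1 ≤ δ → IsHyperbolic (quotientGraph G Knot.span) δ) := by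
  have both : ∀ {P : SimpleGraph Knot → Prop}, P gordian → P hTwoGordian →
      ∀ G ∈ ({gordian, hTwoGordian} : Set (SimpleGraph Knot)), P G := by
    rintro P h1 h2 G (rfl | rfl)
    · exact h1
    · exact h2
  have hbeta : ∀ G ∈ ({gordian, hTwoGordian} : Set (SimpleGraph Knot)),
      ∃ e : quotientGraph G Knot.beta ≃g infinitePath,
        ∀ K : Knot, ((e (cls Knot.beta K) : ℕ) : ℝ) = K.beta :=
    both (exists_iso_beta (fun _ _ => abs_beta_sub_le_of_gordian) joined_gordian_beta)
      (exists_iso_beta (fun _ _ => abs_beta_sub_le_of_hTwoGordian) joined_hTwoGordian_beta)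
  have hjoined : ∀ G ∈ ({gordian, hTwoGordian} : Set (SimpleGraph Knot)),
      ∀ {n n' : ℕ}, Odd n → Odd n' → n ≠ n' → Joined G Knot.det n n' :=
    both joined_gordian_det joined_hTwoGordian_det
  have hspan : ∀ G ∈ ({gordian, hTwoGordian} : Set (SimpleGraph Knot)),
      (quotientGraph G Knot.span).ediam ≤ 2 ∧
      ∀ δ : ℝ, 1 ≤ δ → IsHyperbolic (quotientGraph G Knot.span) δ := by
    refine both ?_ ?_
    -- The possibly missing edge 4, 5 is bypassed through the class of the unknot.
    · refine isHyperbolic_span (a := 4) (b := 5) (c := 0) joined_gordian_span (by omega) (by omega)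
        (by omega) ?_ (by omega) ?_ (by omega)
      · exact (joined_gordian_span_add (s := 0) (k := 4) (.inl rfl) (by omega)).symm
      · exact joined_gordian_span_add (s := 0) (k := 5) (.inl rfl) (by omega)
    -- Here the possibly missing edge is 0, 4, and span 3 is the common neighbour.
    · refine isHyperbolic_span (a := 0) (b := 4) (c := 3) joined_hTwoGordian_span (by omega)
        (by omega) (by omega) ?_ (by omega) ?_ (by omega)
      · exact joined_hTwoGordian_span_zero_odd (by omega) (by decide)
      · exact joined_hTwoGordian_span_add_odd (s := 3) (p := 1) (by omega) (by omega) (by decide)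
  refine ⟨fun G hG => ⟨?_, ?_, ?_⟩, fun G hG => ?_, range_det, fun G hG => ⟨fun K hK => ?_, ?_⟩,
    range_span, fun K hK => ?_, fun K hK ho => ?_, fun K K' hK hK' => ?_, hspan⟩
  · obtain ⟨e, -⟩ := hbeta G hG
    exact ⟨0, le_rfl, isHyperbolic_of_iso e le_rfl⟩
  · exact ⟨1, zero_le_one, (isHyperbolic_det (hjoined G hG)).2 1 le_rfl⟩
  · exact ⟨1, zero_le_one, (hspan G hG).2 1 le_rfl⟩
  · obtain ⟨e, he⟩ := hbeta G hG
    exact ⟨⟨e, he⟩, e.isTree_iff.2 isTree_infinitePath, fun δ hδ => isHyperbolic_of_iso e hδ⟩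
  · exact (hjoined G hG K.odd_det unknot.odd_det hK).adj hK
  · exact isHyperbolic_det (hjoined G hG)
  · have hK' := hK
    rw [span_unknot] at hK'
    have := joined_gordian_span_add (s := 0) (.inl rfl) (K.span_eq_zero_or.resolve_left hK')
    rw [zero_add, ← span_unknot] at this
    exact this.symm.adj hK
  · have := joined_hTwoGordian_span_zero_odd hK ho
    rw [← span_unknot] at this
    exact this.symm.adj (by rw [span_unknot]; omega)
  · have := joined_hTwoGordian_span_add_odd hK one_pos odd_one
    rw [← hK'] at this
    exact this.adj (by omega)
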